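/- **Setting.** Let $X$ be a measurable space, $Y$ a real separable Hilbert space, and $\mathcal H$ a real RKHS of functions on $X$ with reproducing kernel $k$, where each $k(\cdot,t)$ is measurable and $k(x,x)\le\kappa^2$ for all $x$. Let $\mathcal G$ be the $Y$-valued RKHS with kernel $K(x,t)=k(x,t)\,\mathrm{Id}_Y$, and write $K_x:Y\to\mathcal G$ for the adjoint of the evaluation $f\mapsto f(x)$. Let $p_X,q_X$ be probability measures on $X$ with $dq_X=\beta\,dp_X$, where $\beta$ is measurable and $0\le\beta\le b$. Let $\mathcal K$ be a Markov kernel from $X$ to $Y$ and let $p(dx,dy)=\mathcal K(dy,x)\,p_X(dx)$. Assume $\|y\|_Y\le M'$ for $p$-almost every $(x,y)$. Let $f^*(x)=\int_Y y\,\mathcal K(dy,x)$ be the regression function and let $$C_X=\mathbb E_{x\sim q_X}[k(x,\cdot)\otimes k(x,\cdot)]:\mathcal H\to\mathcal H .$$ *Source condition.* Let $\varphi$ be an index function, i.e. $\varphi:[0,\infty)\to[0,\infty)$ is continuous and strictly increasing with $\varphi(0)=0$. Assume that $f^*$ coincides $q_X$-almost everywhere with an element of $\mathcal G$, again denoted $f^*$,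 of the form $f^*(x)=C_*k(x,\cdot)$ for all $x\in X$, where $C_*=C_o\,\varphi(C_X)$ and $C_*,C_o:\mathcal H\to Y$ are Hilbert–Schmidt. *Eigenvalue decay.* Assume that $\mathcal H$ has an orthonormal basis $(f_i)_{i\ge1}$ with $C_Xf_i=\mu_if_i$, $\mu_i>0$, and that for some $a>1$ and $l,u>0$ one has $l\,i^{-a}\le\mu_i\le u\,i^{-a}$ for all $i\ge1$. *Regularization.* Let $s\ge b\kappa^2$ and let $g_\lambda:[0,s]\to\mathbb R$, $0<\lambda\le s$, be a regularization family: there are $D,B>0$ with $|\sigma g_\lambda(\sigma)|\le D$ and $|g_\lambda(\sigma)|\le B/\lambda$ for all $\sigma,\lambda\in(0,s]$. An exponent $\nu>0$ is called *admissible* if for some $\gamma_\nu>0$ one has $|1-\sigma g_\lambda(\sigma)|\,\sigma^\nu\le\gamma_\nu\lambda^\nu$ for all $\sigma,\lambda\in(0,s]$ (the qualification of the family is the largest admissible exponent, if there is one). The exponent $\nu$ *covers* an index function $\psi$ if there is $c>0$ with $c\,t^\nu/\psi(t)\le\sigma^\nu/\psi(\sigma)$ whenever $0<t\le\sigma\le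 s$. *Estimator.* For $\mathbf z=((x_i,y_i))_{i=1}^n$ drawn i.i.d. from $p$ put $$\widehat f_{\mathbf z,\lambda}=g_\lambda(\widehat T)\Big(\frac1n\sum_{i=1}^n\beta(x_i)K_{x_i}y_i\Big),\qquad \widehat T=\frac1n\sum_{i=1}^n\beta(x_i)K_{x_i}K_{x_i}^*:\mathcal G\to\mathcal G .$$ **Theorem.** Let $\Psi(t)=t^{\frac12+\frac1{2a}}\varphi(t)$ for $t\ge0$. (i) If some admissible exponent $\nu$ covers $\varphi$, then there is a constant $c_1>0$ such that for all $n\ge1$ and $\delta\in(0,1)$ for which $\lambda=\Psi^{-1}(n^{-1/2})$ satisfies $\lambda\le1$ and $\lambda\le s$, with probability at least $1-\delta$, $$\|f^*-\widehat f_{\mathbf z,\lambda}\|_{\mathcal G}\le c_1\,\varphi\big(\Psi^{-1}(n^{-1/2})\big)\log\frac2\delta .$$ (ii) If some admissible exponent $\nu$ covers $t\mapsto\varphi(t)\sqrt t$, then there is a constant $c_2>0$ such that for all such $n,\delta$ and $\lambda=\Psi^{-1}(n^{-1/2})$, with probability at least $1-\delta$, $$\|f^*-\widehat f_{\mathbf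 z,\lambda}\|_{L_2(q_X,Y)}\le c_2\,\big(\Psi^{-1}(n^{-1/2})\big)^{1/2}\,\varphi\big(\Psi^{-1}(n^{-1/2})\big)\log\frac2\delta .$$ The constants $c_1,c_2$ do not depend on $n$, $\delta$, $\lambda$ or the sample. -/

import Mathlib

open MeasureTheory ProbabilityTheory Set
open scoped ENNReal

noncomputable section

/-- The function `f(T) = ∑ₘ f(m) P_{ker (T - m)}` of a self-adjoint operator `T` whose eigenvectors
span a dense subspace (for instance, a compact self-adjoint operator). The sum runs over all real
`m`; the terms for which `m` is not an eigenvalue vanish. -/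
def spectralApply {E : Type*} [NormedAddCommGroup E] [InnerProductSpace ℝ E] [CompleteSpace E]
    (f : ℝ → ℝ) (T : E →L[ℝ] E) (v : E) : E :=
  ∑' m : ℝ, f m • (T - m • ContinuousLinearMap.id ℝ E).ker.starProjection v

/-- Hilbert–Schmidt operators: `∑ ‖A e‖² < ∞` over an orthonormal (Hilbert) basis. -/
def IsHilbertSchmidt {E F : Type*} [NormedAddCommGroup E] [InnerProductSpace ℝ E]
    [NormedAddCommGroup F] [InnerProductSpace ℝ F] (A : E →L[ℝ] F) : Prop :=
  ∃ (S : Set E) (e : HilbertBasis S ℝ E), Summable fun i => ‖A (e i)‖ ^ 2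

/-- An index function `φ : [0,∞) → [0,∞)`: continuous, strictly increasing, zero at zero. Only the
values on `[0,∞)` matter. -/
structure IsIndexFunction (φ : ℝ → ℝ) : Prop where
  continuousOn : ContinuousOn φ (Ici 0)
  strictMonoOn : StrictMonoOn φ (Ici 0)
  map_zero : φ 0 = 0

/-- A regularization family `g lam : [0,s] → ℝ`, `0 < lam ≤ s`. -/
structure IsRegularizationFamily (s : ℝ) (g : ℝ → ℝ → ℝ) : Prop where
  bound_mul : ∃ D > 0, ∀ lam ∈ Ioc 0 s, ∀ σ ∈ Ioc 0 s, |σ * g lam σ| ≤ D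
  bound : ∃ B > 0, ∀ lam ∈ Ioc 0 s, ∀ σ ∈ Ioc 0 s, |g lam σ| ≤ B / lam

/-- The qualification inequality of the regularization family `g` with exponent `ν`. The
qualification of the family is the largest such `ν`. -/
def QualificationHolds (s : ℝ) (g : ℝ → ℝ → ℝ) (ν : ℝ) : Prop :=
  0 < ν ∧ ∃ γν > 0, ∀ lam ∈ Ioc 0 s, ∀ σ ∈ Ioc 0 s,
    |1 - σ * g lam σ| * σ ^ ν ≤ γν * lam ^ ν

/-- The exponent `ν` covers the index function `φ` on `(0,s]`. -/
def Covers (s ν : ℝ) (φ : ℝ → ℝ) : Prop :=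
  ∃ c > 0, ∀ t ∈ Ioc 0 s, ∀ σ ∈ Icc t s, c * (t ^ ν / φ t) ≤ σ ^ ν / φ σ

/-- `Ψ(t) = t^{1/2 + 1/(2a)} φ(t)`. -/
def Psi (φ : ℝ → ℝ) (a t : ℝ) : ℝ := t ^ (1 / 2 + 1 / (2 * a)) * φ t

/-- The inverse of `Ψ : [0,∞) → [0,∞)`. -/
def psiInv (φ : ℝ → ℝ) (a : ℝ) : ℝ → ℝ := Function.invFunOn (Psi φ a) (Ici 0)

/-- The regression function `f*(x) = ∫ y 𝒦(dy, x)`. -/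
def regressionFunction {X Y : Type*} [MeasurableSpace X] [NormedAddCommGroup Y]
    [InnerProductSpace ℝ Y] [MeasurableSpace Y] (𝒦 : Kernel X Y) (x : X) : Y :=
  ∫ y, y ∂(𝒦 x)

section Scalar

variable {X : Type*} (H : Type*) [NormedAddCommGroup H] [InnerProductSpace ℝ H] [CompleteSpace H]
  [RKHS ℝ H X ℝ]

/-- The feature map `x ↦ k(x, ·)` of a scalar reproducing kernel Hilbert space. -/
def featureMap (x : X) : H := RKHS.kerFun H x (1 : ℝ)

/-- The scalar reproducing kernel `k(x, t)` of `H`. -/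
def scalarKernel (x t : X) : ℝ := RKHS.kernel H x t (1 : ℝ)

/-- The covariance operator `C_X = E_{x ∼ q_X} [k(x, ·) ⊗ k(x, ·)]`. -/
def covarianceOp [MeasurableSpace X] (qX : Measure X) : H →L[ℝ] H :=
  ∫ x, InnerProductSpace.rankOne ℝ (featureMap H x) (featureMap H x) ∂qX

end Scalar

section Estimator

variable {X Y : Type*} [NormedAddCommGroup Y] [InnerProductSpace ℝ Y] [CompleteSpace Y]
  (G : Type*) [NormedAddCommGroup G] [InnerProductSpace ℝ G] [CompleteSpace G] [RKHS ℝ G X Y]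

/-- The operator `S* B S = (1/n) ∑ᵢ β(xᵢ) K_{xᵢ} K_{xᵢ}*` on `G`; note `K_x* f = f(x)`. -/
def empiricalOp (β : X → ℝ) {n : ℕ} (z : Fin n → X × Y) : G →L[ℝ] G :=
  (n : ℝ)⁻¹ • ∑ i, β (z i).1 •
    (RKHS.kerFun G (z i).1 ∘L ContinuousLinearMap.adjoint (RKHS.kerFun G (z i).1))

/-- The vector `S* B y = (1/n) ∑ᵢ β(xᵢ) K_{xᵢ} yᵢ` of `G`. -/
def empiricalRHS (β : X → ℝ) {n : ℕ} (z : Fin n → X × Y) : G :=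
  (n : ℝ)⁻¹ • ∑ i, β (z i).1 • RKHS.kerFun G (z i).1 (z i).2

/-- The regularized estimator `g_lam(S* B S) S* B y`. -/
def estimator (g : ℝ → ℝ → ℝ) (β : X → ℝ) (lam : ℝ) {n : ℕ} (z : Fin n → X × Y) : G :=
  spectralApply (g lam) (empiricalOp G β z) (empiricalRHS G β z)

end Estimator

/-- The general source condition: the element `f` of `G` is `f(x) = C_* k(x, ·)` with a
Hilbert–Schmidt operator `C_* = C_o φ(C_X)`, where `C_o : H → Y` is Hilbert–Schmidt. -/
def SourceCondition {X Y : Type*} [MeasurableSpace X]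
    [NormedAddCommGroup Y] [InnerProductSpace ℝ Y]
    (H : Type*) [NormedAddCommGroup H] [InnerProductSpace ℝ H] [CompleteSpace H] [RKHS ℝ H X ℝ]
    {G : Type*} [NormedAddCommGroup G] [InnerProductSpace ℝ G] [RKHS ℝ G X Y]
    (qX : Measure X) (φ : ℝ → ℝ) (f : G) : Prop :=
  ∃ Cstar Co : H →L[ℝ] Y, IsHilbertSchmidt Cstar ∧ IsHilbertSchmidt Co ∧
    (∀ x, f x = Cstar (featureMap H x)) ∧
    ∀ h, Cstar h = Co (spectralApply φ (covarianceOp H qX) h)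

end

/-! Notation: C is the covariance operator, Ĉ its β-weighted empirical version on `H`, L = log(2/δ),
N(λ) = ∑ μᵢ/(μᵢ + λ) the effective dimension.

Reduction to scalar operators. Since the kernel of `G` is scalar, `G` is `H ⊗ Y`. Along an
orthonormal basis cⱼ of `Y` an element of `G` splits into components in `H` (`rkhsComp`,
`tensorBasis`), and the empirical operator is Ĉ ⊗ Id (`empiricalOp_rkhsTensor`). The source
condition says that the j-th component of f* is φ(C) C_o* cⱼ. With r(t) = 1 - t g_λ(t), the j-th
component of the error is therefore r(Ĉ) φ(C) C_o* cⱼ - g_λ(Ĉ) ξⱼ, where ξⱼ is a component of the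
noise (`rkhsComp_sub_estimator`). The bias is square-summable over j because C_o is Hilbert–Schmidt;
the noise sums to one finite quadratic form, `noiseForm`.

Source of the rates. The choice of λ means 1/n = λ^(1+1/a) φ(λ)², and the eigenvalue decay gives
N(λ) ≲ λ^(-1/a). Hence N(λ)/n ≲ λ φ(λ)².

Bias. For a general index function, φ(Ĉ) - φ(C) cannot be estimated usefully. Instead |r| is
dominated by a multiple of F(t) = ∑ⱼ 2^(-νj) (2^j λ/(t + 2^j λ))^k, comparable to min(1, λ/t)^ν
(`le_dyadicFilter`). Being built from resolvents, F(Ĉ) - F(C) is controlled by the resolvent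
identity and by (Ĉ + s)⁻¹(Ĉ - C) for s ≥ λ, while the covering property gives F(C) φ(C) ≲ φ(λ)
(`norm_diag_residual_le`). A Bernstein inequality in Hilbert–Schmidt norm shows that (C +
λ)^(-1/2)(Ĉ - C) is of order √λ φ(λ), so the exchange of Ĉ for C also costs only O(φ(λ)).

Noise. Given the inputs, the residuals yᵢ - f*(xᵢ) are independent, centred and bounded. The
exponential moment of the squared norm of their weighted sum is bounded in
`lintegral_exp_norm_sq_le`, where the trace that appears is the empirical effective dimension.

Arbitrary δ. No lower bound on n in terms of δ is available, so C and Ĉ need not be comparable at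
level λ. They are compared at level ωλ with ω = 1 + O(L φ(λ)²), which costs a factor √ω ≲ √L and
keeps the result linear in L. The L₂(q_X) norm is bounded through the weight (Ĉ + ωλ)^(1/2). This
lowers the exponent ν to ν - 1/2 and costs another √ω, which is compensated by playing the bias
estimate against a trivial one (`sqrt_enlargement_mul_min_le`). -/

noncomputable section

/-! ### Operators diagonal in a Hilbert basis. -/

section Diagonal

variable {ι E : Type*} [NormedAddCommGroup E] [InnerProductSpace ℝ E]

theorem HilbertBasis.hasSum_inner_sq (b : HilbertBasis ι ℝ E) (x : E) :
    HasSum (fun i => inner ℝ (b i) x ^ 2) (‖x‖ ^ 2) := by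
  have h := b.hasSum_inner_mul_inner x x
  rw [real_inner_self_eq_norm_sq] at h
  refine h.congr_fun fun i => ?_
  rw [sq, real_inner_comm x (b i)]

theorem HilbertBasis.hasSum_inner_smul (b : HilbertBasis ι ℝ E) (x : E) :
    HasSum (fun i => inner ℝ (b i) x • b i) x :=
  (b.hasSum_repr x).congr_fun fun i => by rw [b.repr_apply_apply]

theorem HilbertBasis.ext_inner (b : HilbertBasis ι ℝ E) {x y : E}
    (h : ∀ i, inner ℝ (b i) x = inner ℝ (b i) y) : x = y := by
  apply b.repr.injective
  ext i
  simpa [b.repr_apply_apply] using h i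

theorem HilbertBasis.memℓp_mul (b : HilbertBasis ι ℝ E) {f : ι → ℝ} {C : ℝ} (hf : ∀ i, |f i| ≤ C)
    (x : E) : Memℓp (fun i => f i * b.repr x i) 2 := by
  apply memℓp_gen
  have h := (b.hasSum_inner_sq x).summable.mul_left (C ^ 2)
  refine Summable.of_nonneg_of_le (fun i => by positivity) (fun i => ?_) h
  simp only [ENNReal.toReal_ofNat, Real.rpow_two, b.repr_apply_apply, norm_mul, mul_pow,
    Real.norm_eq_abs, sq_abs]
  have := sq_le_sq.2 ((hf i).trans (le_abs_self C))
  nlinarith [sq_nonneg (inner ℝ (b i) x)]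

open Classical in
/-- The bounded operator with eigenvectors `b i` and eigenvalues `f i`; zero if `f` is unbounded. -/
def HilbertBasis.diag (b : HilbertBasis ι ℝ E) (f : ι → ℝ) : E →L[ℝ] E :=
  if hf : ∃ C, ∀ i, |f i| ≤ C then
    LinearMap.mkContinuous
      { toFun := fun x => b.repr.symm ⟨fun i => f i * b.repr x i, b.memℓp_mul hf.choose_spec x⟩
        map_add' := fun x y => by
          apply b.repr.injective
          ext i
          simp only [map_add, LinearIsometryEquiv.apply_symm_apply, lp.coeFn_add, Pi.add_apply]
          exact mul_add _ _ _
        map_smul' := fun c x => by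
          apply b.repr.injective
          ext i
          simp [mul_left_comm] }
      |hf.choose| (fun x => by
        apply abs_le_of_sq_le_sq' _ (by positivity) |>.2
        simp only [LinearMap.coe_mk, AddHom.coe_mk]
        rw [mul_pow]
        have h1 := b.hasSum_inner_sq
          (b.repr.symm ⟨fun i => f i * b.repr x i, b.memℓp_mul hf.choose_spec x⟩)
        have h2 := (b.hasSum_inner_sq x).mul_left (|hf.choose| ^ 2)
        refine hasSum_le (fun i => ?_) h1 h2
        rw [← b.repr_apply_apply, ← b.repr_apply_apply, LinearIsometryEquiv.apply_symm_apply]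
        simp only [mul_pow]
        have := sq_le_sq.2 (((hf.choose_spec i).trans (le_abs_self _)).trans (le_abs_self _))
        gcongr)
  else 0

variable (b : HilbertBasis ι ℝ E)

theorem HilbertBasis.inner_diag {f : ι → ℝ} (hf : ∃ C, ∀ i, |f i| ≤ C) (x : E) (i : ι) :
    inner ℝ (b i) (b.diag f x) = f i * inner ℝ (b i) x := by
  rw [HilbertBasis.diag, dif_pos hf, ← b.repr_apply_apply, ← b.repr_apply_apply]
  simp

theorem HilbertBasis.hasSum_norm_diag_sq {f : ι → ℝ} (hf : ∃ C, ∀ i, |f i| ≤ C) (x : E) :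
    HasSum (fun i => f i ^ 2 * inner ℝ (b i) x ^ 2) (‖b.diag f x‖ ^ 2) := by
  refine (b.hasSum_inner_sq _).congr_fun fun i => ?_
  rw [b.inner_diag hf, mul_pow]

theorem HilbertBasis.hasSum_inner_diag {f : ι → ℝ} (hf : ∃ C, ∀ i, |f i| ≤ C) (x y : E) :
    HasSum (fun i => f i * (inner ℝ (b i) x * inner ℝ (b i) y)) (inner ℝ x (b.diag f y)) := by
  refine (b.hasSum_inner_mul_inner _ _).congr_fun fun i => ?_
  rw [b.inner_diag hf, real_inner_comm x]
  ring

theorem HilbertBasis.inner_diag_comm {f : ι → ℝ} (hf : ∃ C, ∀ i, |f i| ≤ C) (x y : E) :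
    inner ℝ (b.diag f x) y = inner ℝ x (b.diag f y) := by
  rw [real_inner_comm]
  refine (b.hasSum_inner_diag hf y x).unique ((b.hasSum_inner_diag hf x y).congr_fun fun i => ?_)
  ring

theorem HilbertBasis.diag_comp {f g : ι → ℝ} (hf : ∃ C, ∀ i, |f i| ≤ C) (hg : ∃ C, ∀ i, |g i| ≤ C)
    (x : E) : b.diag f (b.diag g x) = b.diag (fun i => f i * g i) x := by
  have hfg : ∃ C, ∀ i, |f i * g i| ≤ C := by
    obtain ⟨C, hC⟩ := hf
    obtain ⟨D, hD⟩ := hg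
    refine ⟨C * D, fun i => ?_⟩
    rw [abs_mul]
    exact mul_le_mul (hC i) (hD i) (abs_nonneg _) ((abs_nonneg _).trans (hC i))
  refine b.ext_inner fun i => ?_
  rw [b.inner_diag hf, b.inner_diag hg, b.inner_diag hfg, mul_assoc]

theorem HilbertBasis.norm_diag_le_norm_diag {f g : ι → ℝ} (hg : ∃ C, ∀ i, |g i| ≤ C)
    (hfg : ∀ i, |f i| ≤ |g i|) (x : E) : ‖b.diag f x‖ ≤ ‖b.diag g x‖ := by
  have hf : ∃ C, ∀ i, |f i| ≤ C := hg.imp fun C hC i => (hfg i).trans (hC i)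
  refine abs_le_of_sq_le_sq' (hasSum_le (fun i => ?_) (b.hasSum_norm_diag_sq hf x)
    (b.hasSum_norm_diag_sq hg x)) (norm_nonneg _) |>.2
  have := sq_le_sq.2 (hfg i)
  gcongr

theorem HilbertBasis.norm_diag_le {f : ι → ℝ} {C : ℝ} (hC : 0 ≤ C) (hf : ∀ i, |f i| ≤ C) (x : E) :
    ‖b.diag f x‖ ≤ C * ‖x‖ := by
  refine abs_le_of_sq_le_sq' ?_ (by positivity) |>.2
  rw [mul_pow]
  refine hasSum_le (fun i => ?_) (b.hasSum_norm_diag_sq ⟨C, hf⟩ x)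
    ((b.hasSum_inner_sq x).mul_left (C ^ 2))
  have := sq_le_sq.2 ((hf i).trans (le_abs_self C))
  gcongr

/-- The bound on `t` is part of the conclusion because `HilbertBasis.diag` carries information only
for bounded sequences. -/
theorem HilbertBasis.eq_diag {A : E →L[ℝ] E} (hA : ∀ x y, inner ℝ (A x) y = inner ℝ x (A y))
    {t : ι → ℝ} (ht : ∀ i, A (b i) = t i • b i) :
    (∃ C, ∀ i, |t i| ≤ C) ∧ A = b.diag t := by
  have hb : ∃ C, ∀ i, |t i| ≤ C := by
    refine ⟨‖A‖, fun i => ?_⟩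
    have h := A.le_opNorm (b i)
    rwa [ht i, norm_smul, b.orthonormal.1 i, mul_one, mul_one, Real.norm_eq_abs] at h
  refine ⟨hb, ?_⟩
  ext x
  refine b.ext_inner fun i => ?_
  rw [b.inner_diag hb, ← hA, ht, inner_smul_left]
  rfl

/-- The operator agrees with a diagonal one on the basis, hence on the closure of its span, and
inherits the symmetry. -/
theorem HilbertBasis.isSymmetric_of_eigen {A : E →L[ℝ] E} {t : ι → ℝ}
    (ht : ∀ i, A (b i) = t i • b i) (x y : E) : inner ℝ (A x) y = inner ℝ x (A y) := by
  have hb : ∃ C, ∀ i, |t i| ≤ C := by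
    refine ⟨‖A‖, fun i => ?_⟩
    have h := A.le_opNorm (b i)
    rwa [ht i, norm_smul, b.orthonormal.1 i, mul_one, mul_one, Real.norm_eq_abs] at h
  have hA : A = b.diag t := by
    refine ContinuousLinearMap.ext_on
      (s := Set.range b) ?_ ?_
    · rw [dense_iff_closure_eq]
      have := b.dense_span
      rw [← Submodule.topologicalClosure_coe, this]
      rfl
    · rintro _ ⟨i, rfl⟩
      refine b.ext_inner fun j => ?_
      rw [b.inner_diag hb, ht i, inner_smul_right]
      by_cases hij : j = i
      · rw [hij]
      · rw [b.orthonormal.2 hij]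
        simp
  rw [hA, b.inner_diag_comm hb]

end Diagonal

/-! ### Functional calculus through eigenbases. -/

section SpectralApply

variable {ι E : Type*} [NormedAddCommGroup E] [InnerProductSpace ℝ E] [CompleteSpace E]

open Classical in
-- The eigenspace for `m` consists of the vectors whose coordinates are supported on the fibre `t =
-- m`.
theorem starProjection_ker_diag (b : HilbertBasis ι ℝ E) {t : ι → ℝ} (ht : ∃ C, ∀ i, |t i| ≤ C)
    (m : ℝ) (x : E) :
    (b.diag t - m • ContinuousLinearMap.id ℝ E).ker.starProjection x
      = b.diag (fun i => if t i = m then 1 else 0) x := by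
  have hi : ∃ C, ∀ i, |if t i = m then (1 : ℝ) else 0| ≤ C :=
    ⟨1, fun i => by split_ifs <;> simp⟩
  apply Submodule.eq_starProjection_of_mem_of_inner_eq_zero
  · rw [LinearMap.mem_ker]
    refine b.ext_inner fun i => ?_
    simp only [ContinuousLinearMap.coe_coe, _root_.sub_apply,
      _root_.smul_apply, ContinuousLinearMap.id_apply, inner_sub_right,
      inner_smul_right, inner_zero_right]
    rw [b.inner_diag ht, b.inner_diag hi]
    split_ifs with h
    · rw [h]; ring
    · ring
  · intro u hu
    rw [LinearMap.mem_ker] at hu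
    have h := b.hasSum_inner_mul_inner (x - b.diag (fun i => if t i = m then 1 else 0) x) u
    refine h.unique ?_
    convert hasSum_zero using 2 with i
    have hu' : inner ℝ (b i) ((b.diag t - m • ContinuousLinearMap.id ℝ E) u) = 0 := by
      rw [ContinuousLinearMap.coe_coe] at hu
      rw [hu, inner_zero_right]
    simp only [_root_.sub_apply,
      _root_.smul_apply, ContinuousLinearMap.id_apply, inner_sub_right,
      inner_smul_right] at hu'
    rw [b.inner_diag ht, ← sub_mul] at hu'
    rw [real_inner_comm, inner_sub_right, b.inner_diag hi]
    rcases mul_eq_zero.1 hu' with h | h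
    · rw [if_pos (sub_eq_zero.1 h)]; ring
    · rw [h]; ring

/-- The sum over real `m` regroups the basis expansion of the right-hand side along the fibres of
`t`; a number that is not an eigenvalue has an empty fibre. -/
theorem spectralApply_diag (b : HilbertBasis ι ℝ E) {t : ι → ℝ} (ht : ∃ C, ∀ i, |t i| ≤ C)
    {f : ℝ → ℝ} (hf : ∃ C, ∀ i, |f (t i)| ≤ C) (x : E) :
    spectralApply f (b.diag t) x = b.diag (fun i => f (t i)) x := by
  classical
  have hi : ∀ m : ℝ, ∃ C, ∀ i, |if t i = m then (1 : ℝ) else 0| ≤ C :=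
    fun m => ⟨1, fun i => by split_ifs <;> simp⟩
  rw [spectralApply]
  set v := b.diag (fun i => f (t i)) x with hv
  have h1 := (b.hasSum_inner_smul v).tsum_fiberwise t
  refine HasSum.tsum_eq (h1.congr_fun fun m => ?_)
  rw [starProjection_ker_diag b ht]
  have h2 : HasSum (fun i : t ⁻¹' {m} => inner ℝ (b i) v • b i)
      (b.diag (fun i => if t i = m then 1 else 0) v) := by
    refine (hasSum_subtype_iff_indicator (f := fun i => inner ℝ (b i) v • b i)).2 ?_
    refine (b.hasSum_inner_smul _).congr_fun fun i => ?_
    rw [b.inner_diag (hi m)]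
    by_cases h : t i = m
    · rw [indicator_of_mem (show i ∈ t ⁻¹' {m} from h), if_pos h, one_mul]
    · rw [indicator_of_notMem (show i ∉ t ⁻¹' {m} from h), if_neg h, zero_mul, zero_smul]
  rw [h2.tsum_eq]
  refine b.ext_inner fun i => ?_
  rw [inner_smul_right, b.inner_diag (hi m), b.inner_diag (hi m), hv, b.inner_diag hf]
  split_ifs with h
  · rw [h]; ring
  · ring

/-- Diagonalise on the finite-dimensional range and extend the eigenvectors to a Hilbert basis. A
vector `b` added in the extension is orthogonal to the range, so ‖A b‖² = ⟪b, A (A b)⟫ = 0. -/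
theorem exists_hilbertBasis_eigen {A : E →L[ℝ] E} (hA : ∀ x y, inner ℝ (A x) y = inner ℝ x (A y))
    [FiniteDimensional ℝ A.range] :
    ∃ (w : Set E) (b : HilbertBasis w ℝ E) (t : w → ℝ), ∀ i, A (b i) = t i • b i := by
  set W := A.range with hW
  have hmap : ∀ x ∈ W, A x ∈ W := fun x _ => ⟨x, rfl⟩
  set B : W →ₗ[ℝ] W := (A : E →ₗ[ℝ] E).restrict hmap
  have hB : B.IsSymmetric := fun x y => hA x y
  set v := hB.eigenvectorBasis rfl
  have hv : Orthonormal ℝ (fun i => ((v i : W) : E)) :=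
    v.orthonormal.comp_linearIsometry W.subtypeₗᵢ
  obtain ⟨w, b, hs, hb⟩ := hv.toSubtypeRange.exists_hilbertBasis_extension
  have key : ∀ i : w, ∃ c : ℝ, A (b i) = c • b i := by
    intro i
    by_cases hi : (i : E) ∈ Set.range (fun i => ((v i : W) : E))
    · obtain ⟨j, hj⟩ := hi
      refine ⟨hB.eigenvalues rfl j, ?_⟩
      have := hB.apply_eigenvectorBasis rfl j
      have h2 := congrArg (fun z : W => (z : E)) this
      rw [hb]
      simp only at hj
      rw [← hj]
      exact h2
    · refine ⟨0, ?_⟩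
      rw [zero_smul]
      have horth : ∀ y ∈ W, inner ℝ (b i) y = 0 := by
        intro y hy
        have := v.sum_repr ⟨y, hy⟩
        have h2 := congrArg (fun z : W => (z : E)) this
        simp only [AddSubmonoidClass.coe_finsetSum, Submodule.coe_smul] at h2
        rw [← h2, inner_sum]
        refine Finset.sum_eq_zero fun j _ => ?_
        rw [inner_smul_right]
        have hj : ((v j : W) : E) ∈ w := hs ⟨j, rfl⟩
        have hne : i ≠ ⟨_, hj⟩ := by
          rintro rfl
          exact hi ⟨j, rfl⟩
        have := b.orthonormal.2 hne
        rw [hb] at this ⊢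
        rw [this, mul_zero]
      have : inner ℝ (A (b i)) (A (b i)) = 0 := by
        rw [hA]
        exact horth _ ⟨_, rfl⟩
      exact inner_self_eq_zero.1 this
  choose t ht using key
  exact ⟨w, b, t, ht⟩

end SpectralApply

/-! ### The vector-valued space as a tensor product. -/

section Tensor

variable {X Y H G : Type*}
  [NormedAddCommGroup Y] [InnerProductSpace ℝ Y] [CompleteSpace Y]
  [NormedAddCommGroup H] [InnerProductSpace ℝ H] [CompleteSpace H] [RKHS ℝ H X ℝ]
  [NormedAddCommGroup G] [InnerProductSpace ℝ G] [CompleteSpace G] [RKHS ℝ G X Y]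

theorem inner_featureMap (x : X) (h : H) : inner ℝ (featureMap H x) h = h x := by
  rw [featureMap, RKHS.kerFun_inner]
  simp

theorem featureMap_apply (t x : X) : featureMap H t x = scalarKernel H x t := by
  rw [featureMap, RKHS.kerFun_apply, scalarKernel]

theorem inner_featureMap_featureMap (x t : X) :
    inner ℝ (featureMap H x) (featureMap H t) = scalarKernel H x t := by
  rw [inner_featureMap, featureMap_apply]

theorem norm_featureMap_sq (x : X) : ‖featureMap H x‖ ^ 2 = scalarKernel H x x := by
  rw [← inner_featureMap_featureMap, real_inner_self_eq_norm_sq]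

theorem kerFun_eq_smul_featureMap (x : X) (c : ℝ) : RKHS.kerFun H x c = c • featureMap H x := by
  rw [featureMap, ← map_smul, smul_eq_mul, mul_one]

theorem dense_span_featureMap :
    (Submodule.span ℝ (Set.range (featureMap H (X := X)))).topologicalClosure = ⊤ := by
  refine top_le_iff.1 ?_
  rw [← RKHS.kerFun_dense (𝕜 := ℝ) (X := X) (V := ℝ) H]
  refine Submodule.topologicalClosure_mono (Submodule.span_le.2 ?_)
  rintro _ ⟨x, c, rfl⟩
  rw [kerFun_eq_smul_featureMap]
  exact Submodule.smul_mem _ _ (Submodule.subset_span ⟨x, rfl⟩)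

/-- The kernel of `G` is the scalar kernel of `H` times the identity. -/
def IsScalarKernelExtension (H G : Type*) {X Y : Type*}
    [NormedAddCommGroup Y] [InnerProductSpace ℝ Y] [CompleteSpace Y]
    [NormedAddCommGroup H] [InnerProductSpace ℝ H] [CompleteSpace H] [RKHS ℝ H X ℝ]
    [NormedAddCommGroup G] [InnerProductSpace ℝ G] [CompleteSpace G] [RKHS ℝ G X Y] : Prop :=
  ∀ x t, RKHS.kernel G x t = scalarKernel H x t • ContinuousLinearMap.id ℝ Y

/-- For a kernel section at `t` the element is `K_t y`, and the reproducing property gives its inner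
product with any element of the form `h' ⊗ y`. Carrying this formula through the induction is what
later fixes the norm of `h ⊗ y`. -/
theorem exists_tensor_of_mem_span (hG : IsScalarKernelExtension H G) (y : Y) {h : H}
    (hh : h ∈ Submodule.span ℝ (Set.range (featureMap H (X := X)))) :
    ∃ f : G, (∀ x, f x = h x • y) ∧
      ∀ (h' : H) (f' : G), (∀ x, f' x = h' x • y) → inner ℝ f f' = ‖y‖ ^ 2 * inner ℝ h h' := by
  induction hh using Submodule.span_induction with
  | mem h hh =>
    obtain ⟨t, rfl⟩ := hh
    refine ⟨RKHS.kerFun G t y, fun x => ?_, fun h' f' hf' => ?_⟩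
    · rw [RKHS.kerFun_apply, hG, featureMap_apply]
      simp
    · rw [RKHS.kerFun_inner, hf', inner_smul_right, inner_featureMap, real_inner_self_eq_norm_sq,
        mul_comm]
  | zero =>
    refine ⟨0, fun x => by simp, fun h' f' _ => by simp⟩
  | add h₁ h₂ _ _ ih₁ ih₂ =>
    obtain ⟨f₁, hf₁, hi₁⟩ := ih₁
    obtain ⟨f₂, hf₂, hi₂⟩ := ih₂
    refine ⟨f₁ + f₂, fun x => by simp [hf₁, hf₂, add_smul], fun h' f' hf' => ?_⟩
    rw [inner_add_left, inner_add_left, hi₁ h' f' hf', hi₂ h' f' hf', mul_add]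
  | smul c h _ ih =>
    obtain ⟨f, hf, hi⟩ := ih
    refine ⟨c • f, fun x => by simp [hf, mul_smul], fun h' f' hf' => ?_⟩
    rw [inner_smul_left, inner_smul_left, hi h' f' hf']
    simp only [conj_trivial]
    ring

/-- On the dense span, `h ↦ h ⊗ y` multiplies norms by ‖y‖. Approximants of `h` thus give a Cauchy
sequence in `G`, whose limit is identified pointwise by continuity of evaluation. -/
theorem exists_tensor (hG : IsScalarKernelExtension H G) (h : H) (y : Y) :
    ∃ f : G, (∀ x, f x = h x • y) ∧ ‖f‖ = ‖h‖ * ‖y‖ := by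
  have hd : h ∈ closure (Submodule.span ℝ (Set.range (featureMap H (X := X))) : Set H) := by
    rw [← Submodule.topologicalClosure_coe, dense_span_featureMap]
    trivial
  obtain ⟨u, hu, hlim⟩ := mem_closure_iff_seq_limit.1 hd
  choose f hf hi using fun n => exists_tensor_of_mem_span (G := G) hG y (hu n)
  have hnorm : ∀ (h : H) (f : G), h ∈ Submodule.span ℝ (Set.range (featureMap H (X := X))) →
      (∀ x, f x = h x • y) → ‖f‖ = ‖h‖ * ‖y‖ := by
    intro h f hh hf
    obtain ⟨f', hf', hi'⟩ := exists_tensor_of_mem_span (G := G) hG y hh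
    have : f' = f := RKHS.ext fun x => by rw [hf', hf]
    subst this
    have h1 := hi' h f' hf'
    rw [real_inner_self_eq_norm_sq, real_inner_self_eq_norm_sq, ← mul_pow, mul_comm] at h1
    exact (pow_left_inj₀ (by positivity) (by positivity) two_ne_zero).1 h1
  have hcau : CauchySeq f := by
    have hu' := hlim.cauchySeq
    rw [Metric.cauchySeq_iff] at hu' ⊢
    intro ε hε
    -- The `+ 1` covers the case `y = 0`.
    obtain ⟨N, hN⟩ := hu' (ε / (‖y‖ + 1)) (by positivity)
    refine ⟨N, fun m hm n hn => ?_⟩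
    have h1 : ‖f m - f n‖ = ‖u m - u n‖ * ‖y‖ :=
      hnorm _ _ (Submodule.sub_mem _ (hu m) (hu n)) fun x => by
        simp [hf, sub_smul]
    have h2 := hN m hm n hn
    rw [dist_eq_norm] at h2 ⊢
    rw [h1]
    rw [lt_div_iff₀ (by positivity)] at h2
    nlinarith [norm_nonneg (u m - u n)]
  obtain ⟨f₀, hf₀⟩ := cauchySeq_tendsto_of_complete hcau
  refine ⟨f₀, fun x => ?_, ?_⟩
  · have h1 := ((RKHS.continuous_eval (𝕜 := ℝ) (H := G) x).tendsto f₀).comp hf₀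
    have h2 := (((RKHS.continuous_eval (𝕜 := ℝ) (H := H) x).tendsto h).comp hlim).smul_const y
    refine tendsto_nhds_unique h1 (h2.congr fun n => ?_)
    simp [hf]
  · refine tendsto_nhds_unique hf₀.norm ((hlim.norm.mul_const ‖y‖).congr fun n => ?_)
    rw [hnorm _ _ (hu n) (hf n)]

/-- The element `x ↦ h(x) y` of `G`. -/
def tensorElem (hG : IsScalarKernelExtension H G) (h : H) (y : Y) : G :=
  (exists_tensor (G := G) hG h y).choose

theorem tensorElem_apply (hG : IsScalarKernelExtension H G) (h : H) (y : Y) (x : X) :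
    tensorElem hG h y x = h x • y :=
  (exists_tensor (G := G) hG h y).choose_spec.1 x

/-- The element `x ↦ h(x) y` of `G`, as a bounded bilinear map in `h` and `y`. -/
def rkhsTensor (hG : IsScalarKernelExtension H G) : H →L[ℝ] Y →L[ℝ] G :=
  LinearMap.mkContinuous₂
    (LinearMap.mk₂ ℝ (tensorElem hG)
      (fun h₁ h₂ y => RKHS.ext fun x => by simp [tensorElem_apply, add_smul])
      (fun c h y => RKHS.ext fun x => by simp [tensorElem_apply, mul_smul])
      (fun h y₁ y₂ => RKHS.ext fun x => by simp [tensorElem_apply])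
      (fun c h y => RKHS.ext fun x => by simp [tensorElem_apply, smul_comm c]))
    1 (fun h y => by
      rw [one_mul]
      exact (exists_tensor (G := G) hG h y).choose_spec.2.le)

variable (hG : IsScalarKernelExtension H G)

theorem rkhsTensor_apply (h : H) (y : Y) (x : X) : rkhsTensor hG h y x = h x • y :=
  (exists_tensor (G := G) hG h y).choose_spec.1 x

theorem norm_rkhsTensor (h : H) (y : Y) : ‖rkhsTensor hG h y‖ = ‖h‖ * ‖y‖ :=
  (exists_tensor (G := G) hG h y).choose_spec.2

theorem rkhsTensor_featureMap (x : X) (y : Y) :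
    rkhsTensor hG (featureMap H x) y = RKHS.kerFun G x y :=
  RKHS.ext fun t => by
    rw [rkhsTensor_apply, RKHS.kerFun_apply, hG, featureMap_apply]
    simp

/-- The element `x ↦ ⟪f(x), y⟫` of `H`, for `f` in `G`. -/
def rkhsComp (y : Y) : G →L[ℝ] H := ContinuousLinearMap.adjoint ((rkhsTensor hG).flip y)

theorem inner_rkhsComp (y : Y) (f : G) (h : H) :
    inner ℝ h (rkhsComp hG y f) = inner ℝ (rkhsTensor hG h y) f := by
  rw [rkhsComp, ContinuousLinearMap.adjoint_inner_right]
  rfl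

theorem rkhsComp_apply (y : Y) (f : G) (x : X) : rkhsComp hG y f x = inner ℝ y (f x) := by
  rw [← inner_featureMap, inner_rkhsComp, rkhsTensor_featureMap, RKHS.kerFun_inner]

theorem rkhsComp_rkhsTensor (y y' : Y) (h : H) :
    rkhsComp hG y (rkhsTensor hG h y') = inner ℝ y y' • h :=
  RKHS.ext fun x => by
    rw [rkhsComp_apply, rkhsTensor_apply, inner_smul_right]
    simp [mul_comm]

theorem inner_rkhsTensor (h h' : H) (y y' : Y) :
    inner ℝ (rkhsTensor hG h y) (rkhsTensor hG h' y') = inner ℝ h h' * inner ℝ y y' := by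
  rw [← inner_rkhsComp, rkhsComp_rkhsTensor, inner_smul_right, mul_comm]

theorem orthonormal_rkhsTensor {ι κ : Type*} {b : ι → H} {c : κ → Y} (hb : Orthonormal ℝ b)
    (hc : Orthonormal ℝ c) : Orthonormal ℝ fun p : ι × κ => rkhsTensor hG (b p.1) (c p.2) := by
  refine ⟨fun p => by rw [norm_rkhsTensor, hb.1, hc.1, one_mul], fun p q hpq => ?_⟩
  simp only [inner_rkhsTensor]
  by_cases h1 : p.1 = q.1
  · have h2 : p.2 ≠ q.2 := fun h2 => hpq (Prod.ext h1 h2)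
    rw [hc.2 h2, mul_zero]
  · rw [hb.2 h1, zero_mul]

theorem rkhsTensor_orthogonal_eq_bot {ι κ : Type*} (b : HilbertBasis ι ℝ H)
    (c : HilbertBasis κ ℝ Y) :
    (Submodule.span ℝ (Set.range fun p : ι × κ => rkhsTensor hG (b p.1) (c p.2)))ᗮ = ⊥ := by
  rw [Submodule.eq_bot_iff]
  intro f hf
  have h1 : ∀ j, rkhsComp hG (c j) f = 0 := fun j => b.ext_inner fun i => by
    rw [inner_rkhsComp, inner_zero_right]
    exact Submodule.inner_right_of_mem_orthogonal (Submodule.subset_span (mem_range_self (i, j))) hf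
  refine RKHS.ext fun x => c.ext_inner fun j => ?_
  rw [← rkhsComp_apply hG, h1 j]
  simp

/-- The Hilbert basis `x ↦ bᵢ(x) cⱼ` of `G`. -/
def tensorBasis {ι κ : Type*} (b : HilbertBasis ι ℝ H) (c : HilbertBasis κ ℝ Y) :
    HilbertBasis (ι × κ) ℝ G :=
  HilbertBasis.mkOfOrthogonalEqBot (orthonormal_rkhsTensor hG b.orthonormal c.orthonormal)
    (rkhsTensor_orthogonal_eq_bot hG b c)

theorem tensorBasis_apply {ι κ : Type*} (b : HilbertBasis ι ℝ H) (c : HilbertBasis κ ℝ Y)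
    (p : ι × κ) : tensorBasis hG b c p = rkhsTensor hG (b p.1) (c p.2) := by
  rw [tensorBasis, HilbertBasis.coe_mkOfOrthogonalEqBot]

theorem inner_tensorBasis {ι κ : Type*} (b : HilbertBasis ι ℝ H) (c : HilbertBasis κ ℝ Y)
    (p : ι × κ) (f : G) :
    inner ℝ (tensorBasis hG b c p) f = inner ℝ (b p.1) (rkhsComp hG (c p.2) f) := by
  rw [tensorBasis_apply, inner_rkhsComp]

/-- Parseval in the tensor basis, summed first over the factor `H`. It reduces norms in `G` to those
of the scalar components. -/
theorem hasSum_norm_rkhsComp_sq {κ : Type*} (c : HilbertBasis κ ℝ Y) (f : G) :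
    HasSum (fun j => ‖rkhsComp hG (c j) f‖ ^ 2) (‖f‖ ^ 2) := by
  obtain ⟨w, b, -⟩ := exists_hilbertBasis ℝ H
  have h := (tensorBasis hG b c).hasSum_inner_sq f
  rw [← (Equiv.prodComm κ w).hasSum_iff] at h
  refine h.prod_fiberwise fun j => ?_
  refine (b.hasSum_inner_sq _).congr_fun fun i => ?_
  simp only [Function.comp, Equiv.prodComm_apply, Prod.swap_prod_mk]
  rw [inner_tensorBasis]

/-- A function of an operator that acts only on the factor `H` commutes with taking components along
`Y`. -/
theorem rkhsComp_diag {ι κ : Type*} (b : HilbertBasis ι ℝ H) (c : HilbertBasis κ ℝ Y)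
    {f : ι → ℝ} (hf : ∃ C, ∀ i, |f i| ≤ C) (v : G) (j : κ) :
    rkhsComp hG (c j) ((tensorBasis hG b c).diag (fun p => f p.1) v)
      = b.diag f (rkhsComp hG (c j) v) := by
  refine b.ext_inner fun i => ?_
  rw [← inner_tensorBasis hG b c (i, j),
    HilbertBasis.inner_diag _ (hf.imp fun C hC p => hC p.1), inner_tensorBasis, b.inner_diag hf]

end Tensor

/-! ### The empirical covariance operator and its eigenbasis. -/

section Empirical

variable {X Y H G : Type*}
  [NormedAddCommGroup Y] [InnerProductSpace ℝ Y] [CompleteSpace Y]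
  [NormedAddCommGroup H] [InnerProductSpace ℝ H] [CompleteSpace H] [RKHS ℝ H X ℝ]
  [NormedAddCommGroup G] [InnerProductSpace ℝ G] [CompleteSpace G] [RKHS ℝ G X Y]

/-- The weighted empirical covariance operator of the sample `x` on the scalar space `H`. -/
def empiricalCov (H : Type*) [NormedAddCommGroup H] [InnerProductSpace ℝ H] [CompleteSpace H]
    [RKHS ℝ H X ℝ] (β : X → ℝ) {n : ℕ} (x : Fin n → X) : H →L[ℝ] H :=
  (n : ℝ)⁻¹ • ∑ i, β (x i) • InnerProductSpace.rankOne ℝ (featureMap H (x i)) (featureMap H (x i))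

variable (β : X → ℝ) {n : ℕ}

theorem empiricalCov_apply (x : Fin n → X) (h : H) :
    empiricalCov H β x h = (n : ℝ)⁻¹ • ∑ i, (β (x i) * h (x i)) • featureMap H (x i) := by
  simp [empiricalCov, inner_featureMap, mul_smul]

theorem inner_empiricalCov (x : Fin n → X) (h h' : H) :
    inner ℝ h' (empiricalCov H β x h) = (n : ℝ)⁻¹ * ∑ i, β (x i) * (h (x i) * h' (x i)) := by
  rw [empiricalCov_apply, inner_smul_right, inner_sum]
  congr 1
  refine Finset.sum_congr rfl fun i _ => ?_
  rw [inner_smul_right, real_inner_comm, inner_featureMap, mul_assoc]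

theorem empiricalCov_symm (x : Fin n → X) (h h' : H) :
    inner ℝ (empiricalCov H β x h) h' = inner ℝ h (empiricalCov H β x h') := by
  rw [real_inner_comm, inner_empiricalCov, inner_empiricalCov]
  congr 1
  exact Finset.sum_congr rfl fun i _ => by ring

instance finiteDimensional_range_empiricalCov (x : Fin n → X) :
    FiniteDimensional ℝ (empiricalCov H β x).range := by
  have : (empiricalCov H β x).range ≤
      Submodule.span ℝ (Set.range fun i => featureMap H (x i)) := by
    rintro _ ⟨h, rfl⟩
    rw [ContinuousLinearMap.coe_coe, empiricalCov_apply]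
    exact Submodule.smul_mem _ _ (Submodule.sum_mem _ fun i _ =>
      Submodule.smul_mem _ _ (Submodule.subset_span ⟨i, rfl⟩))
  have hfd : FiniteDimensional ℝ (Submodule.span ℝ (Set.range fun i => featureMap H (x i))) :=
    FiniteDimensional.span_of_finite ℝ (Set.finite_range _)
  exact Submodule.finiteDimensional_of_le this

variable {β}

/-- An eigenbasis of the empirical covariance operator. -/
theorem exists_eigenbasis_empiricalCov (hβ0 : ∀ x, 0 ≤ β x) {c : ℝ} (hβc : ∀ x, β x ≤ c) {κ : ℝ}
    (hκ : ∀ x, scalarKernel H x x ≤ κ ^ 2) (hn : 0 < n) (x : Fin n → X) :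
    ∃ (w : Set H) (b : HilbertBasis w ℝ H) (t : w → ℝ),
      (∀ i, empiricalCov H β x (b i) = t i • b i) ∧ (∀ i, t i ∈ Icc 0 (c * κ ^ 2)) ∧
      ∀ i, t i = 0 → ∀ j, β (x j) * b i (x j) = 0 := by
  obtain ⟨w, b, t, ht⟩ := exists_hilbertBasis_eigen (empiricalCov_symm (H := H) β x)
  have key : ∀ i, t i = (n : ℝ)⁻¹ * ∑ j, β (x j) * (b i (x j) * b i (x j)) := by
    intro i
    rw [← inner_empiricalCov, ht i, inner_smul_right, real_inner_self_eq_norm_sq,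
      b.orthonormal.1 i]
    ring
  have hnn : ∀ i j, 0 ≤ β (x j) * (b i (x j) * b i (x j)) := fun i j =>
    mul_nonneg (hβ0 _) (mul_self_nonneg _)
  refine ⟨w, b, t, ht, fun i => ⟨?_, ?_⟩, fun i hi j => ?_⟩
  · rw [key]
    exact mul_nonneg (by positivity) (Finset.sum_nonneg fun j _ => hnn i j)
  · have hn' : (n : ℝ) ≠ 0 := by positivity
    have hc : ∀ j, 0 ≤ c := fun j => (hβ0 (x j)).trans (hβc _)
    have h1 : ∀ j, β (x j) * (b i (x j) * b i (x j)) ≤ c * κ ^ 2 := by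
      intro j
      have h2 : b i (x j) * b i (x j) ≤ κ ^ 2 := by
        have h3 := abs_real_inner_le_norm (featureMap H (x j)) (b i)
        rw [inner_featureMap, b.orthonormal.1 i, mul_one] at h3
        calc b i (x j) * b i (x j) = |b i (x j)| ^ 2 := by rw [sq_abs, sq]
          _ ≤ ‖featureMap H (x j)‖ ^ 2 := by gcongr
          _ ≤ κ ^ 2 := by rw [norm_featureMap_sq]; exact hκ _
      exact mul_le_mul (hβc _) h2 (mul_self_nonneg _) (hc j)
    rw [key]
    calc (n : ℝ)⁻¹ * ∑ j, β (x j) * (b i (x j) * b i (x j))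
        ≤ (n : ℝ)⁻¹ * ∑ j : Fin n, c * κ ^ 2 := by
          refine mul_le_mul_of_nonneg_left (Finset.sum_le_sum fun j _ => h1 j) (by positivity)
      _ = c * κ ^ 2 := by
          rw [Finset.sum_const, Finset.card_univ, Fintype.card_fin, nsmul_eq_mul]
          field_simp
  · rw [key] at hi
    have h1 : ∑ j, β (x j) * (b i (x j) * b i (x j)) = 0 := by
      rcases mul_eq_zero.1 hi with h | h
      · exfalso
        have : (n : ℝ) ≠ 0 := by positivity
        exact inv_ne_zero this h
      · exact h
    -- A zero eigenvalue is a vanishing sum of nonnegative terms, so each term vanishes.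
    have h2 := (Finset.sum_eq_zero_iff_of_nonneg (fun j _ => hnn i j)).1 h1 j (Finset.mem_univ _)
    rcases mul_eq_zero.1 h2 with h | h
    · rw [h, zero_mul]
    · rw [mul_self_eq_zero.1 h, mul_zero]

end Empirical

/-! ### Components of the estimator. -/

section EstimatorFormula

variable {X Y H G : Type*}
  [NormedAddCommGroup Y] [InnerProductSpace ℝ Y] [CompleteSpace Y]
  [NormedAddCommGroup H] [InnerProductSpace ℝ H] [CompleteSpace H] [RKHS ℝ H X ℝ]
  [NormedAddCommGroup G] [InnerProductSpace ℝ G] [CompleteSpace G] [RKHS ℝ G X Y]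
  (hG : IsScalarKernelExtension H G) (β : X → ℝ) {n : ℕ}

theorem empiricalOp_apply (hG : IsScalarKernelExtension H G) (z : Fin n → X × Y) (f : G) :
    empiricalOp G β z f =
      (n : ℝ)⁻¹ • ∑ i, β (z i).1 • rkhsTensor hG (featureMap H (z i).1) (f (z i).1) := by
  simp [empiricalOp, rkhsTensor_featureMap]

/-- This is the identity Ĉ ⊗ Id that turns the vector-valued problem into one about operators on
`H`. -/
theorem empiricalOp_rkhsTensor (z : Fin n → X × Y) (h : H) (y : Y) :
    empiricalOp G β z (rkhsTensor hG h y) =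
      rkhsTensor hG (empiricalCov H β (fun i => (z i).1) h) y := by
  rw [empiricalOp_apply β hG, empiricalCov_apply]
  simp [rkhsTensor_apply, mul_smul]

theorem rkhsComp_empiricalRHS (z : Fin n → X × Y) (y : Y) :
    rkhsComp hG y (empiricalRHS G β z) =
      (n : ℝ)⁻¹ • ∑ i, (β (z i).1 * inner ℝ y (z i).2) • featureMap H (z i).1 := by
  simp only [empiricalRHS, map_smul, map_sum, ← rkhsTensor_featureMap hG, rkhsComp_rkhsTensor,
    mul_smul]

/-- The family `g` is not constrained at 0, yet 0 may be an eigenvalue of Ĉ. By `ht0` a null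
eigenvector vanishes at every sample point of nonzero weight, so the data vector is orthogonal to it
and the value at 0 may be replaced by 0. -/
theorem rkhsComp_estimator {ι κ : Type*} (c : HilbertBasis κ ℝ Y) (z : Fin n → X × Y)
    {b : HilbertBasis ι ℝ H} {t : ι → ℝ}
    (ht : ∀ i, empiricalCov H β (fun i => (z i).1) (b i) = t i • b i)
    (ht0 : ∀ i, t i = 0 → ∀ j, β (z j).1 * b i (z j).1 = 0)
    {g : ℝ → ℝ → ℝ} {lam : ℝ} (hg : ∃ C, ∀ i, |g lam (t i)| ≤ C) (j : κ) :
    rkhsComp hG (c j) (estimator G g β lam z) =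
      b.diag (fun i => if t i = 0 then 0 else g lam (t i))
        (rkhsComp hG (c j) (empiricalRHS G β z)) := by
  have hg' : ∃ C, ∀ i, |if t i = 0 then 0 else g lam (t i)| ≤ C := by
    obtain ⟨C, hC⟩ := hg
    refine ⟨C, fun i => ?_⟩
    split_ifs
    · rw [abs_zero]
      exact (abs_nonneg _).trans (hC i)
    · exact hC i
  have hB : ∀ p, empiricalOp G β z (tensorBasis hG b c p) = t p.1 • tensorBasis hG b c p := by
    intro p
    rw [tensorBasis_apply, empiricalOp_rkhsTensor, ht, map_smul]
    rfl
  obtain ⟨htb, hop⟩ := (tensorBasis hG b c).eq_diag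
    ((tensorBasis hG b c).isSymmetric_of_eigen hB) hB
  rw [estimator, hop, spectralApply_diag _ htb (hg.imp fun C hC p => hC p.1),
    rkhsComp_diag hG b c (f := fun i => g lam (t i)) hg]
  refine b.ext_inner fun i => ?_
  rw [b.inner_diag hg, b.inner_diag hg']
  split_ifs with h
  · rw [rkhsComp_empiricalRHS, inner_smul_right, inner_sum]
    rw [Finset.sum_eq_zero]
    · ring
    · intro k _
      rw [inner_smul_right, real_inner_comm (featureMap H (z k).1), inner_featureMap]
      linear_combination inner ℝ (c j) (z k).2 * ht0 i h k
  · rfl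

/-- The residual vector `(1/n) ∑ᵢ β(xᵢ) ⟪y, yᵢ - f(xᵢ)⟫ k(xᵢ, ·)`. -/
theorem rkhsComp_empiricalRHS_sub (z : Fin n → X × Y) (y : Y) (f : G) :
    rkhsComp hG y (empiricalRHS G β z) =
      empiricalCov H β (fun i => (z i).1) (rkhsComp hG y f) +
      (n : ℝ)⁻¹ • ∑ i, (β (z i).1 * inner ℝ y ((z i).2 - f (z i).1)) • featureMap H (z i).1 := by
  rw [rkhsComp_empiricalRHS, empiricalCov_apply, ← smul_add, ← Finset.sum_add_distrib]
  congr 1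
  refine Finset.sum_congr rfl fun i _ => ?_
  rw [rkhsComp_apply, ← add_smul, inner_sub_right]
  congr 1
  ring

end EstimatorFormula

/-! ### Hilbert–Schmidt operators and their adjoints. -/

section Source

variable {H Y : Type*} [NormedAddCommGroup Y] [InnerProductSpace ℝ Y] [CompleteSpace Y]
  [NormedAddCommGroup H] [InnerProductSpace ℝ H] [CompleteSpace H]

/-- Both sums add the squared matrix entries ⟪c j, A (b i)⟫², in the two possible orders. -/
theorem IsHilbertSchmidt.summable_adjoint {A : H →L[ℝ] Y} (hA : IsHilbertSchmidt A)
    {κ : Type*} (c : HilbertBasis κ ℝ Y) :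
    Summable fun j => ‖ContinuousLinearMap.adjoint A (c j)‖ ^ 2 := by
  obtain ⟨S, b, hb⟩ := hA
  have h1 : Summable fun p : S × κ => inner ℝ (c p.2) (A (b p.1)) ^ 2 := by
    refine (summable_prod_of_nonneg fun p => sq_nonneg _).2
      ⟨fun i => (c.hasSum_inner_sq (A (b i))).summable, ?_⟩
    exact hb.congr fun i => (c.hasSum_inner_sq (A (b i))).tsum_eq.symm
  have h2 : Summable fun p : κ × S => inner ℝ (c p.1) (A (b p.2)) ^ 2 :=
    (Equiv.prodComm κ S).summable_iff.2 h1
  have h3 := ((summable_prod_of_nonneg (fun p => sq_nonneg _)).1 h2).2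
  refine h3.congr fun j => ?_
  rw [← (b.hasSum_inner_sq (ContinuousLinearMap.adjoint A (c j))).tsum_eq]
  refine tsum_congr fun i => ?_
  rw [ContinuousLinearMap.adjoint_inner_right, real_inner_comm]

end Source

/-! ### Exponential inequalities for sums of vectors, after Pinelis. -/

section Pinelis

/-- The function cosh w is a power series in w² with nonnegative coefficients, hence convex in w².
-/
theorem cosh_convex_combination {p q u v w : ℝ} (hp : 0 ≤ p) (hq : 0 ≤ q) (hpq : p + q = 1)
    (hw : w ^ 2 = p * u ^ 2 + q * v ^ 2) :
    Real.cosh w ≤ p * Real.cosh u + q * Real.cosh v := by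
  refine hasSum_le (fun n => ?_) (Real.hasSum_cosh w)
    (((Real.hasSum_cosh u).mul_left p).add ((Real.hasSum_cosh v).mul_left q))
  have h := (convexOn_pow n).2 (mem_Ici.2 (sq_nonneg u)) (mem_Ici.2 (sq_nonneg v)) hp hq hpq
  simp only [smul_eq_mul] at h
  rw [pow_mul, pow_mul, pow_mul, hw, ← mul_div_assoc, ← mul_div_assoc, ← add_div]
  gcongr

variable {E : Type*} [NormedAddCommGroup E] [InnerProductSpace ℝ E]

/-- With τ the cosine of the angle between `s` and `d`, ‖s + d‖² is the convex combination of (‖s‖ ±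
‖d‖)² with weights (1 ± τ)/2. The term linear in `d` is kept apart because it integrates to zero for
centred `d`. -/
theorem cosh_norm_add_le (s d : E) :
    Real.cosh ‖s + d‖ ≤ Real.cosh ‖s‖ * (Real.exp ‖d‖ - ‖d‖)
      + inner ℝ ((Real.sinh ‖s‖ / ‖s‖) • s) d := by
  rcases eq_or_ne d 0 with rfl | hd
  · simp
  rcases eq_or_ne s 0 with rfl | hs
  · simp only [zero_add, norm_zero, Real.cosh_zero, one_mul, smul_zero, inner_zero_left, add_zero]
    have h1 := Real.cosh_add_sinh ‖d‖
    have h2 := Real.self_le_sinh_iff.2 (norm_nonneg d)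
    linarith
  have hσ : 0 < ‖s‖ := norm_pos_iff.2 hs
  have hρ : 0 < ‖d‖ := norm_pos_iff.2 hd
  set σ := ‖s‖
  set ρ := ‖d‖
  set τ := inner ℝ s d / (σ * ρ) with hτ
  have hτ1 : |τ| ≤ 1 := by
    rw [hτ, abs_div, abs_of_pos (mul_pos hσ hρ)]
    exact div_le_one_of_le₀ (abs_real_inner_le_norm s d) (by positivity)
  obtain ⟨hτl, hτu⟩ := abs_le.1 hτ1
  have hin : inner ℝ s d = τ * (σ * ρ) := by
    rw [hτ]
    field_simp
  have h := cosh_convex_combination (p := (1 + τ) / 2) (q := (1 - τ) / 2) (u := σ + ρ)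
    (v := σ - ρ) (w := ‖s + d‖) (by linarith) (by linarith) (by ring)
    (by rw [norm_add_sq_real, hin]; ring)
  rw [Real.cosh_add, Real.cosh_sub] at h
  rw [inner_smul_left, hin]
  simp only [conj_trivial]
  have h1 := Real.cosh_add_sinh ρ
  have h2 : 0 ≤ Real.sinh ρ - ρ := sub_nonneg.2 (Real.self_le_sinh_iff.2 hρ.le)
  -- In the product τ sinh σ sinh ρ the part linear in ρ is kept, and the excess τ sinh σ (sinh ρ -
  -- ρ) is bounded by cosh σ (sinh ρ - ρ).
  have h3 : τ * Real.sinh σ ≤ Real.cosh σ := by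
    have := Real.sinh_lt_cosh σ
    have := Real.sinh_nonneg_iff.2 hσ.le
    nlinarith
  have h4 : Real.sinh σ / σ * (τ * (σ * ρ)) = τ * Real.sinh σ * ρ := by
    field_simp
  rw [h4, ← h1]
  nlinarith [mul_le_mul_of_nonneg_right h3 h2]

theorem exp_sub_self_le {x : ℝ} (h0 : 0 ≤ x) (h1 : x ≤ 1) : Real.exp x - x ≤ 1 + x ^ 2 := by
  have := Real.abs_exp_sub_one_sub_id_le (x := x) (by rw [abs_of_nonneg h0]; exact h1)
  have := abs_le.1 this
  linarith [this.2]

variable [CompleteSpace E] {α : Type*} [MeasurableSpace α] (μ : Measure α) [IsProbabilityMeasure μ]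
  {d : α → E}

theorem integral_cosh_norm_add_le (hd : StronglyMeasurable d) (hd1 : ∀ x, ‖d x‖ ≤ 1)
    (hd0 : ∫ x, d x ∂μ = 0) {v : ℝ} (hv : ∫ x, ‖d x‖ ^ 2 ∂μ ≤ v) (s : E) :
    ∫⁻ x, ENNReal.ofReal (Real.cosh ‖s + d x‖) ∂μ ≤
      ENNReal.ofReal (Real.cosh ‖s‖ * (1 + v)) := by
  have hint : Integrable d μ := Integrable.of_bound hd.aestronglyMeasurable 1 (ae_of_all _ hd1)
  have hint2 : Integrable (fun x => ‖d x‖ ^ 2) μ := by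
    refine Integrable.of_bound (hd.norm.pow 2).aestronglyMeasurable 1 (ae_of_all _ fun x => ?_)
    rw [norm_pow, norm_norm]
    exact pow_le_one₀ (norm_nonneg _) (hd1 x)
  set w := (Real.sinh ‖s‖ / ‖s‖) • s
  have hb : ∀ x, Real.cosh ‖s + d x‖ ≤
      Real.cosh ‖s‖ * (1 + ‖d x‖ ^ 2) + inner ℝ w (d x) := fun x =>
    (cosh_norm_add_le s (d x)).trans (by
      have := exp_sub_self_le (norm_nonneg _) (hd1 x)
      have := Real.cosh_pos ‖s‖
      gcongr)
  have hint4 : Integrable (fun x => 1 + ‖d x‖ ^ 2) μ := (integrable_const 1).add hint2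
  have hint3 : Integrable (fun x => Real.cosh ‖s‖ * (1 + ‖d x‖ ^ 2) + inner ℝ w (d x)) μ :=
    (hint4.const_mul _).add (hint.const_inner w)
  calc ∫⁻ x, ENNReal.ofReal (Real.cosh ‖s + d x‖) ∂μ
      ≤ ∫⁻ x, ENNReal.ofReal (Real.cosh ‖s‖ * (1 + ‖d x‖ ^ 2) + inner ℝ w (d x)) ∂μ :=
        lintegral_mono fun x => ENNReal.ofReal_le_ofReal (hb x)
    _ = ENNReal.ofReal (∫ x, (Real.cosh ‖s‖ * (1 + ‖d x‖ ^ 2) + inner ℝ w (d x)) ∂μ) := by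
        rw [ofReal_integral_eq_lintegral_ofReal hint3]
        exact ae_of_all _ fun x => (Real.cosh_pos _).le.trans (hb x)
    _ ≤ ENNReal.ofReal (Real.cosh ‖s‖ * (1 + v)) := by
        apply ENNReal.ofReal_le_ofReal
        rw [integral_add (hint4.const_mul _) (hint.const_inner w),
          integral_const_mul, integral_add (integrable_const 1) hint2, integral_inner hint, hd0]
        have := Real.cosh_pos ‖s‖
        simp only [integral_const, probReal_univ, smul_eq_mul, inner_zero_right, add_zero]
        rw [one_mul]
        gcongr

theorem lintegral_pi_succ {n : ℕ} {α : Type*} [MeasurableSpace α] (μ : Fin (n + 1) → Measure α)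
    [∀ i, SigmaFinite (μ i)] {f : (Fin (n + 1) → α) → ℝ≥0∞} (hf : Measurable f) :
    ∫⁻ z, f z ∂Measure.pi μ =
      ∫⁻ x, ∫⁻ y, f (Fin.cons x y) ∂Measure.pi (fun i => μ (Fin.succ i)) ∂μ 0 := by
  have h := (measurePreserving_piFinSuccAbove μ 0).symm
  rw [← h.lintegral_comp hf, lintegral_prod]
  · simp only [MeasurableEquiv.piFinSuccAbove_symm_apply, Fin.zero_succAbove, Fin.insertNthEquiv,
      Equiv.coe_fn_mk, Fin.insertNth_zero']
  · exact (hf.comp (MeasurableEquiv.measurable _)).aemeasurable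

/-- The coordinates are integrated out one at a time, each costing a factor 1 + v; the starting
point `s` is arbitrary so that it can absorb the first vector in the induction. -/
theorem lintegral_pi_cosh_norm_sum_le (hd : StronglyMeasurable d) (hd1 : ∀ x, ‖d x‖ ≤ 1)
    (hd0 : ∫ x, d x ∂μ = 0) {v : ℝ} (hv : ∫ x, ‖d x‖ ^ 2 ∂μ ≤ v) (n : ℕ) (s : E) :
    ∫⁻ z, ENNReal.ofReal (Real.cosh ‖s + ∑ i, d (z i)‖) ∂Measure.pi (fun _ : Fin n => μ) ≤
      ENNReal.ofReal (Real.cosh ‖s‖ * (1 + v) ^ n) := by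
  have hv0 : 0 ≤ v := (integral_nonneg fun x => by positivity).trans hv
  induction n generalizing s with
  | zero => simp
  | succ n ih =>
    have hm : ∀ (n : ℕ) (s : E), Measurable fun z : Fin n → α =>
        ENNReal.ofReal (Real.cosh ‖s + ∑ i, d (z i)‖) := by
      intro n s
      have h1 : StronglyMeasurable fun z : Fin n → α => s + ∑ i, d (z i) := by
        refine stronglyMeasurable_const.add ?_
        exact Finset.stronglyMeasurable_fun_sum _ fun i _ =>
          hd.comp_measurable (measurable_pi_apply i)
      exact (Real.continuous_cosh.measurable.comp h1.norm.measurable).ennreal_ofReal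
    rw [lintegral_pi_succ _ (hm _ _)]
    calc ∫⁻ x, ∫⁻ y, ENNReal.ofReal (Real.cosh ‖s + ∑ i, d ((Fin.cons x y : Fin (n + 1) → α) i)‖)
          ∂Measure.pi (fun _ : Fin n => μ) ∂μ
        ≤ ∫⁻ x, ENNReal.ofReal (Real.cosh ‖s + d x‖ * (1 + v) ^ n) ∂μ := by
          refine lintegral_mono fun x => ?_
          refine le_trans (le_of_eq ?_) (ih (s + d x))
          refine lintegral_congr fun y => ?_
          rw [Fin.sum_univ_succ]
          simp only [Fin.cons_zero, Fin.cons_succ, add_assoc]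
      _ = (∫⁻ x, ENNReal.ofReal (Real.cosh ‖s + d x‖) ∂μ) * ENNReal.ofReal ((1 + v) ^ n) := by
          rw [← lintegral_mul_const']
          · refine lintegral_congr fun x => ?_
            rw [← ENNReal.ofReal_mul (Real.cosh_pos _).le]
          · exact ENNReal.ofReal_ne_top
      _ ≤ ENNReal.ofReal (Real.cosh ‖s‖ * (1 + v)) * ENNReal.ofReal ((1 + v) ^ n) := by
          gcongr
          exact integral_cosh_norm_add_le μ hd hd1 hd0 hv s
      _ = _ := by
          rw [← ENNReal.ofReal_mul (mul_nonneg (Real.cosh_pos _).le (by positivity)), pow_succ]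
          congr 1
          ring

/-- Bernstein's inequality for bounded centred random vectors in a Hilbert space. -/
theorem measure_norm_sum_gt_le (hd : StronglyMeasurable d) {c σ : ℝ} (hc : 0 < c) (hσ : 0 ≤ σ)
    (hdc : ∀ x, ‖d x‖ ≤ c) (hd0 : ∫ x, d x ∂μ = 0) (hdσ : ∫ x, ‖d x‖ ^ 2 ∂μ ≤ σ ^ 2)
    {n : ℕ} {L : ℝ} (hL : 0 < L) :
    Measure.pi (fun _ : Fin n => μ) {z | 2 * c * L + 2 * σ * √(n * L) < ‖∑ i, d (z i)‖} ≤
      ENNReal.ofReal (2 * Real.exp (-L)) := by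
  -- Dividing by T gives vectors of norm at most 1 and total variance nσ²/T² ≤ L, while the
  -- threshold is exactly 2LT. Markov's inequality for cosh then yields e^L / (e^(2L)/2) = 2 e^(-L).
  set T := c + σ * √(n / L) with hT
  have hTpos : 0 < T := by positivity
  have hTc : c ≤ T := le_add_of_nonneg_right (by positivity)
  set d' : α → E := fun x => T⁻¹ • d x
  have hd'1 : ∀ x, ‖d' x‖ ≤ 1 := fun x => by
    rw [norm_smul, Real.norm_eq_abs, abs_of_pos (inv_pos.2 hTpos), inv_mul_le_one₀ hTpos]
    exact (hdc x).trans hTc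
  have hd'0 : ∫ x, d' x ∂μ = 0 := by
    rw [integral_smul, hd0, smul_zero]
  have hd'v : ∫ x, ‖d' x‖ ^ 2 ∂μ ≤ (T⁻¹) ^ 2 * σ ^ 2 := by
    simp only [d', norm_smul, mul_pow, norm_inv, Real.norm_eq_abs, abs_of_pos hTpos]
    rw [integral_const_mul]
    gcongr
  have hmain := lintegral_pi_cosh_norm_sum_le μ (hd.const_smul T⁻¹) hd'1 hd'0 hd'v n 0
  simp only [zero_add, norm_zero, Real.cosh_zero, one_mul] at hmain
  have hnv : (1 + (T⁻¹) ^ 2 * σ ^ 2) ^ n ≤ Real.exp L := by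
    have h1 : n * ((T⁻¹) ^ 2 * σ ^ 2) ≤ L := by
      have h2 : σ * √(n / L) ≤ T := le_add_of_nonneg_left hc.le
      have h3 : (σ * √(n / L)) ^ 2 ≤ T ^ 2 := by gcongr
      rw [mul_pow, Real.sq_sqrt (by positivity)] at h3
      rw [inv_pow]
      field_simp at h3 ⊢
      linarith
    calc (1 + (T⁻¹) ^ 2 * σ ^ 2) ^ n ≤ (Real.exp ((T⁻¹) ^ 2 * σ ^ 2)) ^ n := by
          gcongr
          rw [add_comm]
          exact Real.add_one_le_exp _
      _ = Real.exp (n * ((T⁻¹) ^ 2 * σ ^ 2)) := by rw [← Real.exp_nat_mul]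
      _ ≤ Real.exp L := Real.exp_le_exp.2 h1
  have hsub : {z : Fin n → α | 2 * c * L + 2 * σ * √(n * L) < ‖∑ i, d (z i)‖} ⊆
      {z | ENNReal.ofReal (Real.exp (2 * L) / 2) ≤
        ENNReal.ofReal (Real.cosh ‖∑ i, d' (z i)‖)} := by
    intro z hz
    apply ENNReal.ofReal_le_ofReal
    have h1 : 2 * L ≤ ‖∑ i, d' (z i)‖ := by
      have h2 : ‖∑ i, d' (z i)‖ = T⁻¹ * ‖∑ i, d (z i)‖ := by
        rw [← Finset.smul_sum, norm_smul, norm_inv, Real.norm_eq_abs, abs_of_pos hTpos]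
      rw [h2, le_inv_mul_iff₀ hTpos]
      refine le_of_eq_of_le ?_ (le_of_lt hz)
      have h3 : √((n : ℝ) * L) = √(n / L) * L := by
        rw [← Real.sqrt_sq hL.le, ← Real.sqrt_mul (by positivity), Real.sqrt_sq hL.le]
        congr 1
        field_simp
      rw [h3, hT]
      ring
    have h4 := Real.exp_le_exp.2 h1
    rw [Real.cosh_eq]
    have := Real.exp_pos (-‖∑ i, d' (z i)‖)
    linarith
  have hmeas : Measurable fun z : Fin n → α => ENNReal.ofReal (Real.cosh ‖∑ i, d' (z i)‖) := by
    have h1 : StronglyMeasurable fun z : Fin n → α => ∑ i, d' (z i) :=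
      Finset.stronglyMeasurable_fun_sum _ fun i _ =>
        (hd.const_smul T⁻¹).comp_measurable (measurable_pi_apply i)
    exact (Real.continuous_cosh.measurable.comp h1.norm.measurable).ennreal_ofReal
  refine (measure_mono hsub).trans ?_
  refine (meas_ge_le_lintegral_div hmeas.aemeasurable ?_ ENNReal.ofReal_ne_top).trans ?_
  · simp [Real.exp_pos]
  rw [ENNReal.div_le_iff (by simp [Real.exp_pos]) ENNReal.ofReal_ne_top,
    ← ENNReal.ofReal_mul (by positivity)]
  refine hmain.trans (ENNReal.ofReal_le_ofReal (hnv.trans (le_of_eq ?_)))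
  have : Real.exp (2 * L) = Real.exp L * Real.exp L := by rw [← Real.exp_add]; ring_nf
  rw [this, Real.exp_neg]
  field_simp

end Pinelis

/-! ### Exponential moments of the squared norm of a sum of centred vectors. -/

section QuadraticForm

variable {Y G : Type*} [NormedAddCommGroup Y] [InnerProductSpace ℝ Y] [CompleteSpace Y]
  [NormedAddCommGroup G] [InnerProductSpace ℝ G] [CompleteSpace G]

/-- `R` is the inverse of `1 - τ ∑ᵢ Wᵢ Wᵢ*`. -/
def IsGramResolvent {n : ℕ} (τ : ℝ) (W : Fin n → Y →L[ℝ] G) (R : G →L[ℝ] G) : Prop :=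
  ∀ v, R v - τ • ∑ i, W i (ContinuousLinearMap.adjoint (W i) (R v)) = v

theorem inner_sum_gram {n : ℕ} (W : Fin n → Y →L[ℝ] G) (u w : G) :
    inner ℝ u (∑ i, W i (ContinuousLinearMap.adjoint (W i) w)) =
      ∑ i, inner ℝ (ContinuousLinearMap.adjoint (W i) u) (ContinuousLinearMap.adjoint (W i) w) := by
  rw [inner_sum]
  exact Finset.sum_congr rfl fun i _ => by rw [ContinuousLinearMap.adjoint_inner_left]

variable {n : ℕ} {W : Fin n → Y →L[ℝ] G} {τ : ℝ}

/-- By Cauchy–Schwarz the operator `∑ᵢ Wᵢ Wᵢ*` has norm at most 1, so a Neumann series inverts `1 -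
τ ∑ᵢ Wᵢ Wᵢ*`. -/
theorem exists_isGramResolvent (hW : ∀ u, ∑ i, ‖ContinuousLinearMap.adjoint (W i) u‖ ^ 2 ≤ ‖u‖ ^ 2)
    (hτ0 : 0 ≤ τ) (hτ : τ ≤ 1 / 2) : ∃ R, IsGramResolvent τ W R := by
  set B : G →L[ℝ] G := ∑ i, W i ∘L ContinuousLinearMap.adjoint (W i) with hB
  have hBapp : ∀ u, B u = ∑ i, W i (ContinuousLinearMap.adjoint (W i) u) := fun u => by
    simp [hB]
  have hBn : ‖B‖ ≤ 1 := by
    refine ContinuousLinearMap.opNorm_le_bound _ zero_le_one fun u => ?_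
    have h1 : ‖B u‖ ^ 2 ≤ ‖B u‖ * ‖u‖ := by
      calc ‖B u‖ ^ 2 = inner ℝ (B u) (∑ i, W i (ContinuousLinearMap.adjoint (W i) u)) := by
            rw [← hBapp, real_inner_self_eq_norm_sq]
        _ = ∑ i, inner ℝ (ContinuousLinearMap.adjoint (W i) (B u))
              (ContinuousLinearMap.adjoint (W i) u) := inner_sum_gram W _ _
        _ ≤ ∑ i, ‖ContinuousLinearMap.adjoint (W i) (B u)‖ *
              ‖ContinuousLinearMap.adjoint (W i) u‖ :=
            Finset.sum_le_sum fun i _ => real_inner_le_norm _ _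
        _ ≤ √(∑ i, ‖ContinuousLinearMap.adjoint (W i) (B u)‖ ^ 2) *
              √(∑ i, ‖ContinuousLinearMap.adjoint (W i) u‖ ^ 2) :=
          Real.sum_mul_le_sqrt_mul_sqrt _ _ _
        _ ≤ ‖B u‖ * ‖u‖ := by
            gcongr
            · exact Real.sqrt_le_iff.2 ⟨norm_nonneg _, hW _⟩
            · exact Real.sqrt_le_iff.2 ⟨norm_nonneg _, hW _⟩
    rcases (norm_nonneg (B u)).eq_or_lt with h | h
    · rw [← h]; positivity
    · rw [one_mul]
      nlinarith
  have hu : IsUnit (1 - τ • B) := by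
    apply isUnit_one_sub_of_norm_lt_one
    rw [norm_smul, Real.norm_eq_abs, abs_of_nonneg hτ0]
    nlinarith [norm_nonneg B]
  refine ⟨Ring.inverse (1 - τ • B), fun v => ?_⟩
  have h := congrArg (fun A : G →L[ℝ] G => A v) (Ring.mul_inverse_cancel _ hu)
  simpa [hBapp] using h

theorem IsGramResolvent.inner_symm {R : G →L[ℝ] G} (hR : IsGramResolvent τ W R) (v w : G) :
    inner ℝ (R v) w = inner ℝ v (R w) := by
  conv_lhs => rw [← hR w]
  conv_rhs => rw [← hR v]
  rw [inner_sub_right, inner_sub_left, inner_smul_right, inner_smul_left, inner_sum_gram,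
    real_inner_comm (R w), real_inner_comm (R w), inner_sum_gram]
  simp only [conj_trivial]
  congr 2
  exact Finset.sum_congr rfl fun i _ => real_inner_comm _ _

theorem IsGramResolvent.inner_self {R : G →L[ℝ] G} (hR : IsGramResolvent τ W R) (v : G) :
    inner ℝ v (R v) = ‖R v‖ ^ 2 - τ * ∑ i, ‖ContinuousLinearMap.adjoint (W i) (R v)‖ ^ 2 := by
  conv_lhs => rw [← hR.inner_symm, ← hR v]
  rw [inner_sub_right, inner_smul_right, hR v, inner_sum_gram, real_inner_self_eq_norm_sq]
  simp only [real_inner_self_eq_norm_sq]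

/-- As a quadratic form, `1 - τ ∑ᵢ Wᵢ Wᵢ*` is at least 1/2. -/
theorem IsGramResolvent.norm_le {R : G →L[ℝ] G} (hR : IsGramResolvent τ W R)
    (hW : ∀ u, ∑ i, ‖ContinuousLinearMap.adjoint (W i) u‖ ^ 2 ≤ ‖u‖ ^ 2)
    (hτ : τ ≤ 1 / 2) (v : G) : ‖R v‖ ≤ 2 * ‖v‖ := by
  have h1 := hR.inner_self v
  have h2 := real_inner_le_norm v (R v)
  have h3 := hW (R v)
  have h4 : τ * ∑ i, ‖ContinuousLinearMap.adjoint (W i) (R v)‖ ^ 2 ≤ 1 / 2 * ‖R v‖ ^ 2 := by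
    gcongr
  rcases (norm_nonneg (R v)).eq_or_lt with h | h
  · rw [← h]; positivity
  · nlinarith

/-- Variational lower bound for the quadratic form of `(1 - τ ∑ᵢ Wᵢ Wᵢ*)⁻¹`. -/
theorem IsGramResolvent.le_inner {R : G →L[ℝ] G} (hR : IsGramResolvent τ W R)
    (hW : ∀ u, ∑ i, ‖ContinuousLinearMap.adjoint (W i) u‖ ^ 2 ≤ ‖u‖ ^ 2)
    (hτ0 : 0 ≤ τ) (hτ : τ ≤ 1 / 2) (v u : G) :
    2 * inner ℝ u v - ‖u‖ ^ 2 + τ * ∑ i, ‖ContinuousLinearMap.adjoint (W i) u‖ ^ 2 ≤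
      inner ℝ v (R v) := by
  have h1 := hW (u - R v)
  have h2 : ∑ i, ‖ContinuousLinearMap.adjoint (W i) (u - R v)‖ ^ 2 =
      ∑ i, ‖ContinuousLinearMap.adjoint (W i) u‖ ^ 2
      - 2 * inner ℝ u (∑ i, W i (ContinuousLinearMap.adjoint (W i) (R v)))
      + ∑ i, ‖ContinuousLinearMap.adjoint (W i) (R v)‖ ^ 2 := by
    rw [inner_sum_gram, Finset.mul_sum, ← Finset.sum_sub_distrib, ← Finset.sum_add_distrib]
    exact Finset.sum_congr rfl fun i _ => by rw [map_sub, norm_sub_sq_real]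
  have h3 := norm_sub_sq_real u (R v)
  have h4 := hR.inner_self v
  have h5 : inner ℝ u v = inner ℝ u (R v) -
      τ * inner ℝ u (∑ i, W i (ContinuousLinearMap.adjoint (W i) (R v))) := by
    conv_lhs => rw [← hR v]
    rw [inner_sub_right, inner_smul_right]
  have h6 : 0 ≤ ∑ i, ‖ContinuousLinearMap.adjoint (W i) (u - R v)‖ ^ 2 := by positivity
  -- The defect in the inequality is the form of `1 - τ ∑ᵢ Wᵢ Wᵢ*` at `u - R v`, which is
  -- nonnegative.
  have h7 : τ * ∑ i, ‖ContinuousLinearMap.adjoint (W i) (u - R v)‖ ^ 2 ≤ ‖u - R v‖ ^ 2 := by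
    nlinarith
  rw [h2, h3] at h7
  rw [h4, h5]
  linarith

variable {α : Type*} [MeasurableSpace α]

/-- Hoeffding's lemma for the centred scalar variable ⟪a, d⟫ with values in [-c‖a‖, c‖a‖]. -/
theorem lintegral_exp_inner_le (μ : Measure α) [IsProbabilityMeasure μ] {d : α → Y}
    (hd : StronglyMeasurable d) {c : ℝ} (hdc : ∀ᵐ x ∂μ, ‖d x‖ ≤ c) (hd0 : ∫ x, d x ∂μ = 0) (a : Y) :
    ∫⁻ x, ENNReal.ofReal (Real.exp (inner ℝ a (d x))) ∂μ ≤
      ENNReal.ofReal (Real.exp (c ^ 2 * ‖a‖ ^ 2 / 2)) := by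
  have hint : Integrable d μ := Integrable.of_bound hd.aestronglyMeasurable c hdc
  have hb : ∀ᵐ x ∂μ, inner ℝ a (d x) ∈ Icc (-(c * ‖a‖)) (c * ‖a‖) := by
    filter_upwards [hdc] with x hx
    refine abs_le.1 ((abs_real_inner_le_norm _ _).trans ?_)
    rw [mul_comm]
    gcongr
  have hc : 0 ≤ c := by
    obtain ⟨x, hx⟩ := hdc.exists
    exact (norm_nonneg _).trans hx
  have hsub := hasSubgaussianMGF_of_mem_Icc_of_integral_eq_zero (μ := μ)
    (X := fun x => inner ℝ a (d x)) ((hint.const_inner a).aestronglyMeasurable.aemeasurable) hb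
    (by rw [integral_inner hint, hd0, inner_zero_right])
  have h1 := hsub.mgf_le 1
  have h2 := hsub.integrable_exp_mul 1
  simp only [mgf, one_mul] at h1 h2
  rw [← ofReal_integral_eq_lintegral_ofReal h2 (ae_of_all _ fun x => (Real.exp_pos _).le)]
  refine ENNReal.ofReal_le_ofReal (h1.trans (Real.exp_le_exp.2 (le_of_eq ?_)))
  simp only [NNReal.coe_pow, NNReal.coe_div, coe_nnnorm, Real.norm_eq_abs, NNReal.coe_ofNat]
  rw [div_pow, sq_abs]
  ring

/-- Induction on the number of vectors. Fixing the first one and applying the induction hypothesis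
to the others, with resolvent R', leaves a quadratic expression in d₀. With τ = 2θc², Hoeffding
bounds the contribution of its linear part by θτ‖W₀* R' v‖², and its square part is at most
2θc²‖W₀‖² since ‖R'‖ ≤ 2. Passing from R' to R absorbs the linear cost. Only operator norms of the
Wᵢ occur, so the dimension of `Y` plays no role. -/
theorem lintegral_exp_norm_sq_le {c θ : ℝ} (hθ : 0 ≤ θ) (hθc : 4 * θ * c ^ 2 ≤ 1) (n : ℕ)
    (μ : Fin n → Measure α) [∀ i, IsProbabilityMeasure (μ i)] (d : Fin n → α → Y)
    (hd : ∀ i, StronglyMeasurable (d i)) (hdc : ∀ i, ∀ᵐ x ∂μ i, ‖d i x‖ ≤ c)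
    (hd0 : ∀ i, ∫ x, d i x ∂μ i = 0) (W : Fin n → Y →L[ℝ] G)
    (hW : ∀ u, ∑ i, ‖ContinuousLinearMap.adjoint (W i) u‖ ^ 2 ≤ ‖u‖ ^ 2)
    (R : G →L[ℝ] G) (hR : IsGramResolvent (2 * θ * c ^ 2) W R) (v : G) :
    ∫⁻ z, ENNReal.ofReal (Real.exp (θ * ‖v + ∑ i, W i (d i (z i))‖ ^ 2)) ∂Measure.pi μ ≤
      ENNReal.ofReal (Real.exp (θ * inner ℝ v (R v) + 2 * θ * c ^ 2 * ∑ i, ‖W i‖ ^ 2)) := by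
  have hτ0 : 0 ≤ 2 * θ * c ^ 2 := by positivity
  have hτ : 2 * θ * c ^ 2 ≤ 1 / 2 := by linarith
  induction n generalizing v R with
  | zero =>
    have hRv : R v = v := by simpa [IsGramResolvent] using hR v
    simp [hRv]
  | succ n ih =>
    have hW' : ∀ u, ∑ i : Fin n, ‖ContinuousLinearMap.adjoint (W i.succ) u‖ ^ 2 ≤ ‖u‖ ^ 2 := by
      intro u
      refine le_trans ?_ (hW u)
      rw [Fin.sum_univ_succ]
      exact le_add_of_nonneg_left (by positivity)
    obtain ⟨R', hR'⟩ := exists_isGramResolvent (W := fun i : Fin n => W i.succ) hW' hτ0 hτ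
    have hm : Measurable fun z : Fin (n + 1) → α =>
        ENNReal.ofReal (Real.exp (θ * ‖v + ∑ i, W i (d i (z i))‖ ^ 2)) := by
      have h1 : StronglyMeasurable fun z : Fin (n + 1) → α => v + ∑ i, W i (d i (z i)) := by
        refine stronglyMeasurable_const.add (Finset.stronglyMeasurable_fun_sum _ fun i _ => ?_)
        exact (W i).continuous.comp_stronglyMeasurable
          ((hd i).comp_measurable (measurable_pi_apply i))
      exact (Real.measurable_exp.comp ((h1.norm.measurable.pow_const 2).const_mul θ)).ennreal_ofReal
    rw [lintegral_pi_succ _ hm]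
    set K := 2 * θ * c ^ 2 * ∑ i : Fin n, ‖W i.succ‖ ^ 2
    set a := (2 * θ) • ContinuousLinearMap.adjoint (W 0) (R' v)
    set M := θ * inner ℝ v (R' v) + 2 * θ * c ^ 2 * ‖W 0‖ ^ 2 + K with hM
    calc ∫⁻ x, ∫⁻ y, ENNReal.ofReal (Real.exp (θ * ‖v + ∑ i, W i (d i
            ((Fin.cons x y : Fin (n + 1) → α) i))‖ ^ 2)) ∂Measure.pi (fun i : Fin n => μ i.succ) ∂μ 0
        ≤ ∫⁻ x, ENNReal.ofReal (Real.exp (θ * inner ℝ (v + W 0 (d 0 x)) (R' (v + W 0 (d 0 x))) + K))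
            ∂μ 0 := by
          refine lintegral_mono fun x => ?_
          refine le_trans (le_of_eq ?_) (ih (fun i => μ i.succ) (fun i => d i.succ)
            (fun i => hd _) (fun i => hdc _) (fun i => hd0 _) (fun i => W i.succ) hW' R' hR'
            (v + W 0 (d 0 x)))
          refine lintegral_congr fun y => ?_
          rw [Fin.sum_univ_succ]
          simp only [Fin.cons_zero, Fin.cons_succ, add_assoc]
      _ ≤ ∫⁻ x, ENNReal.ofReal (Real.exp M) * ENNReal.ofReal (Real.exp (inner ℝ a (d 0 x))) ∂μ 0 := by
          refine lintegral_mono_ae ?_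
          filter_upwards [hdc 0] with x hx
          rw [← ENNReal.ofReal_mul (Real.exp_pos _).le, ← Real.exp_add]
          refine ENNReal.ofReal_le_ofReal (Real.exp_le_exp.2 ?_)
          have h1 : inner ℝ a (d 0 x) = 2 * θ * inner ℝ (R' v) (W 0 (d 0 x)) := by
            rw [inner_smul_left, ContinuousLinearMap.adjoint_inner_left]
            simp
          have h2 : inner ℝ (W 0 (d 0 x)) (R' (W 0 (d 0 x))) ≤ 2 * (c ^ 2 * ‖W 0‖ ^ 2) := by
            refine (real_inner_le_norm _ _).trans ?_
            have h3 := hR'.norm_le hW' hτ (W 0 (d 0 x))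
            have h4 : ‖W 0 (d 0 x)‖ ≤ ‖W 0‖ * c := (W 0).le_opNorm_of_le hx
            have h5 : ‖W 0 (d 0 x)‖ ^ 2 ≤ (‖W 0‖ * c) ^ 2 := by gcongr
            nlinarith [norm_nonneg (W 0 (d 0 x))]
          have h3 : inner ℝ (W 0 (d 0 x)) (R' v) = inner ℝ (R' v) (W 0 (d 0 x)) :=
            real_inner_comm _ _
          have h4 : inner ℝ v (R' (W 0 (d 0 x))) = inner ℝ (R' v) (W 0 (d 0 x)) :=
            (hR'.inner_symm _ _).symm
          rw [h1, hM, map_add, inner_add_left, inner_add_right, inner_add_right, h3, h4]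
          nlinarith [mul_le_mul_of_nonneg_left h2 hθ]
      _ = ENNReal.ofReal (Real.exp M) *
            ∫⁻ x, ENNReal.ofReal (Real.exp (inner ℝ a (d 0 x))) ∂μ 0 :=
          lintegral_const_mul' _ _ ENNReal.ofReal_ne_top
      _ ≤ ENNReal.ofReal (Real.exp M) * ENNReal.ofReal (Real.exp (c ^ 2 * ‖a‖ ^ 2 / 2)) := by
          gcongr
          exact lintegral_exp_inner_le (μ 0) (hd 0) (hdc 0) (hd0 0) a
      _ ≤ _ := by
          rw [← ENNReal.ofReal_mul (Real.exp_pos _).le, ← Real.exp_add]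
          refine ENNReal.ofReal_le_ofReal (Real.exp_le_exp.2 ?_)
          -- Testing the variational bound at `u = R' v` gives ⟪v, R v⟫ ≥ ⟪v, R' v⟫ + τ‖W₀* R' v‖²,
          -- exactly the Hoeffding cost divided by θ.
          have h1 := hR.le_inner hW hτ0 hτ v (R' v)
          have h2 := hR'.inner_self v
          have h3 : ‖a‖ ^ 2 = 4 * θ ^ 2 * ‖ContinuousLinearMap.adjoint (W 0) (R' v)‖ ^ 2 := by
            rw [norm_smul, mul_pow, Real.norm_eq_abs, sq_abs]
            ring
          rw [Fin.sum_univ_succ, real_inner_comm v (R' v)] at h1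
          rw [h3, Fin.sum_univ_succ, hM]
          have h4 : inner ℝ v (R' v) +
              2 * θ * c ^ 2 * ‖ContinuousLinearMap.adjoint (W 0) (R' v)‖ ^ 2 ≤ inner ℝ v (R v) := by
            linarith
          nlinarith [mul_le_mul_of_nonneg_left h4 hθ]

end QuadraticForm

/-! ### Conditioning the sample on its inputs. -/

section Disintegration

variable {X Y : Type*} [MeasurableSpace X] [MeasurableSpace Y] {n : ℕ}

theorem lintegral_pi_prod {n : ℕ} {α : Type*} [MeasurableSpace α] (μ : Fin n → Measure α)
    [∀ i, SigmaFinite (μ i)] {f : Fin n → α → ℝ≥0∞} (hf : ∀ i, Measurable (f i)) :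
    ∫⁻ z, ∏ i, f i (z i) ∂Measure.pi μ = ∏ i, ∫⁻ a, f i a ∂μ i := by
  induction n with
  | zero => simp
  | succ n ih =>
    rw [lintegral_pi_succ, Fin.prod_univ_succ, ← ih _ fun i => hf _,
      ← lintegral_mul_const _ (hf 0)]
    · refine lintegral_congr fun a => ?_
      rw [← lintegral_const_mul]
      · refine lintegral_congr fun y => ?_
        rw [Fin.prod_univ_succ]
        simp only [Fin.cons_zero, Fin.cons_succ]
      · exact Finset.measurable_fun_prod _ fun i _ => (hf _).comp (measurable_pi_apply i)
    · exact Finset.measurable_fun_prod _ fun i _ => (hf _).comp (measurable_pi_apply i)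

theorem measurable_pi_kernel (𝒦 : Kernel X Y) [IsMarkovKernel 𝒦] :
    Measurable fun x : Fin n → X => Measure.pi fun i => 𝒦 (x i) := by
  refine Measurable.measure_of_isPiSystem_of_isProbabilityMeasure generateFrom_pi.symm
    isPiSystem_pi ?_
  rintro _ ⟨s, hs, rfl⟩
  simp only [Measure.pi_pi]
  refine Finset.measurable_fun_prod _ fun i _ => ?_
  exact (𝒦.measurable_coe (hs i (mem_univ i))).comp (measurable_pi_apply i)

/-- The product kernel `x ↦ 𝒦(x₁) ⊗ ⋯ ⊗ 𝒦(xₙ)`. -/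
def piKernel (n : ℕ) (𝒦 : Kernel X Y) [IsMarkovKernel 𝒦] : Kernel (Fin n → X) (Fin n → Y) where
  toFun x := Measure.pi fun i => 𝒦 (x i)
  measurable' := measurable_pi_kernel 𝒦

instance isMarkovKernel_piKernel (𝒦 : Kernel X Y) [IsMarkovKernel 𝒦] :
    IsMarkovKernel (piKernel n 𝒦) :=
  ⟨fun x => by
    change IsProbabilityMeasure (Measure.pi fun i => 𝒦 (x i))
    infer_instance⟩

/-- On boxes both sides factor into the same product over the sample. This allows all inputs to be
fixed before the outputs are integrated. -/
theorem map_compProd_piKernel (pX : Measure X) [IsProbabilityMeasure pX] (𝒦 : Kernel X Y)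
    [IsMarkovKernel 𝒦] :
    ((Measure.pi fun _ : Fin n => pX) ⊗ₘ piKernel n 𝒦).map
        (fun (w : (Fin n → X) × (Fin n → Y)) (i : Fin n) => (w.1 i, w.2 i)) =
      Measure.pi fun _ : Fin n => pX ⊗ₘ 𝒦 := by
  have hm : Measurable (fun (w : (Fin n → X) × (Fin n → Y)) (i : Fin n) => (w.1 i, w.2 i)) := by
    fun_prop
  symm
  refine Measure.pi_eq fun s hs => ?_
  rw [Measure.map_apply hm (MeasurableSet.univ_pi hs), Measure.compProd_apply
    (hm (MeasurableSet.univ_pi hs))]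
  have h1 : ∀ x : Fin n → X, piKernel n 𝒦 x (Prod.mk x ⁻¹'
      ((fun (w : (Fin n → X) × (Fin n → Y)) (i : Fin n) => (w.1 i, w.2 i)) ⁻¹' Set.univ.pi s)) =
      ∏ i, 𝒦 (x i) (Prod.mk (x i) ⁻¹' s i) := by
    intro x
    change Measure.pi (fun i => 𝒦 (x i)) _ = _
    rw [← Measure.pi_pi]
    congr 1
  simp only [h1]
  rw [lintegral_pi_prod (fun _ : Fin n => pX) (f := fun i a => 𝒦 a (Prod.mk a ⁻¹' s i))]
  · refine Finset.prod_congr rfl fun i _ => ?_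
    rw [Measure.compProd_apply (hs i)]
  · intro i
    exact Kernel.measurable_kernel_prodMk_left (hs i)

theorem lintegral_pi_compProd (pX : Measure X) [IsProbabilityMeasure pX] (𝒦 : Kernel X Y)
    [IsMarkovKernel 𝒦] {F : (Fin n → X × Y) → ℝ≥0∞} (hF : Measurable F) :
    ∫⁻ z, F z ∂Measure.pi (fun _ : Fin n => pX ⊗ₘ 𝒦) =
      ∫⁻ x, ∫⁻ y, F (fun i => (x i, y i)) ∂Measure.pi (fun i => 𝒦 (x i))
        ∂Measure.pi (fun _ : Fin n => pX) := by
  have hm : Measurable (fun (w : (Fin n → X) × (Fin n → Y)) (i : Fin n) => (w.1 i, w.2 i)) := by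
    fun_prop
  rw [← map_compProd_piKernel, lintegral_map hF hm]
  exact Measure.lintegral_compProd (hF.comp hm)

theorem ae_pi_of_ae {α : Type*} [MeasurableSpace α] (μ : Measure α) [IsProbabilityMeasure μ]
    {p : α → Prop} (hp : ∀ᵐ x ∂μ, p x) : ∀ᵐ x ∂Measure.pi (fun _ : Fin n => μ), ∀ i, p (x i) :=
  ae_all_iff.2 fun i =>
    (Measure.quasiMeasurePreserving_eval (fun _ : Fin n => μ) i).ae hp

/-- Whatever Φ is elsewhere, its composition with a simple function is simple, and continuity at the
limit values gives pointwise convergence. The case needed is inversion of operators, at invertible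
ones. -/
theorem StronglyMeasurable.comp_of_continuousAt {α E F : Type*} [MeasurableSpace α]
    [TopologicalSpace E] [TopologicalSpace F] {p : α → E} (hp : StronglyMeasurable p) {Φ : E → F}
    [TopologicalSpace.PseudoMetrizableSpace F]
    (hΦ : ∀ a, ContinuousAt Φ (p a)) : StronglyMeasurable fun a => Φ (p a) := by
  refine stronglyMeasurable_of_tendsto (f := fun k => fun a => Φ (hp.approx k a)) Filter.atTop
    (fun k => ((hp.approx k).map Φ).stronglyMeasurable) ?_
  exact tendsto_pi_nhds.2 fun a => (hΦ a).tendsto.comp (hp.tendsto_approx a)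

end Disintegration

/-! ### Comparing C = `e.diag μ` with Ĉ = `b.diag t`. -/

section Comparison

variable {ι κ E : Type*} [NormedAddCommGroup E] [InnerProductSpace ℝ E]
  (e : HilbertBasis ι ℝ E) (b : HilbertBasis κ ℝ E) {μ : ι → ℝ} {t : κ → ℝ}

theorem bounded_sqrt_add (hμb : ∃ M, ∀ i, |μ i| ≤ M) (s : ℝ) :
    ∃ M, ∀ i, |√(μ i + s)| ≤ M := by
  obtain ⟨M, hM⟩ := hμb
  refine ⟨√(M + s), fun i => ?_⟩
  rw [abs_of_nonneg (Real.sqrt_nonneg _)]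
  exact Real.sqrt_le_sqrt (by linarith [(abs_le.1 (hM i)).2])

theorem bounded_inv_add (hμ : ∀ i, 0 ≤ μ i) {s : ℝ} (hs : 0 < s) :
    ∀ i, |(μ i + s)⁻¹| ≤ s⁻¹ := by
  intro i
  have := hμ i
  rw [abs_of_nonneg (by positivity)]
  exact inv_anti₀ hs (by linarith)

theorem bounded_inv_sqrt_add (hμ : ∀ i, 0 ≤ μ i) {s : ℝ} (hs : 0 < s) :
    ∀ i, |(√(μ i + s))⁻¹| ≤ (√s)⁻¹ := by
  intro i
  have := hμ i
  rw [abs_of_nonneg (by positivity)]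
  exact inv_anti₀ (Real.sqrt_pos.2 hs) (Real.sqrt_le_sqrt (by linarith))

theorem norm_sq_diag_sqrt_add (hμ : ∀ i, 0 ≤ μ i) (hμb : ∃ M, ∀ i, |μ i| ≤ M) {s : ℝ} (hs : 0 < s)
    (h : E) : ‖e.diag (fun i => √(μ i + s)) h‖ ^ 2 = inner ℝ h (e.diag μ h) + s * ‖h‖ ^ 2 := by
  refine (e.hasSum_norm_diag_sq (bounded_sqrt_add hμb s) h).unique ?_
  refine ((e.hasSum_inner_diag hμb h h).add ((e.hasSum_inner_sq h).mul_left s)).congr_fun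
    fun i => ?_
  have := hμ i
  rw [Real.sq_sqrt (by positivity)]
  ring

theorem norm_sq_diag_inv_sqrt_add (hμ : ∀ i, 0 ≤ μ i) {s : ℝ} (hs : 0 < s)
    (h : E) : ‖e.diag (fun i => (√(μ i + s))⁻¹) h‖ ^ 2 =
      inner ℝ h (e.diag (fun i => (μ i + s)⁻¹) h) := by
  refine (e.hasSum_norm_diag_sq ⟨_, bounded_inv_sqrt_add hμ hs⟩ h).unique ?_
  refine (e.hasSum_inner_diag ⟨_, bounded_inv_add hμ hs⟩ h h).congr_fun fun i => ?_
  have := hμ i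
  rw [inv_pow, Real.sq_sqrt (by positivity)]
  ring

theorem inner_eq_inner_diag_sqrt (hμ : ∀ i, 0 ≤ μ i) (hμb : ∃ M, ∀ i, |μ i| ≤ M) {s : ℝ}
    (hs : 0 < s) (u v : E) :
    inner ℝ u v =
      inner ℝ (e.diag (fun i => √(μ i + s)) u) (e.diag (fun i => (√(μ i + s))⁻¹) v) := by
  rw [e.inner_diag_comm (bounded_sqrt_add hμb s),
    e.diag_comp (bounded_sqrt_add hμb s) ⟨_, bounded_inv_sqrt_add hμ hs⟩]
  congr 1
  have h1 : ∀ i, √(μ i + s) * (√(μ i + s))⁻¹ = 1 := fun i => by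
    have := hμ i
    have : 0 < √(μ i + s) := Real.sqrt_pos.2 (by positivity)
    exact mul_inv_cancel₀ this.ne'
  refine e.ext_inner fun i => ?_
  simp only [h1]
  rw [e.inner_diag ⟨1, fun i => by simp⟩, one_mul]

/-- With P = ‖(C + s)^(1/2) h‖, the perturbation ⟪h, (Ĉ - C) h⟫ is at most P η‖h‖, and √s‖h‖ ≤ P
makes this at most P²/2. As quadratic forms, C + s ≤ 2(Ĉ + s). -/
theorem norm_sq_diag_sqrt_add_le (hμ : ∀ i, 0 ≤ μ i) (hμb : ∃ M, ∀ i, |μ i| ≤ M) (ht : ∀ i, 0 ≤ t i)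
    (htb : ∃ M, ∀ i, |t i| ≤ M) {s η : ℝ} (hs : 0 < s)
    (hη : ∀ h, ‖e.diag (fun i => (√(μ i + s))⁻¹) (b.diag t h - e.diag μ h)‖ ≤ η * ‖h‖)
    (hηs : η ≤ √s / 2) (h : E) :
    ‖e.diag (fun i => √(μ i + s)) h‖ ^ 2 ≤ 2 * ‖b.diag (fun i => √(t i + s)) h‖ ^ 2 := by
  have h1 := norm_sq_diag_sqrt_add e hμ hμb hs h
  have h2 := norm_sq_diag_sqrt_add b ht htb hs h
  have h3 : inner ℝ h (e.diag μ h) =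
      inner ℝ h (b.diag t h) - inner ℝ h (b.diag t h - e.diag μ h) := by
    rw [inner_sub_right]; ring
  have h4 := abs_real_inner_le_norm (e.diag (fun i => √(μ i + s)) h)
    (e.diag (fun i => (√(μ i + s))⁻¹) (b.diag t h - e.diag μ h))
  rw [← inner_eq_inner_diag_sqrt e hμ hμb hs] at h4
  set P := ‖e.diag (fun i => √(μ i + s)) h‖
  have h5 : √s * ‖h‖ ≤ P := by
    refine abs_le_of_sq_le_sq' ?_ (norm_nonneg _) |>.2
    rw [mul_pow, Real.sq_sqrt hs.le, h1]
    have : 0 ≤ inner ℝ h (e.diag μ h) :=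
      (e.hasSum_inner_diag hμb h h).nonneg fun i => mul_nonneg (hμ i) (mul_self_nonneg _)
    linarith
  have h6 : ‖e.diag (fun i => (√(μ i + s))⁻¹) (b.diag t h - e.diag μ h)‖ ≤ P / 2 := by
    refine (hη h).trans ?_
    nlinarith [norm_nonneg h, mul_le_mul_of_nonneg_right hηs (norm_nonneg h)]
  have h7 := neg_abs_le (inner ℝ h (b.diag t h - e.diag μ h))
  nlinarith [norm_nonneg (e.diag (fun i => √(μ i + s)) h)]

/-- By duality ‖u‖² = ⟪(Ĉ + s)⁻¹ u, d⟫, where (C + ωλ)^(1/2) and its inverse are inserted. The form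
comparison replaces C by Ĉ in the first factor, and (t + ωλ)/(t + s)² ≤ ω/λ for s ≥ λ. -/
theorem norm_diag_resolvent_sub_le (hμ : ∀ i, 0 ≤ μ i) (hμb : ∃ M, ∀ i, |μ i| ≤ M)
    (ht : ∀ i, 0 ≤ t i) (htb : ∃ M, ∀ i, |t i| ≤ M) {lam ω η : ℝ} (hl : 0 < lam) (hω : 1 ≤ ω)
    (hη0 : 0 ≤ η)
    (hη : ∀ h, ‖e.diag (fun i => (√(μ i + ω * lam))⁻¹) (b.diag t h - e.diag μ h)‖ ≤ η * ‖h‖)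
    (hηs : η ≤ √(ω * lam) / 2) {s : ℝ} (hs : lam ≤ s) (h : E) :
    ‖b.diag (fun i => (t i + s)⁻¹) (b.diag t h - e.diag μ h)‖ ≤ √(2 * ω / lam) * η * ‖h‖ := by
  have hs0 : 0 < s := hl.trans_le hs
  have hωl : 0 < ω * lam := by positivity
  set d := b.diag t h - e.diag μ h
  set u := b.diag (fun i => (t i + s)⁻¹) d
  have hbi : ∃ M, ∀ i, |(t i + s)⁻¹| ≤ M := ⟨_, bounded_inv_add ht hs0⟩
  have h1 : ‖e.diag (fun i => √(μ i + ω * lam)) (b.diag (fun i => (t i + s)⁻¹) u)‖ ≤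
      √(2 * ω / lam) * ‖u‖ := by
    refine abs_le_of_sq_le_sq' ?_ (by positivity) |>.2
    refine (norm_sq_diag_sqrt_add_le e b hμ hμb ht htb hωl hη hηs _).trans ?_
    rw [b.diag_comp (bounded_sqrt_add htb _) hbi, mul_pow, Real.sq_sqrt (by positivity)]
    have h2 := b.norm_diag_le (f := fun i => √(t i + ω * lam) * (t i + s)⁻¹) (C := √(ω / lam))
      (by positivity) (fun i => ?_) u
    · calc 2 * ‖b.diag (fun i => √(t i + ω * lam) * (t i + s)⁻¹) u‖ ^ 2
          ≤ 2 * (√(ω / lam) * ‖u‖) ^ 2 := by gcongr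
        _ = 2 * ω / lam * ‖u‖ ^ 2 := by
          rw [mul_pow, Real.sq_sqrt (by positivity)]
          ring
    · have hti := ht i
      rw [abs_of_nonneg (by positivity)]
      apply Real.le_sqrt_of_sq_le
      rw [mul_pow, Real.sq_sqrt (by positivity), inv_pow, ← div_eq_mul_inv,
        div_le_div_iff₀ (by positivity) hl]
      nlinarith [mul_nonneg hti (sub_nonneg.2 hω), mul_nonneg hti hs0.le, mul_nonneg hti hl.le,
        mul_nonneg (mul_nonneg (zero_le_one.trans hω) hti) (sub_nonneg.2 hs),
        mul_nonneg (zero_le_one.trans hω) (mul_nonneg (sub_nonneg.2 hs) (add_pos hs0 hl).le),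
        mul_nonneg (zero_le_one.trans hω) (sq_nonneg (t i)),
        mul_nonneg (mul_nonneg (sub_nonneg.2 hω) hti) hl.le,
        mul_nonneg (zero_le_one.trans hω) (mul_nonneg hti hs0.le)]
  have h2 : ‖u‖ ^ 2 ≤ √(2 * ω / lam) * ‖u‖ * (η * ‖h‖) := by
    calc ‖u‖ ^ 2 = inner ℝ (b.diag (fun i => (t i + s)⁻¹) u) d := by
          rw [b.inner_diag_comm hbi, real_inner_self_eq_norm_sq]
      _ = inner ℝ (e.diag (fun i => √(μ i + ω * lam)) (b.diag (fun i => (t i + s)⁻¹) u))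
            (e.diag (fun i => (√(μ i + ω * lam))⁻¹) d) := inner_eq_inner_diag_sqrt e hμ hμb hωl _ _
      _ ≤ _ := (real_inner_le_norm _ _).trans
          (mul_le_mul h1 (hη h) (norm_nonneg _) (by positivity))
  rcases (norm_nonneg u).eq_or_lt with h0 | h0
  · rw [← h0]; positivity
  · nlinarith

/-- Since ω ≥ 1, (t + λ)⁻¹ ≤ ω (t + ωλ)⁻¹. Then C + ωλ ≤ 2(Ĉ + ωλ) is inverted by testing it at u =
(Ĉ + ωλ)⁻¹ v. -/
theorem inner_diag_resolvent_le (hμ : ∀ i, 0 ≤ μ i) (hμb : ∃ M, ∀ i, |μ i| ≤ M)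
    (ht : ∀ i, 0 ≤ t i) (htb : ∃ M, ∀ i, |t i| ≤ M) {lam ω : ℝ} (hl : 0 < lam) (hω : 1 ≤ ω)
    (hcmp : ∀ h, ‖e.diag (fun i => √(μ i + ω * lam)) h‖ ^ 2 ≤
      2 * ‖b.diag (fun i => √(t i + ω * lam)) h‖ ^ 2) (v : E) :
    inner ℝ v (b.diag (fun i => (t i + lam)⁻¹) v) ≤
      2 * ω * ‖e.diag (fun i => (√(μ i + ω * lam))⁻¹) v‖ ^ 2 := by
  have hωl : 0 < ω * lam := by positivity
  have hbi : ∃ M, ∀ i, |(t i + ω * lam)⁻¹| ≤ M := ⟨_, bounded_inv_add ht hωl⟩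
  set u := b.diag (fun i => (t i + ω * lam)⁻¹) v with hu
  have h1 : inner ℝ v (b.diag (fun i => (t i + lam)⁻¹) v) ≤ ω * inner ℝ v u := by
    refine hasSum_le (fun i => ?_) (b.hasSum_inner_diag ⟨_, bounded_inv_add ht hl⟩ v v)
      ((b.hasSum_inner_diag hbi v v).mul_left ω)
    rw [← mul_assoc ω]
    refine mul_le_mul_of_nonneg_right ?_ (mul_self_nonneg (inner ℝ (b i) v))
    have hti := ht i
    rw [← div_eq_mul_inv, inv_eq_one_div, div_le_div_iff₀ (by positivity) (by positivity)]
    nlinarith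
  have h2 : ‖b.diag (fun i => √(t i + ω * lam)) u‖ ^ 2 = inner ℝ v u := by
    rw [hu, b.diag_comp (bounded_sqrt_add htb _) hbi,
      ← norm_sq_diag_inv_sqrt_add b ht hωl]
    congr 4
    ext i
    have hti := ht i
    have h3 : 0 < √(t i + ω * lam) := Real.sqrt_pos.2 (by positivity)
    have h4 : (√(t i + ω * lam)) ^ 2 = t i + ω * lam := Real.sq_sqrt (by positivity)
    rw [← h4, Real.sqrt_sq h3.le]
    field_simp
  have h3 := hcmp u
  rw [h2] at h3
  have h4 := real_inner_le_norm (e.diag (fun i => √(μ i + ω * lam)) u)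
    (e.diag (fun i => (√(μ i + ω * lam))⁻¹) v)
  rw [← inner_eq_inner_diag_sqrt e hμ hμb hωl, real_inner_comm] at h4
  set p := ‖e.diag (fun i => √(μ i + ω * lam)) u‖
  set q := ‖e.diag (fun i => (√(μ i + ω * lam))⁻¹) v‖
  have h5 : inner ℝ v u ≤ 2 * q ^ 2 := by
    nlinarith [sq_nonneg (p - 2 * q)]
  nlinarith

end Comparison

/-! ### A dyadic sum of resolvent powers replacing the residual function. -/

section DyadicFilter

/-- A finite sum of powers of resolvent functions comparable to `min(1, lam / t) ^ ν`. -/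
def dyadicFilter (ν : ℝ) (k J : ℕ) (lam t : ℝ) : ℝ :=
  ∑ j ∈ Finset.range J, ((2 : ℝ) ^ (-ν)) ^ j * ((2 ^ j * lam) * (t + 2 ^ j * lam)⁻¹) ^ k

theorem two_rpow_neg_mem {ν : ℝ} (hν : 0 < ν) : 0 < (2 : ℝ) ^ (-ν) ∧ (2 : ℝ) ^ (-ν) < 1 :=
  ⟨by positivity, Real.rpow_lt_one_of_one_lt_of_neg one_lt_two (neg_neg_of_pos hν)⟩

theorem sum_geom_le {q : ℝ} (hq0 : 0 ≤ q) (hq1 : q < 1) (J : ℕ) :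
    ∑ j ∈ Finset.range J, q ^ j ≤ (1 - q)⁻¹ := by
  rw [← tsum_geometric_of_lt_one hq0 hq1]
  exact (summable_geometric_of_lt_one hq0 hq1).sum_le_tsum _ fun j _ => by positivity

theorem resolvent_factor_mem {lam t : ℝ} (hl : 0 < lam) (ht : 0 ≤ t) (j : ℕ) :
    0 ≤ (2 ^ j * lam) * (t + 2 ^ j * lam)⁻¹ ∧ (2 ^ j * lam) * (t + 2 ^ j * lam)⁻¹ ≤ 1 := by
  refine ⟨by positivity, ?_⟩
  rw [← div_eq_mul_inv, div_le_one (by positivity)]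
  linarith

variable {ν : ℝ} {k J : ℕ} {lam t : ℝ}

theorem dyadicFilter_nonneg (hl : 0 < lam) (ht : 0 ≤ t) : 0 ≤ dyadicFilter ν k J lam t :=
  Finset.sum_nonneg fun j _ => mul_nonneg (by positivity)
    (pow_nonneg (resolvent_factor_mem hl ht j).1 _)

theorem dyadicFilter_le (hν : 0 < ν) (hl : 0 < lam) (ht : 0 ≤ t) :
    dyadicFilter ν k J lam t ≤ (1 - (2 : ℝ) ^ (-ν))⁻¹ := by
  obtain ⟨h0, h1⟩ := two_rpow_neg_mem hν
  refine le_trans (Finset.sum_le_sum fun j _ => ?_) (sum_geom_le h0.le h1 J)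
  obtain ⟨h2, h3⟩ := resolvent_factor_mem hl ht j
  exact mul_le_of_le_one_right (by positivity) (pow_le_one₀ h2 h3)

/-- A single term suffices. Let m be minimal with t < 2^m λ and j = m - 1, or j = 0 if m = 0. Then t
≤ 2 · 2^j λ makes the resolvent factor at least 1/3, and for m > 0 the qualification inequality at t
≥ 2^j λ gives |r| ≤ K 2^(-νj). -/
theorem le_dyadicFilter (hν : 0 < ν) (hl : 0 < lam) (ht : 0 ≤ t) (hJ : 0 < J)
    (htJ : t < 2 ^ J * lam) {r K : ℝ} (hr : |r| ≤ K) (hrt : 0 < t → |r| * t ^ ν ≤ K * lam ^ ν) :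
    |r| ≤ K * 3 ^ k * dyadicFilter ν k J lam t := by
  have hK : 0 ≤ K := (abs_nonneg _).trans hr
  have key : ∀ j < J, ((2 : ℝ) ^ (-ν)) ^ j * ((2 ^ j * lam) * (t + 2 ^ j * lam)⁻¹) ^ k ≤
      dyadicFilter ν k J lam t := fun j hj =>
    Finset.single_le_sum (f := fun j => ((2 : ℝ) ^ (-ν)) ^ j *
      ((2 ^ j * lam) * (t + 2 ^ j * lam)⁻¹) ^ k)
      (fun j _ => mul_nonneg (by positivity) (pow_nonneg (resolvent_factor_mem hl ht j).1 _))
      (Finset.mem_range.2 hj)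
  have third : ∀ j : ℕ, t ≤ 2 * (2 ^ j * lam) →
      1 ≤ 3 ^ k * ((2 ^ j * lam) * (t + 2 ^ j * lam)⁻¹) ^ k := by
    intro j hj
    rw [← mul_pow]
    refine one_le_pow₀ ?_
    rw [← mul_assoc, ← div_eq_mul_inv, one_le_div (by positivity)]
    linarith
  have hex : ∃ j, t < 2 ^ j * lam := ⟨J, htJ⟩
  classical
  set m := Nat.find hex with hm
  have hm1 : t < 2 ^ m * lam := Nat.find_spec hex
  have hmJ : m ≤ J := Nat.find_min' hex htJ
  rcases Nat.eq_zero_or_pos m with h0 | hpos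
  · rw [h0, pow_zero, one_mul] at hm1
    have h1 := key 0 hJ
    have h2 := third 0 (by rw [pow_zero, one_mul]; linarith)
    rw [pow_zero ((2 : ℝ) ^ (-ν)), one_mul] at h1
    calc |r| ≤ K * 1 := by rw [mul_one]; exact hr
      _ ≤ K * (3 ^ k * dyadicFilter ν k J lam t) := by
        gcongr
        exact h2.trans (by gcongr)
      _ = _ := by ring
  · obtain ⟨i, hi⟩ := Nat.exists_eq_succ_of_ne_zero hpos.ne'
    have hi1 : 2 ^ i * lam ≤ t := not_lt.1 (Nat.find_min hex (by omega))
    have h1 := key i (by omega)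
    have h2 := third i (by
      rw [hi, pow_succ] at hm1
      linarith)
    have ht0 : 0 < t := lt_of_lt_of_le (by positivity) hi1
    have h3 : |r| ≤ K * ((2 : ℝ) ^ (-ν)) ^ i := by
      have h4 := hrt ht0
      have h5 : (2 ^ i * lam) ^ ν ≤ t ^ ν := Real.rpow_le_rpow (by positivity) hi1 hν.le
      have h6 : (2 ^ i * lam) ^ ν = ((2 : ℝ) ^ ν) ^ i * lam ^ ν := by
        rw [Real.mul_rpow (by positivity) hl.le, ← Real.rpow_natCast, ← Real.rpow_natCast,
          ← Real.rpow_mul zero_le_two, ← Real.rpow_mul zero_le_two, mul_comm ν]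
      have h7 : 0 < lam ^ ν := Real.rpow_pos_of_pos hl _
      have h8 : |r| * ((2 : ℝ) ^ ν) ^ i ≤ K := by
        refine le_of_mul_le_mul_right ?_ h7
        calc |r| * ((2 : ℝ) ^ ν) ^ i * lam ^ ν = |r| * (2 ^ i * lam) ^ ν := by rw [h6]; ring
          _ ≤ |r| * t ^ ν := by gcongr
          _ ≤ _ := h4
      rw [Real.rpow_neg zero_le_two, inv_pow, ← div_eq_mul_inv, le_div_iff₀ (by positivity)]
      exact h8
    calc |r| ≤ K * ((2 : ℝ) ^ (-ν)) ^ i * 1 := by rw [mul_one]; exact h3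
      _ ≤ K * ((2 : ℝ) ^ (-ν)) ^ i * (3 ^ k * ((2 ^ i * lam) * (t + 2 ^ i * lam)⁻¹) ^ k) := by
        gcongr
      _ = K * 3 ^ k * (((2 : ℝ) ^ (-ν)) ^ i * ((2 ^ i * lam) * (t + 2 ^ i * lam)⁻¹) ^ k) := by ring
      _ ≤ _ := by gcongr

/-- Auxiliary bound: `min(x, 1/x)` is a multiple of an increment of `x ↦ x / (1 + x)`. -/
theorem le_increment {x y u : ℝ} (hx : 0 < x) (hy : 1 < y) (h1 : x ≤ 1 → u ≤ x)
    (h2 : 1 ≤ x → u ≤ x⁻¹) :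
    u ≤ 2 * (1 + y) / (y - 1) * (y * x / (1 + y * x) - x / (1 + x)) := by
  have hy1 : 0 < y - 1 := by linarith
  have h3 : y * x / (1 + y * x) - x / (1 + x) = (y - 1) * x / ((1 + y * x) * (1 + x)) := by
    field_simp
    ring
  have h4 : 2 * (1 + y) / (y - 1) * (y * x / (1 + y * x) - x / (1 + x)) =
      2 * (1 + y) * x / ((1 + y * x) * (1 + x)) := by
    rw [h3]
    field_simp
  rw [h4]
  rcases le_total x 1 with hx1 | hx1
  · refine (h1 hx1).trans ?_
    rw [le_div_iff₀ (by positivity)]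
    have : (1 + y * x) * (1 + x) ≤ (1 + y) * 2 :=
      mul_le_mul (by nlinarith) (by linarith) (by positivity) (by positivity)
    nlinarith
  · refine (h2 hx1).trans ?_
    rw [le_div_iff₀ (by positivity), inv_mul_le_iff₀ hx]
    have h5 : 1 + y * x ≤ (1 + y) * x := by nlinarith
    have h6 : 1 + x ≤ 2 * x := by linarith
    calc (1 + y * x) * (1 + x) ≤ ((1 + y) * x) * (2 * x) :=
          mul_le_mul h5 h6 (by positivity) (by positivity)
      _ = _ := by ring

/-- After extracting (λ/t)^ν, the j-th term is at most min(x, 1/x) with x = (2^j λ/t)^ν; the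
condition k ≥ 2ν gives the decay for small x. This two-sided geometric sum is bounded uniformly in t
and J by comparison with the telescoping increments of x/(1 + x). -/
theorem dyadicFilter_le_rpow (hν : 0 < ν) (hk : 2 * ν ≤ k) (hl : 0 < lam) (ht : 0 < t) :
    dyadicFilter ν k J lam t ≤
      2 * (1 + (2 : ℝ) ^ ν) / ((2 : ℝ) ^ ν - 1) * (lam / t) ^ ν := by
  have hy : 1 < (2 : ℝ) ^ ν := Real.one_lt_rpow one_lt_two hν
  set y := (2 : ℝ) ^ ν
  set Φ : ℕ → ℝ := fun j => (2 ^ j * lam / t) ^ ν / (1 + (2 ^ j * lam / t) ^ ν) with hΦ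
  have hz : ∀ j : ℕ, 0 < 2 ^ j * lam / t := fun j => by positivity
  have hterm : ∀ j : ℕ, ((2 : ℝ) ^ (-ν)) ^ j * ((2 ^ j * lam) * (t + 2 ^ j * lam)⁻¹) ^ k ≤
      (lam / t) ^ ν * (2 * (1 + y) / (y - 1) * (Φ (j + 1) - Φ j)) := by
    intro j
    set z := 2 ^ j * lam / t with hzdef
    have hz0 : 0 < z := hz j
    have hx0 : 0 < z ^ ν := Real.rpow_pos_of_pos hz0 _
    have h1 : ((2 : ℝ) ^ (-ν)) ^ j = (lam / t) ^ ν * (z ^ ν)⁻¹ := by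
      have h2 : z = 2 ^ j * (lam / t) := by rw [hzdef]; ring
      rw [h2, Real.mul_rpow (by positivity) (by positivity), ← Real.rpow_natCast,
        ← Real.rpow_natCast, ← Real.rpow_mul zero_le_two, ← Real.rpow_mul zero_le_two,
        neg_mul, Real.rpow_neg zero_le_two, mul_comm ν]
      have h3 : 0 < (lam / t) ^ ν := Real.rpow_pos_of_pos (by positivity) _
      field_simp
    have h2 : (2 ^ j * lam) * (t + 2 ^ j * lam)⁻¹ = z / (1 + z) := by
      rw [hzdef]
      field_simp
    have h3 : Φ (j + 1) = y * z ^ ν / (1 + y * z ^ ν) := by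
      have : (2 : ℝ) ^ (j + 1) * lam / t = 2 * z := by rw [hzdef, pow_succ]; ring
      simp only [hΦ]
      rw [this, Real.mul_rpow zero_le_two hz0.le]
    rw [h1, h2, h3, mul_assoc]
    refine mul_le_mul_of_nonneg_left ?_ (by positivity)
    refine le_increment hx0 hy (fun hx1 => ?_) (fun hx1 => ?_)
    · have hz1 : z ≤ 1 := by
        by_contra hcon
        exact absurd hx1 (not_le.2 (Real.one_lt_rpow (not_le.1 hcon) hν))
      have h4 : (z / (1 + z)) ^ k ≤ z ^ ν * z ^ ν := by
        calc (z / (1 + z)) ^ k ≤ z ^ k := by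
              gcongr
              exact div_le_self hz0.le (by linarith)
          _ = z ^ (k : ℝ) := (Real.rpow_natCast _ _).symm
          _ ≤ z ^ (2 * ν) := Real.rpow_le_rpow_of_exponent_ge hz0 hz1 hk
          _ = z ^ ν * z ^ ν := by rw [← Real.rpow_add hz0]; ring_nf
      rw [inv_mul_le_iff₀ hx0]
      exact h4
    · refine mul_le_of_le_one_right (by positivity) (pow_le_one₀ (by positivity) ?_)
      rw [div_le_one (by positivity)]
      linarith
  calc dyadicFilter ν k J lam t
      ≤ ∑ j ∈ Finset.range J, (lam / t) ^ ν * (2 * (1 + y) / (y - 1) * (Φ (j + 1) - Φ j)) :=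
        Finset.sum_le_sum fun j _ => hterm j
    _ = (lam / t) ^ ν * (2 * (1 + y) / (y - 1) * (Φ J - Φ 0)) := by
        rw [← Finset.mul_sum, ← Finset.mul_sum, Finset.sum_range_sub]
    _ ≤ (lam / t) ^ ν * (2 * (1 + y) / (y - 1) * 1) := by
        have hy1 : 0 < y - 1 := by linarith
        have hJ : Φ J ≤ 1 := by
          have := Real.rpow_pos_of_pos (hz J) ν
          simp only [hΦ]
          rw [div_le_one (by positivity)]
          linarith
        have h0 : 0 ≤ Φ 0 := by
          have := Real.rpow_pos_of_pos (hz 0) ν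
          simp only [hΦ]
          positivity
        gcongr
        linarith
    _ = _ := by ring

end DyadicFilter

/-! ### The bias bound for a general index function. -/

section Bias

variable {ι κ E : Type*} [NormedAddCommGroup E] [InnerProductSpace ℝ E]
  (e : HilbertBasis ι ℝ E) (b : HilbertBasis κ ℝ E) {μ : ι → ℝ} {t : κ → ℝ}

theorem bounded_resolvent_factor (hμ : ∀ i, 0 ≤ μ i) {s : ℝ} (hs : 0 < s) (k : ℕ) :
    ∀ i, |(s * (μ i + s)⁻¹) ^ k| ≤ 1 := by
  intro i
  have := hμ i
  rw [abs_of_nonneg (by positivity)]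
  refine pow_le_one₀ (by positivity) ?_
  rw [← div_eq_mul_inv, div_le_one (by positivity)]
  linarith

/-- The second resolvent identity: the difference equals -(Ĉ + s)⁻¹(Ĉ - C) · s(C + s)⁻¹, and the
last factor is a contraction. -/
theorem norm_resolvent_sub_le (hμ : ∀ i, 0 ≤ μ i) (hμb : ∃ M, ∀ i, |μ i| ≤ M) (ht : ∀ i, 0 ≤ t i)
    (htb : ∃ M, ∀ i, |t i| ≤ M) {s Δ : ℝ} (hs : 0 < s) (hΔ0 : 0 ≤ Δ)
    (hΔ : ∀ h, ‖b.diag (fun i => (t i + s)⁻¹) (b.diag t h - e.diag μ h)‖ ≤ Δ * ‖h‖) (h : E) :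
    ‖b.diag (fun i => s * (t i + s)⁻¹) h - e.diag (fun i => s * (μ i + s)⁻¹) h‖ ≤ Δ * ‖h‖ := by
  have h1t : ∃ M, ∀ i, |s * (t i + s)⁻¹| ≤ M := ⟨1, fun i => by
    simpa using bounded_resolvent_factor ht hs 1 i⟩
  have h1μ : ∀ i, |s * (μ i + s)⁻¹| ≤ 1 := fun i => by
    simpa using bounded_resolvent_factor hμ hs 1 i
  set w := e.diag (fun i => s * (μ i + s)⁻¹) h with hw
  have hCw : s • h = e.diag μ w + s • w := by
    refine e.ext_inner fun i => ?_
    rw [inner_add_right, inner_smul_right, inner_smul_right, e.inner_diag hμb, hw,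
      e.inner_diag ⟨1, h1μ⟩]
    have := hμ i
    field_simp
  have hkey : b.diag (fun i => s * (t i + s)⁻¹) h - w =
      - b.diag (fun i => (t i + s)⁻¹) (b.diag t w - e.diag μ w) := by
    have h2 : e.diag μ w = s • h - s • w := by rw [hCw]; abel
    refine b.ext_inner fun i => ?_
    rw [inner_neg_right, b.inner_diag ⟨_, bounded_inv_add ht hs⟩, h2, inner_sub_right,
      inner_sub_right, inner_sub_right, b.inner_diag htb, b.inner_diag h1t, inner_smul_right,
      inner_smul_right]
    have := ht i
    field_simp
    ring
  rw [hkey, norm_neg]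
  refine (hΔ w).trans ?_
  have := e.norm_diag_le zero_le_one h1μ h
  rw [one_mul] at this
  gcongr

/-- Exchanging the k contractions one at a time costs Δ each. -/
theorem norm_resolvent_pow_sub_le (hμ : ∀ i, 0 ≤ μ i) (hμb : ∃ M, ∀ i, |μ i| ≤ M)
    (ht : ∀ i, 0 ≤ t i) (htb : ∃ M, ∀ i, |t i| ≤ M) {s Δ : ℝ} (hs : 0 < s) (hΔ0 : 0 ≤ Δ)
    (hΔ : ∀ h, ‖b.diag (fun i => (t i + s)⁻¹) (b.diag t h - e.diag μ h)‖ ≤ Δ * ‖h‖) (k : ℕ)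
    (h : E) :
    ‖b.diag (fun i => (s * (t i + s)⁻¹) ^ k) h - e.diag (fun i => (s * (μ i + s)⁻¹) ^ k) h‖ ≤
      k * Δ * ‖h‖ := by
  have hbt := bounded_resolvent_factor ht hs
  have hbμ := bounded_resolvent_factor hμ hs
  induction k generalizing h with
  | zero =>
    have h1 : b.diag (fun i => (s * (t i + s)⁻¹) ^ 0) h = h := b.ext_inner fun i => by
      rw [b.inner_diag ⟨1, hbt 0⟩, pow_zero, one_mul]
    have h2 : e.diag (fun i => (s * (μ i + s)⁻¹) ^ 0) h = h := e.ext_inner fun i => by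
      rw [e.inner_diag ⟨1, hbμ 0⟩, pow_zero, one_mul]
    rw [h1, h2]
    simp
  | succ k ih =>
    have hb1t : ∃ M, ∀ i, |s * (t i + s)⁻¹| ≤ M := ⟨1, fun i => by simpa using hbt 1 i⟩
    have hb1μ : ∀ i, |s * (μ i + s)⁻¹| ≤ 1 := fun i => by simpa using hbμ 1 i
    set w := e.diag (fun i => s * (μ i + s)⁻¹) h with hw
    have h1 : b.diag (fun i => (s * (t i + s)⁻¹) ^ (k + 1)) h =
        b.diag (fun i => (s * (t i + s)⁻¹) ^ k) (b.diag (fun i => s * (t i + s)⁻¹) h) := by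
      rw [b.diag_comp ⟨1, hbt k⟩ hb1t]
      simp only [pow_succ]
    have h2 : e.diag (fun i => (s * (μ i + s)⁻¹) ^ (k + 1)) h =
        e.diag (fun i => (s * (μ i + s)⁻¹) ^ k) w := by
      rw [hw, e.diag_comp ⟨1, hbμ k⟩ ⟨1, hb1μ⟩]
      simp only [pow_succ]
    have h3 : b.diag (fun i => (s * (t i + s)⁻¹) ^ (k + 1)) h -
        e.diag (fun i => (s * (μ i + s)⁻¹) ^ (k + 1)) h =
        b.diag (fun i => (s * (t i + s)⁻¹) ^ k) (b.diag (fun i => s * (t i + s)⁻¹) h - w) +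
        (b.diag (fun i => (s * (t i + s)⁻¹) ^ k) w -
          e.diag (fun i => (s * (μ i + s)⁻¹) ^ k) w) := by
      rw [h1, h2, map_sub]
      abel
    have hwn : ‖w‖ ≤ ‖h‖ := by simpa using e.norm_diag_le zero_le_one hb1μ h
    rw [h3]
    calc _ ≤ ‖b.diag (fun i => (s * (t i + s)⁻¹) ^ k) (b.diag (fun i => s * (t i + s)⁻¹) h - w)‖ +
          ‖b.diag (fun i => (s * (t i + s)⁻¹) ^ k) w - e.diag (fun i => (s * (μ i + s)⁻¹) ^ k) w‖ :=
          norm_add_le _ _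
      _ ≤ Δ * ‖h‖ + k * Δ * ‖h‖ := by
          refine add_le_add ?_ ((ih w).trans (by gcongr))
          refine (b.norm_diag_le zero_le_one (hbt k) _).trans ?_
          rw [one_mul]
          exact norm_resolvent_sub_le e b hμ hμb ht htb hs hΔ0 hΔ h
      _ = _ := by push_cast; ring

theorem bounded_dyadicFilter {ν : ℝ} (hν : 0 < ν) {k J : ℕ} {lam : ℝ} (hl : 0 < lam)
    (ht : ∀ i, 0 ≤ t i) :
    ∃ M, ∀ i, |dyadicFilter ν k J lam (t i)| ≤ M :=
  ⟨_, fun i => by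
    rw [abs_of_nonneg (dyadicFilter_nonneg hl (ht i))]
    exact dyadicFilter_le hν hl (ht i)⟩

theorem diag_dyadicFilter {ν : ℝ} (hν : 0 < ν) {k J : ℕ} {lam : ℝ} (hl : 0 < lam)
    (ht : ∀ i, 0 ≤ t i) (h : E) :
    b.diag (fun i => dyadicFilter ν k J lam (t i)) h =
      ∑ j ∈ Finset.range J, ((2 : ℝ) ^ (-ν)) ^ j •
        b.diag (fun i => ((2 ^ j * lam) * (t i + 2 ^ j * lam)⁻¹) ^ k) h := by
  refine b.ext_inner fun i => ?_
  rw [b.inner_diag (bounded_dyadicFilter hν hl ht), inner_sum, dyadicFilter, Finset.sum_mul]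
  refine Finset.sum_congr rfl fun j _ => ?_
  rw [inner_smul_right, b.inner_diag ⟨1, bounded_resolvent_factor ht (by positivity) k⟩, mul_assoc]

theorem norm_dyadicFilter_sub_le (hμ : ∀ i, 0 ≤ μ i) (hμb : ∃ M, ∀ i, |μ i| ≤ M)
    (ht : ∀ i, 0 ≤ t i) (htb : ∃ M, ∀ i, |t i| ≤ M) {ν lam Δ : ℝ} (hν : 0 < ν) (hl : 0 < lam)
    (hΔ0 : 0 ≤ Δ)
    (hΔ : ∀ s, lam ≤ s →
      ∀ h, ‖b.diag (fun i => (t i + s)⁻¹) (b.diag t h - e.diag μ h)‖ ≤ Δ * ‖h‖)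
    (k J : ℕ) (h : E) :
    ‖b.diag (fun i => dyadicFilter ν k J lam (t i)) h -
      e.diag (fun i => dyadicFilter ν k J lam (μ i)) h‖ ≤
      k * (1 - (2 : ℝ) ^ (-ν))⁻¹ * Δ * ‖h‖ := by
  obtain ⟨h0, h1⟩ := two_rpow_neg_mem hν
  rw [diag_dyadicFilter b hν hl ht, diag_dyadicFilter e hν hl hμ, ← Finset.sum_sub_distrib]
  calc _ ≤ ∑ j ∈ Finset.range J, ((2 : ℝ) ^ (-ν)) ^ j * (k * Δ * ‖h‖) := by
        refine norm_sum_le_of_le _ fun j _ => ?_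
        rw [← smul_sub, norm_smul, Real.norm_eq_abs, abs_of_nonneg (by positivity)]
        gcongr
        have hj : (1 : ℝ) ≤ 2 ^ j := one_le_pow₀ one_le_two
        exact norm_resolvent_pow_sub_le e b hμ hμb ht htb (by positivity) hΔ0
          (hΔ _ (by nlinarith)) k h
    _ = (∑ j ∈ Finset.range J, ((2 : ℝ) ^ (-ν)) ^ j) * (k * Δ * ‖h‖) := by rw [Finset.sum_mul]
    _ ≤ (1 - (2 : ℝ) ^ (-ν))⁻¹ * (k * Δ * ‖h‖) := by
        gcongr
        exact sum_geom_le h0.le h1 J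
    _ = _ := by ring

/-- The constant in the bias bound. -/
def biasConst (ν c K M : ℝ) : ℝ :=
  K * 3 ^ ⌈2 * ν⌉₊ * (⌈2 * ν⌉₊ * (1 - (2 : ℝ) ^ (-ν))⁻¹ * M + (1 - (2 : ℝ) ^ (-ν))⁻¹ +
    2 * (1 + (2 : ℝ) ^ ν) / ((2 : ℝ) ^ ν - 1) * c⁻¹)

/-- With F the dyadic filter, |r| ≤ K 3^k F moves the estimate to F(Ĉ), and F(Ĉ) is exchanged for
F(C) at a cost proportional to Δ. Finally F φ ≲ φ(λ) on the spectrum of C: below λ by monotonicity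
of φ, above λ because covering lets φ(t) grow at most like t^ν, which F compensates. No comparison
of φ(Ĉ) with φ(C) is involved. -/
theorem norm_diag_residual_le (hμ : ∀ i, 0 < μ i) (hμb : ∃ M, ∀ i, |μ i| ≤ M)
    (ht : ∀ i, 0 ≤ t i) (htb : ∃ M, ∀ i, |t i| ≤ M) {ν lam Δ c K M : ℝ} (hν : 0 < ν) (hl : 0 < lam)
    (hc : 0 < c) (hΔ0 : 0 ≤ Δ)
    (hΔ : ∀ s, lam ≤ s →
      ∀ h, ‖b.diag (fun i => (t i + s)⁻¹) (b.diag t h - e.diag μ h)‖ ≤ Δ * ‖h‖)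
    {r : κ → ℝ} (hr : ∀ i, |r i| ≤ K) (hrt : ∀ i, 0 < t i → |r i| * t i ^ ν ≤ K * lam ^ ν)
    (hK : 0 ≤ K) {φ : ℝ → ℝ} (hφ0 : ∀ i, 0 ≤ φ (μ i)) (hφl : 0 ≤ φ lam) (hφM : ∀ i, φ (μ i) ≤ M)
    (hM : 0 ≤ M)
    (hφmono : ∀ i, μ i ≤ lam → φ (μ i) ≤ φ lam)
    (hφcov : ∀ i, lam ≤ μ i → φ (μ i) ≤ c⁻¹ * φ lam * (μ i / lam) ^ ν) (h : E) :
    ‖b.diag r (e.diag (fun i => φ (μ i)) h)‖ ≤ biasConst ν c K M * (φ lam + Δ) * ‖h‖ := by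
  obtain ⟨q0, q1⟩ := two_rpow_neg_mem hν
  set k := ⌈2 * ν⌉₊ with hk
  have hk2 : 2 * ν ≤ k := Nat.le_ceil _
  obtain ⟨T, hT⟩ := htb
  -- The number of scales must only reach the top of the spectrum of Ĉ; none of the constants below
  -- depends on it.
  obtain ⟨J₀, hJ₀⟩ := pow_unbounded_of_one_lt (T / lam) one_lt_two
  set J := J₀ + 1
  have hJ' : ∀ i, t i < 2 ^ J * lam := fun i => by
    rw [div_lt_iff₀ hl] at hJ₀
    have hp : 0 < (2 : ℝ) ^ J₀ * lam := by positivity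
    have hti := ((le_abs_self _).trans (hT i)).trans_lt hJ₀
    rw [pow_succ]
    linarith
  have hμ' := fun i => (hμ i).le
  have hφb : ∀ i, |φ (μ i)| ≤ M := fun i => by rw [abs_of_nonneg (hφ0 i)]; exact hφM i
  set x := e.diag (fun i => φ (μ i)) h
  have hx : ‖x‖ ≤ M * ‖h‖ := e.norm_diag_le hM hφb h
  have hFb := bounded_dyadicFilter (k := k) (J := J) hν hl ht
  have hFe := bounded_dyadicFilter (k := k) (J := J) hν hl hμ'
  have h1 : ‖b.diag r x‖ ≤ K * 3 ^ k * ‖b.diag (fun i => dyadicFilter ν k J lam (t i)) x‖ := by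
    have h2 : b.diag (fun i => K * 3 ^ k * dyadicFilter ν k J lam (t i)) x =
        (K * 3 ^ k) • b.diag (fun i => dyadicFilter ν k J lam (t i)) x := by
      refine b.ext_inner fun i => ?_
      rw [inner_smul_right, b.inner_diag hFb, b.inner_diag, mul_assoc]
      obtain ⟨C, hC⟩ := hFb
      refine ⟨|K * 3 ^ k| * C, fun i => ?_⟩
      rw [abs_mul]
      gcongr
      exact hC i
    have h3 : ‖(K * 3 ^ k) • b.diag (fun i => dyadicFilter ν k J lam (t i)) x‖ =
        K * 3 ^ k * ‖b.diag (fun i => dyadicFilter ν k J lam (t i)) x‖ := by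
      rw [norm_smul, Real.norm_eq_abs, abs_of_nonneg (by positivity)]
    rw [← h3, ← h2]
    refine b.norm_diag_le_norm_diag ?_ (fun i => ?_) x
    · obtain ⟨C, hC⟩ := hFb
      refine ⟨|K * 3 ^ k| * C, fun i => ?_⟩
      rw [abs_mul]
      gcongr
      exact hC i
    · exact (le_dyadicFilter hν hl (ht i) J₀.succ_pos (hJ' i) (hr i) (hrt i)).trans (le_abs_self _)
  have h4 := norm_dyadicFilter_sub_le e b hμ' hμb ht ⟨T, hT⟩ hν hl hΔ0 hΔ k J x
  have hy : 1 < (2 : ℝ) ^ ν := Real.one_lt_rpow one_lt_two hν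
  have hy1 : 0 < (2 : ℝ) ^ ν - 1 := by linarith
  have hq1 : 0 < 1 - (2 : ℝ) ^ (-ν) := by linarith
  set A := (1 - (2 : ℝ) ^ (-ν))⁻¹
  set B := 2 * (1 + (2 : ℝ) ^ ν) / ((2 : ℝ) ^ ν - 1)
  have hA : 0 ≤ A := by positivity
  have hB : 0 ≤ B := by positivity
  have h5 : ‖e.diag (fun i => dyadicFilter ν k J lam (μ i)) x‖ ≤ (A + B * c⁻¹) * φ lam * ‖h‖ := by
    rw [e.diag_comp hFe ⟨M, hφb⟩]
    refine e.norm_diag_le (by positivity) (fun i => ?_) h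
    have hF0 := dyadicFilter_nonneg (ν := ν) (k := k) (J := J) hl (hμ' i)
    rw [abs_of_nonneg (mul_nonneg hF0 (hφ0 i))]
    rcases le_total (μ i) lam with hi | hi
    · calc dyadicFilter ν k J lam (μ i) * φ (μ i) ≤ A * φ lam :=
            mul_le_mul (dyadicFilter_le hν hl (hμ' i)) (hφmono i hi) (hφ0 i) hA
        _ ≤ (A + B * c⁻¹) * φ lam := by
            gcongr
            exact le_add_of_nonneg_right (by positivity)
    · have hμi := hμ i
      calc dyadicFilter ν k J lam (μ i) * φ (μ i)
          ≤ (B * (lam / μ i) ^ ν) * (c⁻¹ * φ lam * (μ i / lam) ^ ν) :=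
            mul_le_mul (dyadicFilter_le_rpow hν hk2 hl hμi) (hφcov i hi) (hφ0 i) (by positivity)
        _ = B * c⁻¹ * φ lam * ((lam / μ i) ^ ν * (μ i / lam) ^ ν) := by ring
        _ = B * c⁻¹ * φ lam := by
            rw [← Real.mul_rpow (by positivity) (by positivity)]
            have : lam / μ i * (μ i / lam) = 1 := by field_simp
            rw [this, Real.one_rpow, mul_one]
        _ ≤ (A + B * c⁻¹) * φ lam := by
            gcongr
            exact le_add_of_nonneg_left hA
  have h6 : ‖b.diag (fun i => dyadicFilter ν k J lam (t i)) x‖ ≤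
      (k * A * M + A + B * c⁻¹) * (φ lam + Δ) * ‖h‖ := by
    have h7 := norm_add_le (b.diag (fun i => dyadicFilter ν k J lam (t i)) x -
      e.diag (fun i => dyadicFilter ν k J lam (μ i)) x)
      (e.diag (fun i => dyadicFilter ν k J lam (μ i)) x)
    rw [sub_add_cancel] at h7
    have h8 : k * A * Δ * ‖x‖ ≤ k * A * M * Δ * ‖h‖ := by
      calc k * A * Δ * ‖x‖ ≤ k * A * Δ * (M * ‖h‖) := by gcongr
        _ = _ := by ring
    have h9 : 0 ≤ k * A * M * φ lam * ‖h‖ := by positivity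
    have h10 : 0 ≤ (A + B * c⁻¹) * Δ * ‖h‖ := by positivity
    nlinarith
  calc ‖b.diag r x‖ ≤ K * 3 ^ k * ‖b.diag (fun i => dyadicFilter ν k J lam (t i)) x‖ := h1
    _ ≤ K * 3 ^ k * ((k * A * M + A + B * c⁻¹) * (φ lam + Δ) * ‖h‖) := by gcongr
    _ = _ := by rw [biasConst]; ring

end Bias

/-! ### The effective dimension under polynomial eigenvalue decay. -/

section EffectiveDimension

/-- A discrete form of integrating y^(-a) over [x, x + 1], obtained from 1 + y ≤ e^y used twice. -/
theorem rpow_neg_le_telescope {a : ℝ} (ha : 1 < a) {x : ℝ} (hx : 0 < x) :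
    (a - 1) * (x + 1) ^ (-a) ≤ x ^ (1 - a) - (x + 1) ^ (1 - a) := by
  have hx1 : 0 < x + 1 := by linarith
  have h1 : x / (x + 1) ≤ Real.exp (-(x + 1)⁻¹) := by
    have := Real.add_one_le_exp (-(x + 1)⁻¹)
    calc x / (x + 1) = -(x + 1)⁻¹ + 1 := by field_simp; ring
      _ ≤ _ := this
  have h2 : 1 + (a - 1) * (x + 1)⁻¹ ≤ (x / (x + 1)) ^ (1 - a) := by
    calc 1 + (a - 1) * (x + 1)⁻¹ ≤ Real.exp ((a - 1) * (x + 1)⁻¹) := by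
          linarith [Real.add_one_le_exp ((a - 1) * (x + 1)⁻¹)]
      _ = Real.exp (-(x + 1)⁻¹) ^ (1 - a) := by rw [← Real.exp_mul]; ring_nf
      _ ≤ _ := Real.rpow_le_rpow_of_nonpos (by positivity) h1 (by linarith)
  have h3 : (x + 1) ^ (-a) = (x + 1) ^ (1 - a) * (x + 1)⁻¹ := by
    rw [← Real.rpow_neg_one, ← Real.rpow_add hx1]; ring_nf
  have h4 : x ^ (1 - a) = (x + 1) ^ (1 - a) * (x / (x + 1)) ^ (1 - a) := by
    rw [← Real.mul_rpow hx1.le (by positivity)]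
    congr 1
    field_simp
  rw [h3, h4]
  have : 0 < (x + 1) ^ (1 - a) := by positivity
  nlinarith

/-- The constant in the bound `∑ μᵢ / (μᵢ + lam) ≤ C lam^{-1/a}` of the effective dimension. -/
def effDimConst (u a : ℝ) : ℝ := 2 + u / (a - 1)

theorem effDimConst_pos {u a : ℝ} (hu : 0 < u) (ha : 1 < a) : 0 < effDimConst u a := by
  have : 0 < a - 1 := by linarith
  unfold effDimConst
  positivity

/-- The first m = ⌈λ^(-1/a)⌉ terms are at most 1 each, and the remaining ones are at most μᵢ/λ,
summed by telescoping. Allowing any s ≥ λ on the left serves the enlarged level ωλ. -/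
theorem sum_div_add_le {a u : ℝ} (ha : 1 < a) (hu : 0 < u) {μ : ℕ → ℝ} (hμ0 : ∀ i, 0 < μ i)
    (hμ : ∀ i : ℕ, μ i ≤ u * ((i : ℝ) + 1) ^ (-a)) {lam s : ℝ} (hl : lam ∈ Ioc 0 1)
    (hs : lam ≤ s) (n : ℕ) :
    ∑ i ∈ Finset.range n, μ i / (μ i + s) ≤ effDimConst u a * lam ^ (-(1 / a)) := by
  obtain ⟨hl0, hl1⟩ := hl
  have ha0 : 0 < a := by linarith
  have ha1 : 0 < a - 1 := by linarith
  set x := lam ^ (-(1 / a)) with hx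
  -- This uses `lam ≤ 1`; it allows rounding up with `m ≤ 2 * x`.
  have hx1 : 1 ≤ x := Real.one_le_rpow_of_pos_of_le_one_of_nonpos hl0 hl1 (by
    rw [neg_nonpos]; positivity)
  set m := ⌈x⌉₊ with hm
  have hmx : x ≤ m := Nat.le_ceil x
  have hmx2 : (m : ℝ) ≤ 2 * x := by
    have := Nat.ceil_lt_add_one (zero_le_one.trans hx1)
    linarith
  have hm0 : 0 < m := Nat.ceil_pos.2 (by linarith)
  have hterm0 : ∀ i, 0 ≤ μ i / (μ i + s) := fun i => by
    have := hμ0 i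
    have : 0 < s := by linarith
    positivity
  have h1 : ∑ i ∈ Finset.range n, μ i / (μ i + s) ≤
      ∑ i ∈ Finset.range (m + n), μ i / (μ i + s) :=
    Finset.sum_le_sum_of_subset_of_nonneg (Finset.range_mono (by omega)) fun i _ _ => hterm0 i
  have h2 : ∑ i ∈ Finset.range m, μ i / (μ i + s) ≤ m := by
    calc ∑ i ∈ Finset.range m, μ i / (μ i + s) ≤ ∑ i ∈ Finset.range m, (1 : ℝ) := by
          refine Finset.sum_le_sum fun i _ => ?_
          have := hμ0 i
          rw [div_le_one (by linarith)]
          linarith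
      _ = m := by simp
  have h3 : ∀ i : ℕ, μ (m + i) / (μ (m + i) + s) ≤ u / (lam * (a - 1)) *
      (((m + i : ℕ) : ℝ) ^ (1 - a) - ((m + (i + 1) : ℕ) : ℝ) ^ (1 - a)) := by
    intro i
    have hp : (0 : ℝ) < ((m + i : ℕ) : ℝ) := by exact_mod_cast (by omega : 0 < m + i)
    have h4 := rpow_neg_le_telescope ha hp
    have h5 : ((m + (i + 1) : ℕ) : ℝ) = ((m + i : ℕ) : ℝ) + 1 := by push_cast; ring
    rw [h5]
    calc μ (m + i) / (μ (m + i) + s) ≤ (u * (((m + i : ℕ) : ℝ) + 1) ^ (-a)) / lam := by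
          have := hμ0 (m + i)
          exact div_le_div₀ (by positivity) (hμ _) hl0 (by linarith)
      _ = u / (lam * (a - 1)) * ((a - 1) * (((m + i : ℕ) : ℝ) + 1) ^ (-a)) := by
          field_simp
      _ ≤ _ := by gcongr
  have h6 : ∑ i ∈ Finset.range n, μ (m + i) / (μ (m + i) + s) ≤
      u / (lam * (a - 1)) * (m : ℝ) ^ (1 - a) := by
    calc _ ≤ ∑ i ∈ Finset.range n, u / (lam * (a - 1)) *
          (((m + i : ℕ) : ℝ) ^ (1 - a) - ((m + (i + 1) : ℕ) : ℝ) ^ (1 - a)) :=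
          Finset.sum_le_sum fun i _ => h3 i
      _ = u / (lam * (a - 1)) * ((m : ℝ) ^ (1 - a) - ((m + n : ℕ) : ℝ) ^ (1 - a)) := by
          rw [← Finset.mul_sum,
            Finset.sum_range_sub' (fun i => ((m + i : ℕ) : ℝ) ^ (1 - a))]
          simp
      _ ≤ _ := by
          gcongr
          linarith [Real.rpow_nonneg (Nat.cast_nonneg (α := ℝ) (m + n)) (1 - a)]
  have h7 : (m : ℝ) ^ (1 - a) ≤ lam * x := by
    calc (m : ℝ) ^ (1 - a) ≤ x ^ (1 - a) :=
          Real.rpow_le_rpow_of_nonpos (by linarith) hmx (by linarith)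
      _ = lam ^ (1 + -(1 / a)) := by
          rw [hx, ← Real.rpow_mul hl0.le]
          congr 1
          field_simp
          ring
      _ = lam * x := by rw [Real.rpow_add hl0, Real.rpow_one]
  calc _ ≤ _ := h1
    _ = ∑ i ∈ Finset.range m, μ i / (μ i + s) +
        ∑ i ∈ Finset.range n, μ (m + i) / (μ (m + i) + s) := Finset.sum_range_add _ m n
    _ ≤ 2 * x + u / (lam * (a - 1)) * (lam * x) := by
        refine add_le_add (h2.trans hmx2) (h6.trans ?_)
        gcongr
    _ = effDimConst u a * x := by
        unfold effDimConst
        field_simp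

end EffectiveDimension

/-! ### Measurability of the feature map and the covariance form. -/

section CovarianceInputs

variable {X H : Type*} [MeasurableSpace X]
  [NormedAddCommGroup H] [InnerProductSpace ℝ H] [CompleteSpace H] [RKHS ℝ H X ℝ]

theorem measurable_apply_of_mem_rkhs (hmeas : ∀ t, Measurable fun x => scalarKernel H x t) (h : H) :
    Measurable fun x => h x := by
  have hspan : ∀ u ∈ Submodule.span ℝ (range (featureMap H)), Measurable fun x : X => u x := by
    intro u hu
    induction hu using Submodule.span_induction with
    | mem u hu =>
      obtain ⟨t, rfl⟩ := hu
      simp only [featureMap_apply]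
      exact hmeas t
    | zero => simp only [← inner_featureMap, inner_zero_right]; exact measurable_const
    | add u v _ _ hu hv =>
      simp only [← inner_featureMap, inner_add_right] at hu hv ⊢
      exact hu.add hv
    | smul r u _ hu =>
      simp only [← inner_featureMap, inner_smul_right] at hu ⊢
      exact hu.const_mul r
  have hh : h ∈ closure (Submodule.span ℝ (range (featureMap H (X := X))) : Set H) := by
    rw [← Submodule.topologicalClosure_coe, dense_span_featureMap]
    trivial
  obtain ⟨u, hu, hlim⟩ := mem_closure_iff_seq_limit.1 hh
  refine measurable_of_tendsto_metrizable (fun n => hspan _ (hu n)) (tendsto_pi_nhds.2 fun x => ?_)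
  simp only [← inner_featureMap]
  exact tendsto_const_nhds.inner hlim

/-- The partial sums of k(x, ·) = ∑ eᵢ(x) eᵢ are strongly measurable; the countable basis makes them
a sequence. -/
theorem stronglyMeasurable_featureMap (hmeas : ∀ t, Measurable fun x => scalarKernel H x t)
    (e : HilbertBasis ℕ ℝ H) : StronglyMeasurable (featureMap H (X := X)) := by
  refine stronglyMeasurable_of_tendsto
    (f := fun n x => ∑ i ∈ Finset.range n, (e i) x • e i) Filter.atTop (fun n => ?_)
    (tendsto_pi_nhds.2 fun x => ?_)
  · refine Finset.stronglyMeasurable_fun_sum _ fun i _ => ?_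
    exact (measurable_apply_of_mem_rkhs hmeas (e i)).stronglyMeasurable.smul_const _
  · have := (e.hasSum_inner_smul (featureMap H x)).tendsto_sum_nat
    simpa only [real_inner_comm, inner_featureMap] using this

variable {κ : ℝ}

theorem norm_featureMap_le (hκ : ∀ x, scalarKernel H x x ≤ κ ^ 2) (x : X) :
    ‖featureMap H x‖ ≤ |κ| :=
  abs_le_of_sq_le_sq' (by rw [norm_featureMap_sq, sq_abs]; exact hκ x) (abs_nonneg κ) |>.2

theorem abs_apply_le_norm (hκ : ∀ x, scalarKernel H x x ≤ κ ^ 2) (h : H) (x : X) :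
    |h x| ≤ |κ| * ‖h‖ := by
  rw [← inner_featureMap]
  exact (abs_real_inner_le_norm _ _).trans
    (mul_le_mul_of_nonneg_right (norm_featureMap_le hκ x) (norm_nonneg _))

theorem inner_covarianceOp (hmeas : ∀ t, Measurable fun x => scalarKernel H x t)
    (hκ : ∀ x, scalarKernel H x x ≤ κ ^ 2) (e : HilbertBasis ℕ ℝ H)
    (qX : Measure X) [IsProbabilityMeasure qX] (h h' : H) :
    inner ℝ h (covarianceOp H qX h') = ∫ x, h x * h' x ∂qX := by
  have hm := stronglyMeasurable_featureMap hmeas e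
  have hint : Integrable (fun x => InnerProductSpace.rankOne ℝ (featureMap H x) (featureMap H x))
      qX := by
    refine Integrable.of_bound (C := |κ| * |κ|) ?_ (Filter.Eventually.of_forall fun x => ?_)
    · refine StronglyMeasurable.aestronglyMeasurable ?_
      refine Continuous.comp_stronglyMeasurable
        (g := fun u : H => InnerProductSpace.rankOne ℝ u u) ?_ hm
      exact (InnerProductSpace.rankOne ℝ (E := H) (F := H)).continuous.clm_apply continuous_id
    · rw [InnerProductSpace.norm_rankOne]
      exact mul_le_mul (norm_featureMap_le hκ x) (norm_featureMap_le hκ x) (norm_nonneg _)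
        (abs_nonneg _)
  rw [covarianceOp, ContinuousLinearMap.integral_apply hint, ← integral_inner]
  · refine integral_congr_ae (Filter.Eventually.of_forall fun x => ?_)
    simp only [InnerProductSpace.rankOne_apply, inner_smul_right, inner_featureMap]
    rw [real_inner_comm, inner_featureMap]
    ring
  · exact hint.apply_continuousLinearMap h'

end CovarianceInputs

/-! ### Hilbert–Schmidt tensors as square-summable matrices. -/

section HSTensor

variable {H : Type*} [NormedAddCommGroup H] [InnerProductSpace ℝ H] (e : HilbertBasis ℕ ℝ H)

theorem HilbertBasis.hasSum_mul_inner (u v u' v' : H) :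
    HasSum (fun p : ℕ × ℕ => (inner ℝ (e p.1) u * inner ℝ (e p.1) u') *
      (inner ℝ (e p.2) v * inner ℝ (e p.2) v')) (inner ℝ u u' * inner ℝ v v') := by
  have h : ∀ x y : H, HasSum (fun i => inner ℝ (e i) x * inner ℝ (e i) y) (inner ℝ x y) := by
    intro x y
    simpa only [real_inner_comm] using e.hasSum_inner_mul_inner x y
  exact (h u u').mul (h v v') (summable_mul_of_summable_norm (h u u').summable.norm
    (h v v').summable.norm)

/-- The tensor `u ⊗ v`, represented by its coordinates, as an element of the Hilbert space of
square-summable matrices. -/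
def hsTensorElem (u v : H) : lp (fun _ : ℕ × ℕ => ℝ) 2 :=
  ⟨fun p => inner ℝ (e p.1) u * inner ℝ (e p.2) v, by
    refine (memℓp_gen_iff (by norm_num)).2 ?_
    refine (e.hasSum_mul_inner u v u v).summable.congr fun p => ?_
    simp only [ENNReal.toReal_ofNat, Real.rpow_two, Real.norm_eq_abs, sq_abs]
    ring⟩

theorem inner_hsTensorElem (u v u' v' : H) :
    inner ℝ (hsTensorElem e u v) (hsTensorElem e u' v') = inner ℝ u u' * inner ℝ v v' := by
  rw [lp.inner_eq_tsum, ← (e.hasSum_mul_inner u v u' v').tsum_eq]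
  refine tsum_congr fun p => ?_
  simp only [hsTensorElem, RCLike.inner_apply, conj_trivial]
  ring

theorem norm_hsTensorElem (u v : H) : ‖hsTensorElem e u v‖ = ‖u‖ * ‖v‖ := by
  rw [← sq_eq_sq₀ (norm_nonneg _) (by positivity), ← real_inner_self_eq_norm_sq,
    inner_hsTensorElem, real_inner_self_eq_norm_sq, real_inner_self_eq_norm_sq, mul_pow]

/-- The bilinear map `(u, v) ↦ u ⊗ v`. -/
def hsTensor : H →L[ℝ] H →L[ℝ] lp (fun _ : ℕ × ℕ => ℝ) 2 :=
  LinearMap.mkContinuous₂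
    (LinearMap.mk₂ ℝ (hsTensorElem e)
      (fun u u' v => by
        ext p
        change inner ℝ _ _ * _ = inner ℝ _ _ * _ + inner ℝ _ _ * _
        rw [inner_add_right, add_mul])
      (fun r u v => by ext p; simp [hsTensorElem, inner_smul_right, mul_assoc])
      (fun u v v' => by
        ext p
        change _ * inner ℝ _ _ = _ * inner ℝ _ _ + _ * inner ℝ _ _
        rw [inner_add_right, mul_add])
      (fun r u v => by ext p; simp [hsTensorElem, inner_smul_right, mul_left_comm]))
    1 (fun u v => by simp [norm_hsTensorElem])

/-- Bernstein's inequality above is for vectors in a Hilbert space, so rank-one operators are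
encoded as such vectors. Pairing with x ⊗ h recovers the bilinear form at (x, h), whence an estimate
for all h at once. -/
theorem inner_hsTensor (u v u' v' : H) :
    inner ℝ (hsTensor e u v) (hsTensor e u' v') = inner ℝ u u' * inner ℝ v v' :=
  inner_hsTensorElem e u v u' v'

theorem norm_hsTensor (u v : H) : ‖hsTensor e u v‖ = ‖u‖ * ‖v‖ := norm_hsTensorElem e u v

end HSTensor

/-! ### Bernstein's inequality for uncentred vectors. -/

section Deviation

variable {E : Type*} [NormedAddCommGroup E] [InnerProductSpace ℝ E] [CompleteSpace E]
  {α : Type*} [MeasurableSpace α] (μ : Measure α) [IsProbabilityMeasure μ] {ζ : α → E}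

theorem integral_norm_sub_integral_sq_le (hζ : StronglyMeasurable ζ) {c : ℝ}
    (hc : ∀ x, ‖ζ x‖ ≤ c) :
    ∫ x, ‖ζ x - ∫ y, ζ y ∂μ‖ ^ 2 ∂μ ≤ ∫ x, ‖ζ x‖ ^ 2 ∂μ := by
  have hint : Integrable ζ μ :=
    Integrable.of_bound hζ.aestronglyMeasurable c (Filter.Eventually.of_forall hc)
  have hint2 : Integrable (fun x => ‖ζ x‖ ^ 2) μ := by
    refine Integrable.of_bound (C := c ^ 2) (hζ.norm.pow 2).aestronglyMeasurable
      (Filter.Eventually.of_forall fun x => ?_)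
    rw [norm_pow, norm_norm]
    have := hc x
    gcongr
  set m := ∫ y, ζ y ∂μ with hm
  have h1 : ∀ x, ‖ζ x - m‖ ^ 2 = ‖ζ x‖ ^ 2 - 2 * inner ℝ m (ζ x) + ‖m‖ ^ 2 := fun x => by
    rw [norm_sub_sq_real, real_inner_comm]
  have hint3 : Integrable (fun x => 2 * inner ℝ m (ζ x)) μ := (hint.const_inner m).const_mul 2
  simp only [h1]
  rw [integral_add (f := fun x => ‖ζ x‖ ^ 2 - 2 * inner ℝ m (ζ x)) (hint2.sub hint3)
    (integrable_const _), integral_sub hint2 hint3,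
    integral_const_mul, integral_inner hint, ← hm, real_inner_self_eq_norm_sq]
  simp only [integral_const, probReal_univ, one_smul]
  nlinarith [sq_nonneg ‖m‖]

/-- Centring can double the norm bound, hence 4c in place of 2c, but does not increase the second
moment. -/
theorem measure_norm_sum_sub_integral_gt_le (hζ : StronglyMeasurable ζ) {c σ : ℝ} (hc : 0 < c)
    (hσ : 0 ≤ σ) (hζc : ∀ x, ‖ζ x‖ ≤ c) (hζσ : ∫ x, ‖ζ x‖ ^ 2 ∂μ ≤ σ ^ 2) {n : ℕ} {L : ℝ}
    (hL : 0 < L) :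
    Measure.pi (fun _ : Fin n => μ)
      {z | 4 * c * L + 2 * σ * √(n * L) < ‖∑ i, ζ (z i) - (n : ℝ) • ∫ x, ζ x ∂μ‖} ≤
      ENNReal.ofReal (2 * Real.exp (-L)) := by
  have hint : Integrable ζ μ :=
    Integrable.of_bound hζ.aestronglyMeasurable c (Filter.Eventually.of_forall hζc)
  have h := measure_norm_sum_gt_le μ (d := fun x => ζ x - ∫ y, ζ y ∂μ)
    (hζ.sub stronglyMeasurable_const) (c := 2 * c) (σ := σ) (by positivity) hσ (fun x => ?_) ?_
    ((integral_norm_sub_integral_sq_le μ hζ hζc).trans hζσ) (n := n) hL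
  · refine le_trans (measure_mono fun z hz => ?_) h
    simp only [mem_ofPred_eq, Finset.sum_sub_distrib, Finset.sum_const, Finset.card_univ,
      Fintype.card_fin] at hz ⊢
    rw [← Nat.cast_smul_eq_nsmul ℝ]
    linarith
  · have h1 : ‖∫ y, ζ y ∂μ‖ ≤ c := by
      simpa using norm_integral_le_of_norm_le_const (μ := μ) (Filter.Eventually.of_forall hζc)
    linarith [norm_sub_le (ζ x) (∫ y, ζ y ∂μ), hζc x]
  · rw [integral_sub hint (integrable_const _)]
    simp

end Deviation

/-! ### Concentration of the covariance and of the effective dimension. -/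

section CovarianceDeviation

variable {X Y H : Type*} [MeasurableSpace X] [MeasurableSpace Y]
  [NormedAddCommGroup H] [InnerProductSpace ℝ H] [CompleteSpace H] [RKHS ℝ H X ℝ]

theorem integral_withDensity_ofReal {pX qX : Measure X} {β : X → ℝ} (hβm : Measurable β)
    (hβ0 : ∀ x, 0 ≤ β x) (hq : qX = pX.withDensity fun x => ENNReal.ofReal (β x)) {E : Type*}
    [NormedAddCommGroup E] [NormedSpace ℝ E] (f : X → E) :
    ∫ x, f x ∂qX = ∫ x, β x • f x ∂pX := by
  rw [hq, integral_withDensity_eq_integral_toReal_smul hβm.ennreal_ofReal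
    (Filter.Eventually.of_forall fun x => ENNReal.ofReal_lt_top)]
  simp only [ENNReal.toReal_ofReal (hβ0 _)]

theorem integral_compProd_fst {E : Type*} [NormedAddCommGroup E] [NormedSpace ℝ E]
    (pX : Measure X) [IsProbabilityMeasure pX] (𝒦 : Kernel X Y) [IsMarkovKernel 𝒦] {f : X → E}
    (hf : StronglyMeasurable f) : ∫ w, f w.1 ∂(pX ⊗ₘ 𝒦) = ∫ x, f x ∂pX := by
  conv_rhs => rw [← Measure.fst_compProd pX 𝒦, Measure.fst,
    integral_map measurable_fst.aemeasurable hf.aestronglyMeasurable]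

/-- The common assumptions on the kernel, the weights `β = dq_X / dp_X` and the eigenbasis of the
covariance operator. -/
structure IsWeightedModel (pX qX : Measure X) (β : X → ℝ) (s : ℝ) (e : HilbertBasis ℕ ℝ H)
    (μ : ℕ → ℝ) : Prop where
  measurable_kernel : ∀ t, Measurable fun x => scalarKernel H x t
  bounded_kernel : ∃ κ : ℝ, ∀ x, scalarKernel H x x ≤ κ ^ 2
  measurable_weight : Measurable β
  weight_nonneg : ∀ x, 0 ≤ β x
  density : qX = pX.withDensity fun x => ENNReal.ofReal (β x)
  weight_mul_le : ∀ x, β x * ‖featureMap H x‖ ^ 2 ≤ s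
  eigenvalue_pos : ∀ i, 0 < μ i
  eigen : ∀ i, covarianceOp H qX (e i) = μ i • e i

namespace IsWeightedModel

variable {pX qX : Measure X} [IsProbabilityMeasure pX] [IsProbabilityMeasure qX]
  {β : X → ℝ} {s : ℝ} {e : HilbertBasis ℕ ℝ H} {μ : ℕ → ℝ}

theorem inner_covarianceOp (hm : IsWeightedModel pX qX β s e μ) (h h' : H) :
    inner ℝ h (covarianceOp H qX h') = ∫ x, β x * (h x * h' x) ∂pX := by
  obtain ⟨κ, hκ⟩ := hm.bounded_kernel
  rw [_root_.inner_covarianceOp hm.measurable_kernel hκ e,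
    integral_withDensity_ofReal hm.measurable_weight hm.weight_nonneg hm.density]
  rfl

theorem weight_mul_sq_le (hm : IsWeightedModel pX qX β s e μ) (h : H) (x : X) :
    β x * h x ^ 2 ≤ s * ‖h‖ ^ 2 := by
  have h1 : h x ^ 2 ≤ ‖featureMap H x‖ ^ 2 * ‖h‖ ^ 2 := by
    rw [← inner_featureMap, ← mul_pow, ← sq_abs]
    gcongr
    exact abs_real_inner_le_norm _ _
  calc β x * h x ^ 2 ≤ β x * (‖featureMap H x‖ ^ 2 * ‖h‖ ^ 2) :=
        mul_le_mul_of_nonneg_left h1 (hm.weight_nonneg x)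
    _ = β x * ‖featureMap H x‖ ^ 2 * ‖h‖ ^ 2 := by ring
    _ ≤ _ := mul_le_mul_of_nonneg_right (hm.weight_mul_le x) (sq_nonneg _)

theorem integrable_weight_mul_sq (hm : IsWeightedModel pX qX β s e μ) (h : H) :
    Integrable (fun x => β x * h x ^ 2) pX := by
  refine Integrable.of_bound (C := s * ‖h‖ ^ 2) (hm.measurable_weight.mul
    ((measurable_apply_of_mem_rkhs hm.measurable_kernel h).pow_const 2)).aestronglyMeasurable
    (Filter.Eventually.of_forall fun x => ?_)
  rw [Real.norm_eq_abs, abs_of_nonneg (mul_nonneg (hm.weight_nonneg x) (sq_nonneg _))]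
  exact hm.weight_mul_sq_le h x

theorem integral_weight_mul_sq (hm : IsWeightedModel pX qX β s e μ) (i : ℕ) :
    ∫ x, β x * e i x ^ 2 ∂pX = μ i := by
  have h := hm.inner_covarianceOp (e i) (e i)
  rw [hm.eigen, inner_smul_right, real_inner_self_eq_norm_sq, e.orthonormal.1 i, one_pow,
    mul_one] at h
  rw [h]
  simp only [pow_two]

theorem eigenvalue_le (hm : IsWeightedModel pX qX β s e μ) (i : ℕ) : μ i ≤ s := by
  rw [← hm.integral_weight_mul_sq i]
  refine (integral_mono (hm.integrable_weight_mul_sq (e i)) (integrable_const s)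
    fun x => ?_).trans ?_
  · simpa [e.orthonormal.1 i] using hm.weight_mul_sq_le (e i) x
  · simp

theorem eigenvalue_bounded (hm : IsWeightedModel pX qX β s e μ) : ∃ C, ∀ i, |μ i| ≤ C :=
  ⟨s, fun i => by rw [abs_of_pos (hm.eigenvalue_pos i)]; exact hm.eigenvalue_le i⟩

theorem pos (hm : IsWeightedModel pX qX β s e μ) : 0 < s :=
  (hm.eigenvalue_pos 0).trans_le (hm.eigenvalue_le 0)

theorem covarianceOp_eq_diag (hm : IsWeightedModel pX qX β s e μ) :
    covarianceOp H qX = e.diag μ :=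
  (e.eq_diag (e.isSymmetric_of_eigen hm.eigen) hm.eigen).2

/-- The vector `(C + r)^{-1/2} k(x, ·)`. -/
def _root_.whitenedFeature (e : HilbertBasis ℕ ℝ H) (μ : ℕ → ℝ) (r : ℝ) (x : X) : H :=
  e.diag (fun i => (√(μ i + r))⁻¹) (featureMap H x)

theorem stronglyMeasurable_whitenedFeature (hm : IsWeightedModel pX qX β s e μ) (r : ℝ) :
    StronglyMeasurable (whitenedFeature (X := X) e μ r) :=
  (ContinuousLinearMap.continuous _).comp_stronglyMeasurable
    (stronglyMeasurable_featureMap hm.measurable_kernel e)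

theorem norm_whitenedFeature_le (hm : IsWeightedModel pX qX β s e μ) {r : ℝ} (hr : 0 < r)
    (x : X) : ‖whitenedFeature e μ r x‖ ≤ (√r)⁻¹ * ‖featureMap H x‖ :=
  e.norm_diag_le (by positivity) (bounded_inv_sqrt_add (fun i => (hm.eigenvalue_pos i).le) hr) _

theorem weight_mul_norm_whitenedFeature_sq_le (hm : IsWeightedModel pX qX β s e μ) {r : ℝ}
    (hr : 0 < r) (x : X) : β x * ‖whitenedFeature e μ r x‖ ^ 2 ≤ s / r := by
  calc β x * ‖whitenedFeature e μ r x‖ ^ 2 ≤ β x * ((√r)⁻¹ * ‖featureMap H x‖) ^ 2 := by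
        have := hm.weight_nonneg x
        have := hm.norm_whitenedFeature_le hr x
        gcongr
    _ = β x * ‖featureMap H x‖ ^ 2 / r := by
        rw [mul_pow, inv_pow, Real.sq_sqrt hr.le]
        ring
    _ ≤ s / r := by
        have := hm.weight_mul_le x
        gcongr

theorem hasSum_norm_whitenedFeature_sq (hm : IsWeightedModel pX qX β s e μ) {r : ℝ} (hr : 0 < r)
    (x : X) : HasSum (fun i => (μ i + r)⁻¹ * e i x ^ 2) (‖whitenedFeature e μ r x‖ ^ 2) := by
  refine (e.hasSum_norm_diag_sq
    ⟨_, bounded_inv_sqrt_add (fun i => (hm.eigenvalue_pos i).le) hr⟩ _).congr_fun fun i => ?_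
  have := hm.eigenvalue_pos i
  rw [real_inner_comm, inner_featureMap, inv_pow, Real.sq_sqrt (by positivity)]

/-- Expanding in the eigenbasis and integrating termwise with ∫ β eᵢ² dp_X = μᵢ gives the effective
dimension at level r. -/
theorem integral_weight_mul_norm_whitenedFeature_sq_le (hm : IsWeightedModel pX qX β s e μ)
    {r N : ℝ} (hr : 0 < r) (hN : ∀ n, ∑ i ∈ Finset.range n, μ i / (μ i + r) ≤ N) :
    ∫ x, β x * ‖whitenedFeature e μ r x‖ ^ 2 ∂pX ≤ N := by
  have hN0 : 0 ≤ N := by simpa using hN 0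
  have hterm : ∀ i x, 0 ≤ (μ i + r)⁻¹ * (β x * e i x ^ 2) := fun i x => by
    have := hm.eigenvalue_pos i
    have := hm.weight_nonneg x
    positivity
  have hmeas : ∀ i, Measurable fun x => (μ i + r)⁻¹ * (β x * e i x ^ 2) := fun i =>
    (hm.measurable_weight.mul
      ((measurable_apply_of_mem_rkhs hm.measurable_kernel (e i)).pow_const 2)).const_mul _
  rw [integral_eq_lintegral_of_nonneg_ae]
  · refine ENNReal.toReal_le_of_le_ofReal hN0 ?_
    have h1 : ∀ x, ENNReal.ofReal (β x * ‖whitenedFeature e μ r x‖ ^ 2) =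
        ∑' i, ENNReal.ofReal ((μ i + r)⁻¹ * (β x * e i x ^ 2)) := by
      intro x
      have h2 : HasSum (fun i => (μ i + r)⁻¹ * (β x * e i x ^ 2))
          (β x * ‖whitenedFeature e μ r x‖ ^ 2) :=
        ((hm.hasSum_norm_whitenedFeature_sq hr x).mul_left (β x)).congr_fun fun i => by ring
      rw [← ENNReal.ofReal_tsum_of_nonneg (hterm · x) h2.summable, h2.tsum_eq]
    simp only [h1]
    rw [lintegral_tsum fun i => (hmeas i).ennreal_ofReal.aemeasurable]
    have h3 : ∀ i, ∫⁻ x, ENNReal.ofReal ((μ i + r)⁻¹ * (β x * e i x ^ 2)) ∂pX =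
        ENNReal.ofReal (μ i / (μ i + r)) := by
      intro i
      rw [← ofReal_integral_eq_lintegral_ofReal
        ((hm.integrable_weight_mul_sq (e i)).const_mul _)
        (Filter.Eventually.of_forall (hterm i)), integral_const_mul, hm.integral_weight_mul_sq,
        div_eq_inv_mul]
    simp only [h3]
    refine ENNReal.tsum_le_of_sum_range_le fun n => ?_
    rw [← ENNReal.ofReal_sum_of_nonneg]
    · exact ENNReal.ofReal_le_ofReal (hN n)
    · intro i _
      have := hm.eigenvalue_pos i
      positivity
  · exact Filter.Eventually.of_forall fun x => mul_nonneg (hm.weight_nonneg x) (sq_nonneg _)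
  · exact (hm.measurable_weight.stronglyMeasurable.mul
      ((hm.stronglyMeasurable_whitenedFeature r).norm.pow 2)).aestronglyMeasurable

theorem integrable_weight_mul_norm_whitenedFeature_sq (hm : IsWeightedModel pX qX β s e μ)
    {r : ℝ} (hr : 0 < r) : Integrable (fun x => β x * ‖whitenedFeature e μ r x‖ ^ 2) pX := by
  refine Integrable.of_bound (C := s / r) (hm.measurable_weight.stronglyMeasurable.mul
      ((hm.stronglyMeasurable_whitenedFeature r).norm.pow 2)).aestronglyMeasurable
    (Filter.Eventually.of_forall fun x => ?_)
  rw [Real.norm_eq_abs, abs_of_nonneg (mul_nonneg (hm.weight_nonneg x) (sq_nonneg _))]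
  exact hm.weight_mul_norm_whitenedFeature_sq_le hr x

/-- Concentration of the empirical effective dimension. -/
theorem measure_empirical_effDim_gt_le (hm : IsWeightedModel pX qX β s e μ) (𝒦 : Kernel X Y)
    [IsMarkovKernel 𝒦] {r N L : ℝ} (hr : 0 < r)
    (hN : ∀ n, ∑ i ∈ Finset.range n, μ i / (μ i + r) ≤ N) (hL : 0 < L) {n : ℕ} (hn : 0 < n) :
    Measure.pi (fun _ : Fin n => pX ⊗ₘ 𝒦)
      {z | 2 * N + 5 * s * L / (n * r) <
        (n : ℝ)⁻¹ * ∑ i, β (z i).1 * ‖whitenedFeature e μ r (z i).1‖ ^ 2} ≤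
      ENNReal.ofReal (2 * Real.exp (-L)) := by
  have hN0 : 0 ≤ N := by simpa using hN 0
  have hs0 := hm.pos
  have hn' : (0 : ℝ) < n := by exact_mod_cast hn
  have hξ0 : ∀ x, 0 ≤ β x * ‖whitenedFeature e μ r x‖ ^ 2 := fun x =>
    mul_nonneg (hm.weight_nonneg x) (sq_nonneg _)
  have hξm : StronglyMeasurable fun x => β x * ‖whitenedFeature e μ r x‖ ^ 2 :=
    hm.measurable_weight.stronglyMeasurable.mul
      ((hm.stronglyMeasurable_whitenedFeature r).norm.pow 2)
  have hint := integral_compProd_fst pX 𝒦 hξm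
  have hle := hm.integral_weight_mul_norm_whitenedFeature_sq_le hr hN
  have h := measure_norm_sum_sub_integral_gt_le (pX ⊗ₘ 𝒦)
    (ζ := fun w => β w.1 * ‖whitenedFeature e μ r w.1‖ ^ 2) (c := s / r) (σ := √(s / r * N))
    (hξm.comp_measurable measurable_fst) (by positivity) (Real.sqrt_nonneg _) (fun w => ?_) ?_
    (n := n) hL
  · refine le_trans (measure_mono fun z hz => ?_) h
    rw [mem_ofPred_eq] at hz ⊢
    rw [hint, smul_eq_mul]
    refine lt_of_lt_of_le ?_ (le_abs_self _)
    -- AM–GM splits the variance term of Bernstein's inequality between the mean nN and the range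
    -- term sL/r.
    have h1 : 2 * √(s / r * N) * √(n * L) ≤ n * N + s / r * L := by
      rw [mul_assoc, ← Real.sqrt_mul (by positivity)]
      have : √(s / r * N * (n * L)) ≤ (n * N + s / r * L) / 2 := by
        refine Real.sqrt_le_iff.2 ⟨by positivity, ?_⟩
        nlinarith [sq_nonneg (n * N - s / r * L)]
      linarith
    rw [inv_mul_eq_div, lt_div_iff₀ hn'] at hz
    have h2 : (2 * N + 5 * s * L / (n * r)) * n = 2 * (n * N) + 5 * (s / r * L) := by
      field_simp
    have h3 : (n : ℝ) * ∫ x, β x * ‖whitenedFeature e μ r x‖ ^ 2 ∂pX ≤ n * N := by gcongr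
    linarith
  · rw [Real.norm_eq_abs, abs_of_nonneg (hξ0 _)]
    exact hm.weight_mul_norm_whitenedFeature_sq_le hr _
  · rw [Real.sq_sqrt (by positivity),
      integral_compProd_fst pX 𝒦 (f := fun x => ‖β x * ‖whitenedFeature e μ r x‖ ^ 2‖ ^ 2)
        (hξm.norm.pow 2)]
    have hint2 := (hm.integrable_weight_mul_norm_whitenedFeature_sq hr).const_mul (s / r)
    calc _ ≤ ∫ x, s / r * (β x * ‖whitenedFeature e μ r x‖ ^ 2) ∂pX := by
          refine integral_mono_of_nonneg (Filter.Eventually.of_forall fun x => sq_nonneg _) hint2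
            (Filter.Eventually.of_forall fun x => ?_)
          simp only [Real.norm_eq_abs, sq_abs]
          rw [pow_two]
          exact mul_le_mul_of_nonneg_right (hm.weight_mul_norm_whitenedFeature_sq_le hr x) (hξ0 x)
      _ ≤ _ := by
          rw [integral_const_mul]
          gcongr

/-- Concentration of `(C + r)^{-1/2} (Ĉ - C)`. -/
theorem measure_cov_deviation_le (hm : IsWeightedModel pX qX β s e μ) (𝒦 : Kernel X Y)
    [IsMarkovKernel 𝒦] {r N L : ℝ} (hr : 0 < r)
    (hN : ∀ n, ∑ i ∈ Finset.range n, μ i / (μ i + r) ≤ N) (hL : 0 < L) {n : ℕ} (hn : 0 < n) :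
    Measure.pi (fun _ : Fin n => pX ⊗ₘ 𝒦)
      {z | ¬ ∀ h, ‖e.diag (fun i => (√(μ i + r))⁻¹)
          (empiricalCov H β (fun i => (z i).1) h - e.diag μ h)‖ ≤
        (4 * (s / √r) * L + 2 * √(s * N) * √(n * L)) / n * ‖h‖} ≤
      ENNReal.ofReal (2 * Real.exp (-L)) := by
  have hN0 : 0 ≤ N := by simpa using hN 0
  have hs0 := hm.pos
  have hn' : (0 : ℝ) < n := by exact_mod_cast hn
  have hμ0 : ∀ i, 0 ≤ μ i := fun i => (hm.eigenvalue_pos i).le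
  have hAb : ∃ C, ∀ i, |(√(μ i + r))⁻¹| ≤ C := ⟨_, bounded_inv_sqrt_add hμ0 hr⟩
  -- The summand β(x) (C + r)^(-1/2) k(x, ·) ⊗ k(x, ·), viewed as an element of a Hilbert space.
  set ζ : X → lp (fun _ : ℕ × ℕ => ℝ) 2 := fun x =>
    β x • hsTensor e (whitenedFeature e μ r x) (featureMap H x) with hζ
  have hζm : StronglyMeasurable ζ := by
    refine hm.measurable_weight.stronglyMeasurable.smul ?_
    have hc : Continuous fun p : H × H => hsTensor e p.1 p.2 := by fun_prop
    exact hc.comp_stronglyMeasurable ((hm.stronglyMeasurable_whitenedFeature r).prodMk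
      (stronglyMeasurable_featureMap hm.measurable_kernel e))
  have hζn : ∀ x, ‖ζ x‖ = β x * (‖whitenedFeature e μ r x‖ * ‖featureMap H x‖) := fun x => by
    rw [hζ, norm_smul, Real.norm_eq_abs, abs_of_nonneg (hm.weight_nonneg x), norm_hsTensor]
  have hζc : ∀ x, ‖ζ x‖ ≤ s / √r := by
    intro x
    have h0 := hm.weight_nonneg x
    have h1 := hm.norm_whitenedFeature_le hr x
    have h2 := hm.weight_mul_le x
    rw [hζn]
    calc _ ≤ β x * (((√r)⁻¹ * ‖featureMap H x‖) * ‖featureMap H x‖) := by gcongr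
      _ = β x * ‖featureMap H x‖ ^ 2 / √r := by ring
      _ ≤ s / √r := by gcongr
  have hζi : Integrable ζ pX :=
    Integrable.of_bound hζm.aestronglyMeasurable _ (Filter.Eventually.of_forall hζc)
  have hint := integral_compProd_fst pX 𝒦 hζm
  have h := measure_norm_sum_sub_integral_gt_le (pX ⊗ₘ 𝒦)
    (ζ := fun w => ζ w.1) (c := s / √r) (σ := √(s * N))
    (hζm.comp_measurable measurable_fst) (by positivity) (Real.sqrt_nonneg _) (fun w => hζc _) ?_
    (n := n) hL
  · refine le_trans (measure_mono fun z hz => ?_) h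
    rw [mem_ofPred_eq] at hz ⊢
    rw [hint]
    by_contra hcon
    refine hz fun h => ?_
    set A := e.diag fun i => (√(μ i + r))⁻¹ with hA
    set d := empiricalCov H β (fun i => (z i).1) h - e.diag μ h with hd
    -- Pairing the centred sum with x ⊗ h gives the bilinear form of A(Ĉ - C). Taking x = A d and
    -- using ‖x ⊗ h‖ = ‖x‖‖h‖ then bounds ‖A d‖.
    have key : ∀ x : H, inner ℝ x (A d) = (n : ℝ)⁻¹ * inner ℝ (hsTensor e x h)
        (∑ i, ζ (z i).1 - (n : ℝ) • ∫ x, ζ x ∂pX) := by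
      intro x
      have hk : ∀ y : X, inner ℝ (hsTensor e x h) (ζ y) = β y * (A x y * h y) := by
        intro y
        rw [hζ, inner_smul_right, inner_hsTensor, real_inner_comm, whitenedFeature,
          real_inner_comm (featureMap H y) h, inner_featureMap, ← hA, hA, e.inner_diag_comm hAb,
          inner_featureMap]
      rw [← e.inner_diag_comm hAb, ← hA, hd, inner_sub_right, inner_empiricalCov,
        ← hm.covarianceOp_eq_diag, hm.inner_covarianceOp, inner_sub_right, inner_sum,
        inner_smul_right, ← integral_inner hζi]
      simp only [hk]
      rw [mul_sub, inv_mul_cancel_left₀ hn'.ne']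
      simp only [mul_comm (h _)]
    have h1 : ‖A d‖ ^ 2 ≤ ‖A d‖ * ((n : ℝ)⁻¹ * (4 * (s / √r) * L + 2 * √(s * N) * √(n * L)) *
        ‖h‖) := by
      rw [← real_inner_self_eq_norm_sq, key]
      calc _ ≤ (n : ℝ)⁻¹ * (‖A d‖ * ‖h‖ * (4 * (s / √r) * L + 2 * √(s * N) * √(n * L))) := by
            refine mul_le_mul_of_nonneg_left ?_ (by positivity)
            refine (real_inner_le_norm _ _).trans ?_
            rw [norm_hsTensor]
            exact mul_le_mul_of_nonneg_left (not_lt.1 hcon) (by positivity)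
        _ = _ := by ring
    rw [div_eq_inv_mul]
    rcases (norm_nonneg (A d)).eq_or_lt with h0 | h0
    · rw [← h0]; positivity
    · nlinarith
  · rw [Real.sq_sqrt (by positivity),
      integral_compProd_fst pX 𝒦 (f := fun x => ‖ζ x‖ ^ 2) (hζm.norm.pow 2)]
    -- One factor β‖k(x, ·)‖² ≤ s is taken out of ‖ζ‖²; the other integrates to at most N.
    have hint2 := (hm.integrable_weight_mul_norm_whitenedFeature_sq hr).const_mul s
    calc _ ≤ ∫ x, s * (β x * ‖whitenedFeature e μ r x‖ ^ 2) ∂pX := by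
          refine integral_mono_of_nonneg (Filter.Eventually.of_forall fun x => sq_nonneg _) hint2
            (Filter.Eventually.of_forall fun x => ?_)
          simp only [hζn]
          calc (β x * (‖whitenedFeature e μ r x‖ * ‖featureMap H x‖)) ^ 2 =
              (β x * ‖featureMap H x‖ ^ 2) * (β x * ‖whitenedFeature e μ r x‖ ^ 2) := by ring
            _ ≤ _ := mul_le_mul_of_nonneg_right (hm.weight_mul_le x)
              (mul_nonneg (hm.weight_nonneg x) (sq_nonneg _))
      _ ≤ _ := by
          rw [integral_const_mul]
          have := hm.integral_weight_mul_norm_whitenedFeature_sq_le hr hN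
          gcongr

end IsWeightedModel

end CovarianceDeviation

/-! ### The noise as a quadratic form and its conditional exponential moment. -/

section Noise

variable {X Y H G : Type*}
  [NormedAddCommGroup Y] [InnerProductSpace ℝ Y] [CompleteSpace Y]
  [NormedAddCommGroup H] [InnerProductSpace ℝ H] [CompleteSpace H] [RKHS ℝ H X ℝ]
  [NormedAddCommGroup G] [InnerProductSpace ℝ G] [CompleteSpace G] [RKHS ℝ G X Y]
  {β : X → ℝ} {lam : ℝ} {n : ℕ}

/-- The regularized inverse `(Ĉ + lam)⁻¹`. -/
def empiricalResolvent (H : Type*) [NormedAddCommGroup H] [InnerProductSpace ℝ H] [CompleteSpace H]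
    [RKHS ℝ H X ℝ] (β : X → ℝ) (lam : ℝ) (x : Fin n → X) : H →L[ℝ] H :=
  Ring.inverse (empiricalCov H β x + lam • (1 : H →L[ℝ] H))

/-- The empirical effective dimension `(1/n) ∑ᵢ β(xᵢ) ⟪k(xᵢ), (Ĉ + lam)⁻¹ k(xᵢ)⟫`. -/
def empiricalEffDim (H : Type*) [NormedAddCommGroup H] [InnerProductSpace ℝ H] [CompleteSpace H]
    [RKHS ℝ H X ℝ] (β : X → ℝ) (lam : ℝ) (x : Fin n → X) : ℝ :=
  ∑ i, β (x i) / n *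
    inner ℝ (featureMap H (x i)) (empiricalResolvent H β lam x (featureMap H (x i)))

/-- The squared norm of `(Ĉ + lam)^{-1/2}` applied to the noise
`(1/n) ∑ᵢ β(xᵢ) k(xᵢ) ⊗ (yᵢ - f(xᵢ))`. -/
def noiseForm (H : Type*) [NormedAddCommGroup H] [InnerProductSpace ℝ H] [CompleteSpace H]
    [RKHS ℝ H X ℝ] (β : X → ℝ) (f : X → Y) (lam : ℝ) (z : Fin n → X × Y) : ℝ :=
  ∑ i, ∑ k, β (z i).1 / n * (β (z k).1 / n) *
    (inner ℝ (featureMap H (z i).1)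
      (empiricalResolvent H β lam (fun i => (z i).1) (featureMap H (z k).1)) *
      inner ℝ ((z i).2 - f (z i).1) ((z k).2 - f (z k).1))

section Resolvent

variable {ι : Type*} {b : HilbertBasis ι ℝ H} {t : ι → ℝ} {x : Fin n → X}

/-- The resolvent is defined by `Ring.inverse`, without choosing an eigenbasis, so that it can be
shown measurable in the sample. Here it is identified with the diagonal one. -/
theorem isUnit_and_inverse_empiricalCov_add (hC : empiricalCov H β x = b.diag t)
    (htb : ∃ C, ∀ i, |t i| ≤ C) (ht : ∀ i, 0 ≤ t i) (hl : 0 < lam) :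
    IsUnit (empiricalCov H β x + lam • (1 : H →L[ℝ] H)) ∧
      empiricalResolvent H β lam x = b.diag fun i => (t i + lam)⁻¹ := by
  have hib : ∃ C, ∀ i, |(t i + lam)⁻¹| ≤ C := ⟨_, bounded_inv_add ht hl⟩
  let u : (H →L[ℝ] H)ˣ :=
    { val := empiricalCov H β x + lam • (1 : H →L[ℝ] H)
      inv := b.diag fun i => (t i + lam)⁻¹
      val_inv := by
        refine ContinuousLinearMap.ext fun h => b.ext_inner fun i => ?_
        have := ht i
        have h0 : t i + lam ≠ 0 := by positivity
        simp only [hC, mul_apply_eq_comp, add_apply,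
          smul_apply, one_apply_eq_self, inner_add_right,
          inner_smul_right, b.inner_diag htb, b.inner_diag hib]
        field_simp
      inv_val := by
        refine ContinuousLinearMap.ext fun h => b.ext_inner fun i => ?_
        have := ht i
        have h0 : t i + lam ≠ 0 := by positivity
        simp only [hC, mul_apply_eq_comp, add_apply,
          smul_apply, one_apply_eq_self, inner_add_right,
          inner_smul_right, b.inner_diag htb, b.inner_diag hib]
        field_simp }
  exact ⟨u.isUnit, Ring.inverse_unit u⟩

/-- Parseval in `Y` for each pair of sample points: the possibly infinite sum over components
collapses to a finite double sum that does not involve the basis. -/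
theorem hasSum_inner_resolvent_noise {κ : Type*} (c : HilbertBasis κ ℝ Y) (f : X → Y)
    (z : Fin n → X × Y) :
    HasSum (fun j => inner ℝ
      ((n : ℝ)⁻¹ • ∑ i, (β (z i).1 * inner ℝ (c j) ((z i).2 - f (z i).1)) • featureMap H (z i).1)
      (empiricalResolvent H β lam (fun i => (z i).1) ((n : ℝ)⁻¹ •
        ∑ i, (β (z i).1 * inner ℝ (c j) ((z i).2 - f (z i).1)) • featureMap H (z i).1)))
      (noiseForm H β f lam z) := by
  have h : ∀ i k : Fin n, HasSum (fun j => β (z i).1 / n * (β (z k).1 / n) *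
      (inner ℝ (featureMap H (z i).1)
        (empiricalResolvent H β lam (fun i => (z i).1) (featureMap H (z k).1)) *
        (inner ℝ ((z i).2 - f (z i).1) (c j) * inner ℝ (c j) ((z k).2 - f (z k).1))))
      (β (z i).1 / n * (β (z k).1 / n) * (inner ℝ (featureMap H (z i).1)
        (empiricalResolvent H β lam (fun i => (z i).1) (featureMap H (z k).1)) *
        inner ℝ ((z i).2 - f (z i).1) ((z k).2 - f (z k).1))) := fun i k =>
    ((c.hasSum_inner_mul_inner _ _).mul_left _).mul_left _
  refine (hasSum_sum fun i _ => hasSum_sum fun k _ => h i k).congr_fun fun j => ?_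
  simp only [map_smul, map_sum, inner_smul_left, inner_smul_right, sum_inner, inner_sum,
    conj_trivial, Finset.mul_sum]
  rw [Finset.sum_comm]
  refine Finset.sum_congr rfl fun i _ => Finset.sum_congr rfl fun k _ => ?_
  rw [real_inner_comm ((z i).2 - f (z i).1)]
  ring

end Resolvent

section Conditional

variable (hG : IsScalarKernelExtension H G)

theorem norm_rkhsTensor_le (h : H) : ‖rkhsTensor hG h‖ ≤ ‖h‖ :=
  ContinuousLinearMap.opNorm_le_bound _ (norm_nonneg _) fun y => (norm_rkhsTensor hG h y).le

theorem hasSum_norm_adjoint_rkhsTensor_sq {κ : Type*} (c : HilbertBasis κ ℝ Y) (h : H) (u : G) :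
    HasSum (fun j => inner ℝ h (rkhsComp hG (c j) u) ^ 2)
      (‖ContinuousLinearMap.adjoint (rkhsTensor hG h) u‖ ^ 2) := by
  refine (c.hasSum_inner_sq _).congr_fun fun j => ?_
  rw [ContinuousLinearMap.adjoint_inner_right, inner_rkhsComp]

variable {ι : Type*} {b : HilbertBasis ι ℝ H} {t : ι → ℝ} {x : Fin n → X}

/-- The noise is ‖∑ Wᵢ dᵢ‖² with Wᵢ = √(βᵢ/n) (Ĉ + λ)^(-1/2) k(xᵢ, ·) ⊗ (·) and dᵢ = √(βᵢ/n) (yᵢ -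
f(xᵢ)). On each component ∑ Wᵢ Wᵢ* is Ĉ(Ĉ + λ)⁻¹ ≤ 1, and ∑ ‖Wᵢ‖² is at most the empirical effective
dimension. The conditions on the outputs are needed only where β ≠ 0, since elsewhere both Wᵢ and dᵢ
vanish. -/
theorem lintegral_exp_noise_le (hG : IsScalarKernelExtension H G) [MeasurableSpace Y]
    [BorelSpace Y] [SecondCountableTopology Y]
    (hβ0 : ∀ x, 0 ≤ β x) {B : ℝ} (hβB : ∀ x, β x ≤ B) (hn : 0 < n)
    (hC : empiricalCov H β x = b.diag t) (htb : ∃ C, ∀ i, |t i| ≤ C) (ht : ∀ i, 0 ≤ t i)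
    (hl : 0 < lam) (P : Fin n → Measure Y) [∀ i, IsProbabilityMeasure (P i)] (f : X → Y) {M : ℝ}
    (hM0 : 0 < M) (hB : 0 < B)
    (hM : ∀ i, β (x i) ≠ 0 → ∀ᵐ y ∂P i, ‖y‖ ≤ M)
    (hf : ∀ i, β (x i) ≠ 0 → f (x i) = ∫ y, y ∂P i) :
    ∫⁻ y, ENNReal.ofReal (Real.exp ((16 * B * M ^ 2 / n)⁻¹ *
        noiseForm H β f lam (fun i => (x i, y i)) - empiricalEffDim H β lam x / 2))
      ∂Measure.pi P ≤ 1 := by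
  obtain ⟨-, hR⟩ := isUnit_and_inverse_empiricalCov_add hC htb ht hl
  have hn' : (0 : ℝ) < n := by exact_mod_cast hn
  set S := b.diag fun i => (√(t i + lam))⁻¹ with hS
  have hSb : ∃ C, ∀ i, |(√(t i + lam))⁻¹| ≤ C := ⟨_, bounded_inv_sqrt_add ht hl⟩
  have hib : ∃ C, ∀ i, |(t i + lam)⁻¹| ≤ C := ⟨_, bounded_inv_add ht hl⟩
  have hSR : ∀ u v : H, inner ℝ (S u) (S v) = inner ℝ u (empiricalResolvent H β lam x v) := by
    intro u v
    rw [hS, b.inner_diag_comm hSb, hR]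
    congr 1
    rw [b.diag_comp hSb hSb]
    congr 2
    ext i
    rw [← mul_inv, Real.mul_self_sqrt (by linarith [ht i])]
  have hw0 : ∀ i, 0 ≤ β (x i) / n := fun i => div_nonneg (hβ0 _) hn'.le
  obtain ⟨w, c, -⟩ := exists_hilbertBasis ℝ Y
  set W : Fin n → Y →L[ℝ] G := fun i =>
    √(β (x i) / n) • rkhsTensor hG (S (featureMap H (x i))) with hW
  set d : Fin n → Y → Y := fun i y => √(β (x i) / n) • (y - f (x i)) with hd
  set cst : ℝ := 2 * M * √(B / n) with hcst
  have hcst2 : cst ^ 2 = 4 * B * M ^ 2 / n := by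
    rw [hcst, mul_pow, Real.sq_sqrt (by positivity)]
    ring
  have hcst0 : 0 < cst ^ 2 := by rw [hcst2]; positivity
  have hfM : ∀ i, β (x i) ≠ 0 → ‖f (x i)‖ ≤ M := by
    intro i hi
    rw [hf i hi]
    simpa using norm_integral_le_of_norm_le_const (hM i hi)
  have hdc : ∀ i, ∀ᵐ y ∂P i, ‖d i y‖ ≤ cst := by
    intro i
    by_cases hi : β (x i) = 0
    · refine Filter.Eventually.of_forall fun y => ?_
      simp only [hd, hi, zero_div, Real.sqrt_zero, zero_smul, norm_zero]
      positivity
    · filter_upwards [hM i hi] with y hy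
      rw [hd, norm_smul, Real.norm_eq_abs, abs_of_nonneg (Real.sqrt_nonneg _), hcst, mul_comm]
      have h1 : ‖y - f (x i)‖ ≤ 2 * M := by linarith [norm_sub_le y (f (x i)), hfM i hi]
      have h2 : √(β (x i) / n) ≤ √(B / n) := by
        have := hβB (x i)
        gcongr
      gcongr
  have hd0 : ∀ i, ∫ y, d i y ∂P i = 0 := by
    intro i
    by_cases hi : β (x i) = 0
    · simp [hd, hi]
    · have hint : Integrable (fun y : Y => y) (P i) :=
        Integrable.of_bound aestronglyMeasurable_id M (hM i hi)
      simp only [hd]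
      rw [integral_smul, integral_sub hint (integrable_const _), ← hf i hi]
      simp
  have hWadj : ∀ i u, ‖ContinuousLinearMap.adjoint (W i) u‖ ^ 2 = β (x i) / n *
      ‖ContinuousLinearMap.adjoint (rkhsTensor hG (S (featureMap H (x i)))) u‖ ^ 2 := by
    intro i u
    have h1 : ContinuousLinearMap.adjoint (W i) u = √(β (x i) / n) •
        ContinuousLinearMap.adjoint (rkhsTensor hG (S (featureMap H (x i)))) u := by
      rw [hW, map_smulₛₗ, conj_trivial, smul_apply]
    rw [h1, norm_smul, mul_pow, Real.norm_eq_abs, sq_abs, Real.sq_sqrt (hw0 i)]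
  have hWle : ∀ u, ∑ i, ‖ContinuousLinearMap.adjoint (W i) u‖ ^ 2 ≤ ‖u‖ ^ 2 := by
    intro u
    simp only [hWadj]
    have h1 := hasSum_sum fun i (_ : i ∈ (Finset.univ : Finset (Fin n))) =>
      (hasSum_norm_adjoint_rkhsTensor_sq hG c (S (featureMap H (x i))) u).mul_left (β (x i) / n)
    refine hasSum_le (fun j => ?_) h1 (hasSum_norm_rkhsComp_sq hG c u)
    set h := rkhsComp hG (c j) u
    have h2 : ∀ i, inner ℝ (S (featureMap H (x i))) h = S h (x i) := fun i => by
      rw [hS, b.inner_diag_comm hSb, inner_featureMap]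
    have h3 : ∑ i, β (x i) / n * inner ℝ (S (featureMap H (x i))) h ^ 2 =
        inner ℝ (S h) (b.diag t (S h)) := by
      rw [← hC, inner_empiricalCov, Finset.mul_sum]
      refine Finset.sum_congr rfl fun i _ => ?_
      rw [h2]
      ring
    rw [h3]
    refine hasSum_le (fun i => ?_) (b.hasSum_inner_diag htb (S h) (S h)) (b.hasSum_inner_sq h)
    rw [hS, b.inner_diag hSb]
    have h4 := ht i
    have h5 : t i * ((√(t i + lam))⁻¹ * (√(t i + lam))⁻¹) ≤ 1 := by
      rw [← mul_inv, Real.mul_self_sqrt (by positivity), ← div_eq_mul_inv,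
        div_le_one (by positivity)]
      linarith
    calc _ = t i * ((√(t i + lam))⁻¹ * (√(t i + lam))⁻¹) * inner ℝ (b i) h ^ 2 := by ring
      _ ≤ 1 * inner ℝ (b i) h ^ 2 := mul_le_mul_of_nonneg_right h5 (sq_nonneg _)
      _ = _ := one_mul _
  have hWn : ∑ i, ‖W i‖ ^ 2 ≤ empiricalEffDim H β lam x := by
    refine Finset.sum_le_sum fun i _ => ?_
    have h1 := norm_rkhsTensor_le hG (S (featureMap H (x i)))
    have h2 := hw0 i
    rw [hW, norm_smul, mul_pow, Real.norm_eq_abs, sq_abs, Real.sq_sqrt (hw0 i), ← hSR,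
      real_inner_self_eq_norm_sq]
    gcongr
  -- The largest admissible value, 4θ cst² = 1. The Gram parameter 2θ cst² is then 1/2, which is
  -- also the coefficient of the trace.
  set θ : ℝ := (16 * B * M ^ 2 / n)⁻¹ with hθ
  have hθ0 : 0 ≤ θ := by positivity
  have hθc : 4 * θ * cst ^ 2 = 1 := by
    rw [hθ, hcst2]
    field_simp
    norm_num
  obtain ⟨R, hR'⟩ := exists_isGramResolvent hWle (τ := 2 * θ * cst ^ 2) (by positivity)
    (by linarith)
  have hmain := lintegral_exp_norm_sq_le hθ0 hθc.le n P d (fun i => by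
      have : Measurable (d i) := by fun_prop
      exact this.stronglyMeasurable) hdc hd0 W hWle R hR' 0
  have hV : ∀ y : Fin n → Y, ‖(0 : G) + ∑ i, W i (d i (y i))‖ ^ 2 =
      noiseForm H β f lam (fun i => (x i, y i)) := by
    intro y
    rw [zero_add, ← real_inner_self_eq_norm_sq, sum_inner]
    refine Finset.sum_congr rfl fun i _ => ?_
    rw [inner_sum]
    refine Finset.sum_congr rfl fun k _ => ?_
    simp only [hW, hd, smul_apply, map_smul, inner_smul_left,
      inner_smul_right, inner_rkhsTensor, hSR, conj_trivial]
    linear_combination (√(β (x i) / n) * √(β (x i) / n)) *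
      (inner ℝ (featureMap H (x i)) (empiricalResolvent H β lam x (featureMap H (x k))) *
        inner ℝ (y i - f (x i)) (y k - f (x k))) * Real.mul_self_sqrt (hw0 k) + (β (x k) / n) *
      (inner ℝ (featureMap H (x i)) (empiricalResolvent H β lam x (featureMap H (x k))) *
        inner ℝ (y i - f (x i)) (y k - f (x k))) * Real.mul_self_sqrt (hw0 i)
  simp only [hV] at hmain
  have h3 : ∀ y : Fin n → Y, ENNReal.ofReal (Real.exp (θ *
      noiseForm H β f lam (fun i => (x i, y i)) - empiricalEffDim H β lam x / 2)) =
      ENNReal.ofReal (Real.exp (-(empiricalEffDim H β lam x / 2))) *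
      ENNReal.ofReal (Real.exp (θ * noiseForm H β f lam (fun i => (x i, y i)))) := by
    intro y
    rw [← ENNReal.ofReal_mul (Real.exp_nonneg _), ← Real.exp_add]
    congr 2
    ring
  simp only [h3]
  rw [lintegral_const_mul' _ _ ENNReal.ofReal_ne_top]
  calc _ ≤ ENNReal.ofReal (Real.exp (-(empiricalEffDim H β lam x / 2))) *
        ENNReal.ofReal (Real.exp (empiricalEffDim H β lam x / 2)) := by
        refine mul_le_mul_right (hmain.trans (ENNReal.ofReal_le_ofReal (Real.exp_le_exp.2 ?_))) _
        have h4 : 2 * θ * cst ^ 2 = 1 / 2 := by linarith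
        rw [h4, inner_zero_left]
        linarith
    _ = 1 := by
        rw [← ENNReal.ofReal_mul (Real.exp_nonneg _), ← Real.exp_add]
        simp

end Conditional

end Noise

/-! ### Measurability of the noise and its concentration. -/

namespace IsWeightedModel

variable {X Y H G : Type*} [MeasurableSpace X]
  [NormedAddCommGroup Y] [InnerProductSpace ℝ Y] [CompleteSpace Y]
  [NormedAddCommGroup H] [InnerProductSpace ℝ H] [CompleteSpace H] [RKHS ℝ H X ℝ]
  [NormedAddCommGroup G] [InnerProductSpace ℝ G] [CompleteSpace G] [RKHS ℝ G X Y]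
  {pX qX : Measure X} {β : X → ℝ} {s : ℝ} {e : HilbertBasis ℕ ℝ H} {μ : ℕ → ℝ}
  {n : ℕ} {lam B : ℝ}

theorem exists_eigenbasis (hm : IsWeightedModel pX qX β s e μ) (hβB : ∀ x, β x ≤ B) (hn : 0 < n)
    (x : Fin n → X) :
    ∃ (w : Set H) (b : HilbertBasis w ℝ H) (t : w → ℝ),
      (∀ i, empiricalCov H β x (b i) = t i • b i) ∧ (∀ i, 0 ≤ t i) ∧ (∃ C, ∀ i, |t i| ≤ C) ∧
      empiricalCov H β x = b.diag t := by
  obtain ⟨κ, hκ⟩ := hm.bounded_kernel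
  obtain ⟨w, b, t, h1, h2, -⟩ := exists_eigenbasis_empiricalCov hm.weight_nonneg hβB hκ hn x
  have h3 := b.eq_diag (b.isSymmetric_of_eigen h1) h1
  exact ⟨w, b, t, h1, fun i => (h2 i).1, h3.1, h3.2⟩

theorem stronglyMeasurable_empiricalResolvent (hm : IsWeightedModel pX qX β s e μ)
    (hβB : ∀ x, β x ≤ B) (hn : 0 < n) (hl : 0 < lam) :
    StronglyMeasurable fun x : Fin n → X => empiricalResolvent H β lam x := by
  have hk := stronglyMeasurable_featureMap hm.measurable_kernel e
  have hcov : StronglyMeasurable fun x : Fin n → X => empiricalCov H β x := by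
    suffices h : ∀ i : Fin n, StronglyMeasurable fun x : Fin n → X => β (x i) •
        InnerProductSpace.rankOne ℝ (featureMap H (x i)) (featureMap H (x i)) from
      (Finset.stronglyMeasurable_fun_sum Finset.univ fun i _ => h i).const_smul (n : ℝ)⁻¹
    intro i
    refine (hm.measurable_weight.comp (measurable_pi_apply i)).stronglyMeasurable.smul ?_
    have hc : Continuous fun u : H => InnerProductSpace.rankOne ℝ u u :=
      (InnerProductSpace.rankOne ℝ (E := H) (F := H)).continuous.clm_apply continuous_id
    exact hc.comp_stronglyMeasurable (hk.comp_measurable (measurable_pi_apply i))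
  have hadd : StronglyMeasurable fun x : Fin n → X =>
      empiricalCov H β x + lam • (1 : H →L[ℝ] H) := hcov.add stronglyMeasurable_const
  refine StronglyMeasurable.comp_of_continuousAt (Φ := Ring.inverse) hadd fun x => ?_
  obtain ⟨w, b, t, -, ht, htb, hC⟩ := hm.exists_eigenbasis hβB hn x
  obtain ⟨u, hu⟩ := (isUnit_and_inverse_empiricalCov_add hC htb ht hl).1
  rw [← hu]
  exact NormedRing.inverse_continuousAt u

theorem measurable_inner_resolvent (hm : IsWeightedModel pX qX β s e μ)
    (hβB : ∀ x, β x ≤ B) (hn : 0 < n) (hl : 0 < lam) (i k : Fin n) :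
    Measurable fun x : Fin n → X =>
      inner ℝ (featureMap H (x i)) (empiricalResolvent H β lam x (featureMap H (x k))) := by
  have hk := stronglyMeasurable_featureMap hm.measurable_kernel e
  have hR := hm.stronglyMeasurable_empiricalResolvent hβB hn hl
  have hc : Continuous fun p : (H →L[ℝ] H) × H => p.1 p.2 := by fun_prop
  exact ((hk.comp_measurable (measurable_pi_apply i)).inner (hc.comp_stronglyMeasurable
    (hR.prodMk (hk.comp_measurable (measurable_pi_apply k))))).measurable

theorem measurable_empiricalEffDim (hm : IsWeightedModel pX qX β s e μ)
    (hβB : ∀ x, β x ≤ B) (hn : 0 < n) (hl : 0 < lam) :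
    Measurable fun x : Fin n → X => empiricalEffDim H β lam x :=
  Finset.measurable_fun_sum _ fun i _ =>
    ((hm.measurable_weight.comp (measurable_pi_apply i)).div_const _).mul
      (hm.measurable_inner_resolvent hβB hn hl i i)

variable [MeasurableSpace Y] [BorelSpace Y] [SecondCountableTopology Y]

theorem measurable_noiseForm (hm : IsWeightedModel pX qX β s e μ)
    (hβB : ∀ x, β x ≤ B) (hn : 0 < n) (hl : 0 < lam) {f : X → Y} (hf : Measurable f) :
    Measurable fun z : Fin n → X × Y => noiseForm H β f lam z := by
  have hx : Measurable fun (z : Fin n → X × Y) (i : Fin n) => (z i).1 := by fun_prop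
  have hw : ∀ i : Fin n, Measurable fun z : Fin n → X × Y => β (z i).1 / n := fun i =>
    (hm.measurable_weight.comp (by fun_prop)).div_const _
  have hε : ∀ i : Fin n, Measurable fun z : Fin n → X × Y => (z i).2 - f (z i).1 := fun i => by
    fun_prop
  refine Finset.measurable_fun_sum _ fun i _ => Finset.measurable_fun_sum _ fun k _ => ?_
  exact ((hw i).mul (hw k)).mul
    (((hm.measurable_inner_resolvent hβB hn hl i k).comp hx).mul ((hε i).inner (hε k)))

/-- Concentration of the noise, conditionally on the inputs. -/
theorem measure_noiseForm_gt_le (hm : IsWeightedModel pX qX β s e μ) [IsProbabilityMeasure pX]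
    (hG : IsScalarKernelExtension H G) (𝒦 : Kernel X Y) [IsMarkovKernel 𝒦] (hβB : ∀ x, β x ≤ B)
    (hB : 0 < B) (hn : 0 < n) (hl : 0 < lam) {f : X → Y} (hf : Measurable f)
    (hfreg : ∀ᵐ x ∂qX, f x = regressionFunction 𝒦 x) {M : ℝ} (hM0 : 0 < M)
    (hM : ∀ᵐ w ∂(pX ⊗ₘ 𝒦), ‖w.2‖ ≤ M) (L : ℝ) :
    Measure.pi (fun _ : Fin n => pX ⊗ₘ 𝒦)
      {z | 4 * B * M ^ 2 / n * (2 * empiricalEffDim H β lam (fun i => (z i).1) + 4 * L) <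
        noiseForm H β f lam z} ≤ ENNReal.ofReal (Real.exp (-L)) := by
  have hn' : (0 : ℝ) < n := by exact_mod_cast hn
  set F : (Fin n → X × Y) → ℝ≥0∞ := fun z => ENNReal.ofReal (Real.exp ((16 * B * M ^ 2 / n)⁻¹ *
    noiseForm H β f lam z - empiricalEffDim H β lam (fun i => (z i).1) / 2)) with hF
  have hx : Measurable fun (z : Fin n → X × Y) (i : Fin n) => (z i).1 := by fun_prop
  have hFm : Measurable F := by
    have h1 := hm.measurable_noiseForm (Y := Y) hβB hn hl hf
    have h2 := (hm.measurable_empiricalEffDim hβB hn hl).comp hx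
    exact (((h1.const_mul _).sub (h2.div_const 2)).exp).ennreal_ofReal
  have hF1 : ∫⁻ z, F z ∂Measure.pi (fun _ : Fin n => pX ⊗ₘ 𝒦) ≤ 1 := by
    rw [lintegral_pi_compProd pX 𝒦 hFm]
    have hM2 := ae_pi_of_ae (n := n) pX (Measure.ae_ae_of_ae_compProd hM)
    -- A property holding q_X-almost everywhere transfers to p_X only on {β ≠ 0}, which is all that
    -- the weighted noise sees.
    have hf2 : ∀ᵐ x ∂pX, β x ≠ 0 → f x = regressionFunction 𝒦 x := by
      rw [hm.density, ae_withDensity_iff hm.measurable_weight.ennreal_ofReal] at hfreg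
      filter_upwards [hfreg] with x hx hβ
      refine hx ?_
      rw [Ne, ENNReal.ofReal_eq_zero, not_le]
      exact lt_of_le_of_ne (hm.weight_nonneg x) (Ne.symm hβ)
    have hf3 := ae_pi_of_ae (n := n) pX hf2
    calc _ ≤ ∫⁻ x, 1 ∂Measure.pi (fun _ : Fin n => pX) := by
          refine lintegral_mono_ae ?_
          filter_upwards [hM2, hf3] with x hx1 hx2
          obtain ⟨w, b, t, -, ht, htb, hC⟩ := hm.exists_eigenbasis hβB hn x
          exact lintegral_exp_noise_le hG hm.weight_nonneg hβB hn hC htb ht hl (fun i => 𝒦 (x i)) f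
            hM0 hB (fun i _ => hx1 i) hx2
      _ = 1 := by simp
  have hsub : {z | 4 * B * M ^ 2 / n * (2 * empiricalEffDim H β lam (fun i => (z i).1) + 4 * L) <
      noiseForm H β f lam z} ⊆ {z | ENNReal.ofReal (Real.exp L) ≤ F z} := by
    intro z hz
    refine ENNReal.ofReal_le_ofReal (Real.exp_le_exp.2 ?_)
    rw [mem_ofPred_eq] at hz
    have h1 : (16 * B * M ^ 2 / n)⁻¹ * (4 * B * M ^ 2 / n *
        (2 * empiricalEffDim H β lam (fun i => (z i).1) + 4 * L)) =
        empiricalEffDim H β lam (fun i => (z i).1) / 2 + L := by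
      field_simp
      ring
    have h2 := mul_le_mul_of_nonneg_left hz.le
      (show 0 ≤ (16 * B * M ^ 2 / n)⁻¹ by positivity)
    linarith
  calc _ ≤ _ := measure_mono hsub
    _ ≤ (∫⁻ z, F z ∂Measure.pi (fun _ : Fin n => pX ⊗ₘ 𝒦)) / ENNReal.ofReal (Real.exp L) :=
        meas_ge_le_lintegral_div hFm.aemeasurable (by simp [Real.exp_pos]) ENNReal.ofReal_ne_top
    _ ≤ 1 / ENNReal.ofReal (Real.exp L) := by gcongr
    _ = ENNReal.ofReal (Real.exp (-L)) := by
        rw [Real.exp_neg, ENNReal.ofReal_inv_of_pos (Real.exp_pos L), one_div]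

end IsWeightedModel

/-! ### Consequences of the parameter choice. -/

section NumericBounds

variable {n lam φl L a : ℝ}

/-- Consequences of the choice `1 / n = lam^{1 + 1/a} φ(lam)²` of the regularization parameter. -/
theorem parameter_choice_bounds (ha : 1 < a) (hl : lam ∈ Ioc 0 1)
    (hnl : n⁻¹ = lam ^ (1 + 1 / a) * φl ^ 2) :
    n⁻¹ ≤ lam * φl ^ 2 ∧ n⁻¹ * lam ^ (-(1 / a)) = lam * φl ^ 2 := by
  obtain ⟨hl0, hl1⟩ := hl
  have ha0 : 0 < a := by linarith
  constructor
  · rw [hnl, Real.rpow_add hl0, Real.rpow_one]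
    have h1 : lam ^ (1 / a) ≤ 1 := Real.rpow_le_one hl0.le hl1 (by positivity)
    calc _ = lam * φl ^ 2 * lam ^ (1 / a) := by ring
      _ ≤ lam * φl ^ 2 * 1 := by gcongr
      _ = _ := mul_one _
  · rw [hnl, mul_right_comm, ← Real.rpow_add hl0, add_neg_cancel_right, Real.rpow_one]

end NumericBounds

/-! ### Good samples and their probability. -/

namespace IsWeightedModel

/-- The constant in the bound of the covariance deviation. -/
def devConst (s CN : ℝ) : ℝ := 12 * s + 2 * √(3 * s * CN)

/-- The factor `ω` by which the regularization parameter is enlarged on atypical samples. -/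
def enlargement (s CN L φl : ℝ) : ℝ := 1 + (1 + 4 * devConst s CN ^ 2) * (L * φl ^ 2)

/-- The bound of `ω / L`. -/
def enlargementConst (s CN φ₁ : ℝ) : ℝ := 2 + (1 + 4 * devConst s CN ^ 2) * φ₁ ^ 2

/-- The constant in the bound of the noise. -/
def noiseConst (s CN B M φ₁ : ℝ) : ℝ :=
  4 * B * M ^ 2 * (4 * enlargementConst s CN φ₁ * (2 * CN + 15 * s) + 12)

section Numeric

variable {s CN L φl φ₁ : ℝ}

theorem devConst_pos (hs : 0 < s) : 0 < devConst s CN := by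
  unfold devConst
  positivity

theorem one_le_enlargement (hL : 0 ≤ L) : 1 ≤ enlargement s CN L φl := by
  unfold enlargement
  have : 0 ≤ (1 + 4 * devConst s CN ^ 2) * (L * φl ^ 2) := by positivity
  linarith

theorem enlargement_le (hL : 1 / 2 ≤ L) (hφ0 : 0 ≤ φl) (hφ : φl ≤ φ₁) :
    enlargement s CN L φl ≤ enlargementConst s CN φ₁ * L := by
  unfold enlargement enlargementConst
  have h1 : φl ^ 2 ≤ φ₁ ^ 2 := by gcongr
  have h2 : L * φl ^ 2 ≤ L * φ₁ ^ 2 := mul_le_mul_of_nonneg_left h1 (by linarith)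
  have h3 : (1 + 4 * devConst s CN ^ 2) * (L * φl ^ 2) ≤
      (1 + 4 * devConst s CN ^ 2) * (L * φ₁ ^ 2) :=
    mul_le_mul_of_nonneg_left h2 (by positivity)
  linarith

/-- For x = √L φ(λ) and d the deviation constant, ω = 1 + (1 + 4d²)x² dominates both (2dx)² and x².
The first bound makes C and Ĉ comparable at level ωλ, the second gives L/n ≤ ωλ. -/
theorem mul_sqrt_le_sqrt_enlargement (hL : 0 ≤ L) :
    2 * (devConst s CN * (√L * φl)) ≤ √(enlargement s CN L φl) ∧
      √L * φl ≤ √(enlargement s CN L φl) := by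
  have hx : (√L * φl) ^ 2 = L * φl ^ 2 := by rw [mul_pow, Real.sq_sqrt hL]
  have hx0 : 0 ≤ L * φl ^ 2 := by positivity
  constructor
  · refine Real.le_sqrt_of_sq_le ?_
    unfold enlargement
    rw [mul_pow, mul_pow, hx]
    linarith
  · refine Real.le_sqrt_of_sq_le ?_
    unfold enlargement
    rw [hx]
    nlinarith [mul_nonneg (sq_nonneg (devConst s CN)) hx0]

end Numeric

variable {X Y H G : Type*} [MeasurableSpace X]
  [NormedAddCommGroup Y] [InnerProductSpace ℝ Y] [CompleteSpace Y]
  [NormedAddCommGroup H] [InnerProductSpace ℝ H] [CompleteSpace H] [RKHS ℝ H X ℝ]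
  [NormedAddCommGroup G] [InnerProductSpace ℝ G] [CompleteSpace G] [RKHS ℝ G X Y]
  {pX qX : Measure X} {β : X → ℝ} {s : ℝ} {e : HilbertBasis ℕ ℝ H} {μ : ℕ → ℝ}

/-- The event on which the covariance operator and the noise are well concentrated. -/
structure IsGoodSample (β : X → ℝ) (e : HilbertBasis ℕ ℝ H) (μ : ℕ → ℝ) (f : X → Y)
    (lam ω η V : ℝ) {n : ℕ} (z : Fin n → X × Y) : Prop where
  cov : ∀ h, ‖e.diag (fun i => (√(μ i + ω * lam))⁻¹)
    (empiricalCov H β (fun i => (z i).1) h - e.diag μ h)‖ ≤ η * ‖h‖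
  noise : noiseForm H β f lam z ≤ V

/-- Replacing (Ĉ + λ)⁻¹ by 2ω(C + ωλ)⁻¹ turns the summands into a fixed function of each sample
point, so that concentration of independent sums applies. -/
theorem empiricalEffDim_le [IsProbabilityMeasure pX] [IsProbabilityMeasure qX]
    (hm : IsWeightedModel pX qX β s e μ) {ι : Type*}
    {b : HilbertBasis ι ℝ H} {t : ι → ℝ} {n : ℕ} {x : Fin n → X}
    (hC : empiricalCov H β x = b.diag t)
    (htb : ∃ C, ∀ i, |t i| ≤ C) (ht : ∀ i, 0 ≤ t i) {lam ω η : ℝ} (hl : 0 < lam) (hω : 1 ≤ ω)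
    (hη : ∀ h, ‖e.diag (fun i => (√(μ i + ω * lam))⁻¹) (empiricalCov H β x h - e.diag μ h)‖ ≤
      η * ‖h‖) (hηs : η ≤ √(ω * lam) / 2) :
    empiricalEffDim H β lam x ≤
      2 * ω * ((n : ℝ)⁻¹ * ∑ i, β (x i) * ‖whitenedFeature e μ (ω * lam) (x i)‖ ^ 2) := by
  have hμ0 : ∀ i, 0 ≤ μ i := fun i => (hm.eigenvalue_pos i).le
  have hωl : 0 < ω * lam := mul_pos (by linarith) hl
  obtain ⟨-, hR⟩ := isUnit_and_inverse_empiricalCov_add hC htb ht hl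
  rw [hC] at hη
  have hcmp := norm_sq_diag_sqrt_add_le e b hμ0 hm.eigenvalue_bounded ht htb hωl hη hηs
  rw [empiricalEffDim, hR, Finset.mul_sum, Finset.mul_sum]
  refine Finset.sum_le_sum fun i _ => ?_
  have h1 := inner_diag_resolvent_le e b hμ0 hm.eigenvalue_bounded ht htb hl hω hcmp
    (featureMap H (x i))
  calc _ ≤ β (x i) / n * (2 * ω * ‖whitenedFeature e μ (ω * lam) (x i)‖ ^ 2) :=
        mul_le_mul_of_nonneg_left h1 (div_nonneg (hm.weight_nonneg _) n.cast_nonneg)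
    _ = _ := by ring

variable [MeasurableSpace Y] [BorelSpace Y] [SecondCountableTopology Y]

/-- Three exceptional events, for the covariance, the effective dimension and the noise, have
probabilities at most 2e^(-3L), 2e^(-3L) and e^(-3L). The confidence level 3L makes their total at
most δ when L = log(2/δ). -/
theorem measure_not_isGoodSample_le [IsProbabilityMeasure pX] [IsProbabilityMeasure qX]
    (hm : IsWeightedModel pX qX β s e μ)
    (hG : IsScalarKernelExtension H G) (𝒦 : Kernel X Y) [IsMarkovKernel 𝒦] {B : ℝ}
    (hβB : ∀ x, β x ≤ B) (hB : 0 < B) {f : X → Y} (hf : Measurable f)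
    (hfreg : ∀ᵐ x ∂qX, f x = regressionFunction 𝒦 x) {M : ℝ} (hM0 : 0 < M)
    (hM : ∀ᵐ w ∂(pX ⊗ₘ 𝒦), ‖w.2‖ ≤ M) {a : ℝ} (ha : 1 < a) {CN : ℝ} (hCN : 0 < CN)
    (hN : ∀ lam ∈ Ioc (0 : ℝ) 1, ∀ r, lam ≤ r → ∀ n,
      ∑ i ∈ Finset.range n, μ i / (μ i + r) ≤ CN * lam ^ (-(1 / a)))
    {n : ℕ} (hn : 0 < n) {lam φl φ₁ L : ℝ} (hl : lam ∈ Ioc 0 1) (hφ0 : 0 < φl) (hφ : φl ≤ φ₁)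
    (hL : 1 / 2 ≤ L) (hnl : (n : ℝ)⁻¹ = lam ^ (1 + 1 / a) * φl ^ 2) :
    Measure.pi (fun _ : Fin n => pX ⊗ₘ 𝒦)
      {z | ¬ IsGoodSample β e μ f lam (enlargement s CN L φl) (devConst s CN * √lam * (√L * φl))
        (noiseConst s CN B M φ₁ * L * (lam * φl ^ 2)) z} ≤
      ENNReal.ofReal (5 * Real.exp (-(3 * L))) := by
  obtain ⟨hl0, hl1⟩ := id hl
  have hs0 := hm.pos
  have hn' : (0 : ℝ) < n := by exact_mod_cast hn
  obtain ⟨hn1, hn2⟩ := parameter_choice_bounds ha hl hnl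
  set ω := enlargement s CN L φl with hωdef
  have hω1 : 1 ≤ ω := one_le_enlargement (by linarith)
  set r := ω * lam with hr
  have hrl : lam ≤ r := le_mul_of_one_le_left hl0.le hω1
  have hr0 : 0 < r := hl0.trans_le hrl
  set N := CN * lam ^ (-(1 / a)) with hNdef
  have hNr := hN lam hl r hrl
  have hx0 : 0 ≤ √L * φl := by positivity
  have hx2 : (√L * φl) ^ 2 = L * φl ^ 2 := by rw [mul_pow, Real.sq_sqrt (by linarith)]
  obtain ⟨hw1, hw2⟩ := mul_sqrt_le_sqrt_enlargement (s := s) (CN := CN) (L := L) (φl := φl)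
    (by linarith)
  have hsr : √r = √ω * √lam := Real.sqrt_mul (by linarith) _
  have hsl : √lam ^ 2 = lam := Real.sq_sqrt hl0.le
  have hsl0 : 0 < √lam := Real.sqrt_pos.2 hl0
  -- the deviation bound
  have hη : (4 * (s / √r) * (3 * L) + 2 * √(s * N) * √(n * (3 * L))) / n ≤
      devConst s CN * √lam * (√L * φl) := by
    have h1 : 4 * (s / √r) * (3 * L) / n ≤ 12 * s * √lam * (√L * φl) := by
      rw [div_le_iff₀ hn', mul_div_assoc', div_mul_eq_mul_div, div_le_iff₀ (by positivity), hsr]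
      have h2 : L ≤ (√L * φl) ^ 2 * lam * n := by
        rw [hx2]
        have h3 := mul_le_mul_of_nonneg_left hn1 (show 0 ≤ L * n by positivity)
        rw [mul_assoc, mul_inv_cancel₀ hn'.ne'] at h3
        linarith
      calc 4 * s * (3 * L) ≤ 12 * s * ((√L * φl) ^ 2 * lam * n) := by nlinarith
        _ = 12 * s * √lam * (√L * φl) * n * ((√L * φl) * √lam) := by
          linear_combination (12 * s * (√L * φl) ^ 2 * n) * (-hsl)
        _ ≤ 12 * s * √lam * (√L * φl) * n * (√ω * √lam) := by gcongr
    have h4 : 2 * √(s * N) * √(n * (3 * L)) / n ≤ 2 * √(3 * s * CN) * √lam * (√L * φl) := by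
      have h5 : √(s * N) * √(n * (3 * L)) / n = √(3 * s * CN) * √lam * (√L * φl) := by
        have h6 : √(s * N) * √(n * (3 * L)) / n = √(s * N * (n * (3 * L)) / (n : ℝ) ^ 2) := by
          rw [Real.sqrt_div' _ (by positivity), Real.sqrt_sq hn'.le,
            Real.sqrt_mul (show 0 ≤ s * N by positivity)]
        have h7 : s * N * (n * (3 * L)) / (n : ℝ) ^ 2 = 3 * s * CN * (lam * (L * φl ^ 2)) := by
          have : s * N * (n * (3 * L)) / (n : ℝ) ^ 2 =
              3 * s * CN * L * ((n : ℝ)⁻¹ * lam ^ (-(1 / a))) := by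
            rw [hNdef]
            field_simp
          rw [this, hn2]
          ring
        rw [h6, h7, ← hx2, Real.sqrt_mul (show 0 ≤ 3 * s * CN by positivity),
          Real.sqrt_mul hl0.le, Real.sqrt_sq hx0, ← mul_assoc]
      calc _ = 2 * (√(s * N) * √(n * (3 * L)) / n) := by ring
        _ ≤ _ := by rw [h5]; linarith
    rw [add_div]
    calc _ ≤ _ := add_le_add h1 h4
      _ = _ := by unfold devConst; ring
  have hηs : devConst s CN * √lam * (√L * φl) ≤ √r / 2 := by
    rw [hsr]
    nlinarith
  have hE1 := hm.measure_cov_deviation_le 𝒦 hr0 hNr (show 0 < 3 * L by linarith) hn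
  have hE2 := hm.measure_empirical_effDim_gt_le 𝒦 hr0 hNr (show 0 < 3 * L by linarith) hn
  have hE3 := hm.measure_noiseForm_gt_le hG 𝒦 hβB hB hn hl0 hf hfreg hM0 hM (3 * L)
  refine (measure_mono (fun z hz => ?_)).trans ((measure_union_le _ _).trans
    ((add_le_add ((measure_union_le _ _).trans (add_le_add hE1 hE2)) hE3).trans ?_))
  · by_contra hcon
    rw [mem_union, mem_union, not_or, not_or] at hcon
    obtain ⟨⟨h1, h2⟩, h3⟩ := hcon
    rw [mem_ofPred_eq, not_not] at h1
    rw [mem_ofPred_eq, not_lt] at h2 h3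
    have hcov : ∀ h, ‖e.diag (fun i => (√(μ i + r))⁻¹)
        (empiricalCov H β (fun i => (z i).1) h - e.diag μ h)‖ ≤
          devConst s CN * √lam * (√L * φl) * ‖h‖ := fun h => (h1 h).trans (by gcongr)
    refine hz ⟨hcov, h3.trans ?_⟩
    obtain ⟨w, b, t, -, ht, htb, hC⟩ := hm.exists_eigenbasis hβB hn fun i => (z i).1
    have h4 := hm.empiricalEffDim_le hC htb ht hl0 hω1 hcov hηs
    -- The main term uses N/n ≲ λ φ(λ)²; the range term uses L/(n r) ≤ 1, ensured by the
    -- enlargement.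
    have h5 : (n : ℝ)⁻¹ * (2 * N + 5 * s * (3 * L) / (n * r)) ≤
        (2 * CN + 15 * s) * (lam * φl ^ 2) := by
      have h6 : L * (n : ℝ)⁻¹ ≤ r := by
        calc L * (n : ℝ)⁻¹ ≤ L * (lam * φl ^ 2) := by gcongr
          _ = (√L * φl) ^ 2 * lam := by rw [hx2]; ring
          _ ≤ √ω ^ 2 * lam := by gcongr
          _ = r := by rw [Real.sq_sqrt (by linarith)]
      calc _ = 2 * CN * ((n : ℝ)⁻¹ * lam ^ (-(1 / a))) + 15 * s * (n : ℝ)⁻¹ *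
            (L * (n : ℝ)⁻¹ / r) := by
            rw [hNdef]
            field_simp
            ring
        _ ≤ 2 * CN * (lam * φl ^ 2) + 15 * s * (lam * φl ^ 2) * 1 := by
            rw [hn2]
            have : L * (n : ℝ)⁻¹ / r ≤ 1 := (div_le_one hr0).2 h6
            gcongr
        _ = _ := by ring
    have hωL := enlargement_le (s := s) (CN := CN) hL hφ0.le hφ
    have hE0 : 0 ≤ enlargementConst s CN φ₁ := by unfold enlargementConst; positivity
    have hL0 : 0 ≤ L := by linarith
    calc 4 * B * M ^ 2 / n *
          (2 * empiricalEffDim H β lam (fun i => (z i).1) + 4 * (3 * L))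
        ≤ 4 * B * M ^ 2 / n *
          (2 * (2 * ω * (2 * N + 5 * s * (3 * L) / (n * r))) + 4 * (3 * L)) := by
          have h7 := h4.trans (mul_le_mul_of_nonneg_left h2 (show 0 ≤ 2 * ω by linarith))
          gcongr
      _ = 4 * B * M ^ 2 * (4 * ω * ((n : ℝ)⁻¹ * (2 * N + 5 * s * (3 * L) / (n * r))) +
          12 * L * (n : ℝ)⁻¹) := by ring
      _ ≤ 4 * B * M ^ 2 * (4 * (enlargementConst s CN φ₁ * L) *
          ((2 * CN + 15 * s) * (lam * φl ^ 2)) + 12 * L * (lam * φl ^ 2)) := by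
          gcongr
      _ = _ := by unfold noiseConst; ring
  · rw [← ENNReal.ofReal_add (by positivity) (by positivity),
      ← ENNReal.ofReal_add (by positivity) (by positivity)]
    refine ENNReal.ofReal_le_ofReal (le_of_eq ?_)
    ring

end IsWeightedModel

/-! ### The inverse of Ψ. -/

section PsiInverse

variable {φ : ℝ → ℝ} {a : ℝ}

theorem IsIndexFunction.pos (hφ : IsIndexFunction φ) {t : ℝ} (ht : 0 < t) : 0 < φ t := by
  rw [← hφ.map_zero]
  exact hφ.strictMonoOn (mem_Ici.2 le_rfl) ht.le ht

theorem IsIndexFunction.mono (hφ : IsIndexFunction φ) {t u : ℝ} (ht : 0 ≤ t) (htu : t ≤ u) :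
    φ t ≤ φ u :=
  hφ.strictMonoOn.monotoneOn ht (ht.trans htu) htu

/-- Intermediate value theorem. For T ≥ 1 one has φ(T) ≥ φ(1) > 0, so the power factor alone makes Ψ
exceed y. -/
theorem psi_psiInv (hφ : IsIndexFunction φ) (ha : 1 < a) {y : ℝ} (hy : 0 ≤ y) :
    Psi φ a (psiInv φ a y) = y := by
  have hp : 0 < 1 / 2 + 1 / (2 * a) := by positivity
  set p := 1 / 2 + 1 / (2 * a) with hpdef
  refine Function.invFunOn_eq ?_
  have hφ1 := hφ.pos one_pos
  set T := max 1 ((y / φ 1) ^ p⁻¹) with hT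
  have hT1 : 1 ≤ T := le_max_left _ _
  have hcont : ContinuousOn (Psi φ a) (Icc 0 T) :=
    (Real.continuous_rpow_const hp.le).continuousOn.mul
      (hφ.continuousOn.mono fun x hx => hx.1)
  have h0 : Psi φ a 0 = 0 := by rw [Psi, hφ.map_zero, mul_zero]
  have h1 : y ≤ Psi φ a T := by
    have h2 : y / φ 1 ≤ T ^ p := by
      calc y / φ 1 = ((y / φ 1) ^ p⁻¹) ^ p := (Real.rpow_inv_rpow (by positivity) hp.ne').symm
        _ ≤ T ^ p := Real.rpow_le_rpow (by positivity) (le_max_right _ _) hp.le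
    calc y = y / φ 1 * φ 1 := by field_simp
      _ ≤ T ^ p * φ T := mul_le_mul h2 (hφ.mono zero_le_one hT1) hφ1.le (by positivity)
  obtain ⟨x, hx, hxy⟩ := intermediate_value_Icc (by linarith : (0 : ℝ) ≤ T) hcont
    (show y ∈ Icc (Psi φ a 0) (Psi φ a T) from ⟨h0.trans_le hy, h1⟩)
  exact ⟨x, hx.1, hxy⟩

theorem inv_eq_of_eq_psiInv (hφ : IsIndexFunction φ) (ha : 1 < a) {n : ℕ} {lam : ℝ}
    (hl0 : 0 < lam) (hl : lam = psiInv φ a ((n : ℝ) ^ (-(1 / 2) : ℝ))) :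
    (n : ℝ)⁻¹ = lam ^ (1 + 1 / a) * φ lam ^ 2 := by
  have h := psi_psiInv hφ ha (y := (n : ℝ) ^ (-(1 / 2) : ℝ)) (by positivity)
  rw [← hl, Psi] at h
  have h2 : ((n : ℝ) ^ (-(1 / 2) : ℝ)) ^ 2 = (n : ℝ)⁻¹ := by
    rw [← Real.rpow_natCast, ← Real.rpow_mul (by positivity), ← Real.rpow_neg_one]
    norm_num
  rw [← h2, ← h, mul_pow, ← Real.rpow_natCast, ← Real.rpow_mul hl0.le]
  congr 2
  push_cast
  field_simp

end PsiInverse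

/-! ### Bounds for the filter and residual functions. -/

section Filter

/-- The values of a filter function, set to zero at zero. -/
def cutoff (g : ℝ → ℝ) (t : ℝ) : ℝ := if t = 0 then 0 else g t

theorem bounded_cutoff {ι : Type*} {t : ι → ℝ} {g : ℝ → ℝ} (hg : ∃ C, ∀ i, |g (t i)| ≤ C) :
    ∃ C, ∀ i, |cutoff g (t i)| ≤ C := by
  obtain ⟨C, hC⟩ := hg
  refine ⟨C, fun i => ?_⟩
  unfold cutoff
  split_ifs
  · rw [abs_zero]
    exact (abs_nonneg _).trans (hC i)
  · exact hC i

theorem bounded_one_sub_mul_cutoff {ι : Type*} {t : ι → ℝ} {g : ℝ → ℝ}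
    (hg : ∃ C, ∀ i, |g (t i)| ≤ C) (ht : ∃ C, ∀ i, |t i| ≤ C) :
    ∃ C, ∀ i, |1 - t i * cutoff g (t i)| ≤ C := by
  obtain ⟨C, hC⟩ := bounded_cutoff hg
  obtain ⟨T, hT⟩ := ht
  refine ⟨1 + T * C, fun i => (abs_sub _ _).trans ?_⟩
  rw [abs_one, abs_mul]
  have h1 := hT i
  have h2 := hC i
  have h3 := (abs_nonneg _).trans h1
  gcongr

variable {s D B lam t : ℝ} {g : ℝ → ℝ → ℝ}

theorem abs_mul_cutoff_le (hD0 : 0 ≤ D) (hD : ∀ lam ∈ Ioc 0 s, ∀ σ ∈ Ioc 0 s, |σ * g lam σ| ≤ D)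
    (hl : lam ∈ Ioc 0 s) (ht : t ∈ Icc 0 s) : |t * cutoff (g lam) t| ≤ D := by
  unfold cutoff
  split_ifs with h
  · simpa
  · exact hD lam hl t ⟨lt_of_le_of_ne ht.1 (Ne.symm h), ht.2⟩

theorem abs_cutoff_le (hB0 : 0 ≤ B) (hB : ∀ lam ∈ Ioc 0 s, ∀ σ ∈ Ioc 0 s, |g lam σ| ≤ B / lam)
    (hl : lam ∈ Ioc 0 s) (ht : t ∈ Icc 0 s) : |cutoff (g lam) t| ≤ B / lam := by
  unfold cutoff
  split_ifs with h
  · rw [abs_zero]; exact div_nonneg hB0 hl.1.le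
  · exact hB lam hl t ⟨lt_of_le_of_ne ht.1 (Ne.symm h), ht.2⟩

theorem abs_one_sub_mul_cutoff_le (hD0 : 0 ≤ D)
    (hD : ∀ lam ∈ Ioc 0 s, ∀ σ ∈ Ioc 0 s, |σ * g lam σ| ≤ D)
    (hl : lam ∈ Ioc 0 s) (ht : t ∈ Icc 0 s) : |1 - t * cutoff (g lam) t| ≤ 1 + D := by
  have h := abs_mul_cutoff_le hD0 hD hl ht
  rw [abs_le] at h ⊢
  constructor <;> linarith

/-- From |t g| ≤ D and λ|g| ≤ B one gets (t + λ)|g| ≤ D + B. Squaring compares the filter with the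
resolvent, through which the noise is controlled. -/
theorem cutoff_mul_sq_le (hD0 : 0 ≤ D) (hD : ∀ lam ∈ Ioc 0 s, ∀ σ ∈ Ioc 0 s, |σ * g lam σ| ≤ D)
    (hB0 : 0 ≤ B) (hB : ∀ lam ∈ Ioc 0 s, ∀ σ ∈ Ioc 0 s, |g lam σ| ≤ B / lam)
    (hl : lam ∈ Ioc 0 s) (ht : t ∈ Icc 0 s) :
    (t + lam) * cutoff (g lam) t ^ 2 ≤ (D + B) ^ 2 * (t + lam)⁻¹ := by
  have h1 := abs_mul_cutoff_le hD0 hD hl ht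
  have h2 := abs_cutoff_le hB0 hB hl ht
  have hl0 := hl.1
  have ht0 := ht.1
  set γ := cutoff (g lam) t
  have h3 : |(t + lam) * γ| ≤ D + B := by
    rw [add_mul]
    refine (abs_add_le _ _).trans (add_le_add h1 ?_)
    rw [abs_mul, abs_of_pos hl0]
    calc lam * |γ| ≤ lam * (B / lam) := by gcongr
      _ = B := by field_simp
  have h4 : ((t + lam) * γ) ^ 2 ≤ (D + B) ^ 2 := by
    rw [← sq_abs]
    gcongr
  rw [← div_eq_mul_inv, le_div_iff₀ (by positivity)]
  calc _ = ((t + lam) * γ) ^ 2 := by ring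
    _ ≤ _ := h4

variable {ν K : ℝ} {r : ℝ}

/-- The residual function weighted by `(t + ω lam)^{1/2}`. -/
theorem sqrt_add_mul_residual_le {ω γν : ℝ} (hl0 : 0 < lam) (ht0 : 0 ≤ t) (hω : 1 ≤ ω)
    (hν : 1 / 2 < ν) (hγ : 0 ≤ γν) (hK : 0 ≤ K) (hr : |r| ≤ K)
    (hrt : 0 < t → |r| * t ^ ν ≤ γν * lam ^ ν) :
    |√(t + ω * lam) * r| ≤ √2 * (K + γν) * (√ω * √lam) ∧
      (0 < t → |√(t + ω * lam) * r| * t ^ (ν - 1 / 2) ≤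
        √2 * (K + γν) * (√ω * √lam) * lam ^ (ν - 1 / 2)) := by
  have hr0 := abs_nonneg r
  have h1 : √(t + ω * lam) ≤ √ω * √(t + lam) := by
    rw [← Real.sqrt_mul (by linarith)]
    refine Real.sqrt_le_sqrt ?_
    nlinarith
  have habs : |√(t + ω * lam) * r| ≤ √ω * (√(t + lam) * |r|) := by
    rw [abs_mul, abs_of_nonneg (Real.sqrt_nonneg _), ← mul_assoc]
    gcongr
  -- For t ≤ λ the weight is of order at most √(ωλ). For t > λ it is of order at most √(ωt), and the
  -- factor √t is paid from t^ν, lowering the exponent to ν - 1/2.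
  rcases le_or_gt t lam with htl | htl
  · have h2 : √(t + lam) ≤ √2 * √lam := by
      rw [← Real.sqrt_mul zero_le_two]
      exact Real.sqrt_le_sqrt (by linarith)
    have h3 : |√(t + ω * lam) * r| ≤ √2 * (K + γν) * (√ω * √lam) := by
      calc _ ≤ _ := habs
        _ ≤ √ω * ((√2 * √lam) * (K + γν)) := by
          have : |r| ≤ K + γν := by linarith
          gcongr
        _ = _ := by ring
    refine ⟨h3, fun htp => ?_⟩
    have : t ^ (ν - 1 / 2) ≤ lam ^ (ν - 1 / 2) :=
      Real.rpow_le_rpow ht0 htl (by linarith)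
    gcongr
  · have htp : 0 < t := hl0.trans htl
    have h2 : √(t + lam) ≤ √2 * √t := by
      rw [← Real.sqrt_mul zero_le_two]
      exact Real.sqrt_le_sqrt (by linarith)
    have hsplit : t ^ ν = √t * t ^ (ν - 1 / 2) := by
      rw [Real.sqrt_eq_rpow, ← Real.rpow_add htp]
      ring_nf
    have hsplit' : lam ^ ν = √lam * lam ^ (ν - 1 / 2) := by
      rw [Real.sqrt_eq_rpow, ← Real.rpow_add hl0]
      ring_nf
    have h3 : |√(t + ω * lam) * r| * t ^ (ν - 1 / 2) ≤
        √2 * (K + γν) * (√ω * √lam) * lam ^ (ν - 1 / 2) := by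
      have hq : 0 ≤ t ^ (ν - 1 / 2) := by positivity
      calc _ ≤ √ω * ((√2 * √t) * |r|) * t ^ (ν - 1 / 2) := by
            refine mul_le_mul_of_nonneg_right (habs.trans ?_) hq
            gcongr
        _ = √ω * √2 * (|r| * t ^ ν) := by rw [hsplit]; ring
        _ ≤ √ω * √2 * ((K + γν) * lam ^ ν) := by
            have h4 := hrt htp
            have h5 : γν * lam ^ ν ≤ (K + γν) * lam ^ ν := by
              gcongr
              linarith
            have := h4.trans h5
            gcongr
        _ = _ := by rw [hsplit']; ring
    refine ⟨?_, fun _ => h3⟩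
    have h6 : lam ^ (ν - 1 / 2) ≤ t ^ (ν - 1 / 2) :=
      Real.rpow_le_rpow hl0.le htl.le (by linarith)
    refine le_of_mul_le_mul_right (h3.trans ?_) (show 0 < t ^ (ν - 1 / 2) by positivity)
    gcongr

end Filter

/-! ### Covering exponents for φ(t)√t. -/

section Covering

variable {φ : ℝ → ℝ} {s ν : ℝ}

/-- An exponent that covers `φ(t) √t` exceeds `1 / 2`. -/
theorem Covers.half_lt (hφ : IsIndexFunction φ) (hs : 0 < s)
    (h : Covers s ν fun t => φ t * √t) : 1 / 2 < ν := by
  by_contra hν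
  push Not at hν
  obtain ⟨c, hc, h⟩ := h
  have hφs := hφ.pos hs
  -- If ν ≤ 1/2 then t^(ν - 1/2) does not increase, and covering keeps φ away from 0 near the
  -- origin, against continuity and φ(0) = 0.
  have key : ∀ t ∈ Ioc 0 s, c * φ s ≤ φ t := by
    intro t ht
    have ht0 := ht.1
    have hφt := hφ.pos ht0
    have h1 := h t ht s ⟨ht.2, le_rfl⟩
    have hst : 0 < √t := Real.sqrt_pos.2 ht0
    have hss : 0 < √s := Real.sqrt_pos.2 hs
    have hsplit : ∀ u : ℝ, 0 < u → u ^ ν = √u * u ^ (ν - 1 / 2) := by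
      intro u hu
      rw [Real.sqrt_eq_rpow, ← Real.rpow_add hu]
      ring_nf
    have h2 : s ^ (ν - 1 / 2) ≤ t ^ (ν - 1 / 2) :=
      Real.rpow_le_rpow_of_nonpos ht0 ht.2 (by linarith)
    have h3 : c * (t ^ (ν - 1 / 2) / φ t) ≤ s ^ (ν - 1 / 2) / φ s := by
      simp only [hsplit t ht0, hsplit s hs] at h1
      have e1 : √t * t ^ (ν - 1 / 2) / (φ t * √t) = t ^ (ν - 1 / 2) / φ t := by field_simp
      have e2 : √s * s ^ (ν - 1 / 2) / (φ s * √s) = s ^ (ν - 1 / 2) / φ s := by field_simp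
      rwa [e1, e2] at h1
    have hsp : 0 < s ^ (ν - 1 / 2) := by positivity
    have h4 : c * (s ^ (ν - 1 / 2) / φ t) ≤ s ^ (ν - 1 / 2) / φ s := by
      refine le_trans ?_ h3
      gcongr
    rw [mul_div_assoc', div_le_div_iff₀ hφt hφs] at h4
    refine le_of_mul_le_mul_right ?_ hsp
    linarith
  have hcφ : 0 < c * φ s := by positivity
  have hcont : Filter.Tendsto φ (nhdsWithin 0 (Ioc 0 s)) (nhds 0) := by
    have h1 := (hφ.continuousOn 0 (mem_Ici.2 le_rfl)).tendsto
    rw [hφ.map_zero] at h1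
    exact h1.mono_left (nhdsWithin_mono _ fun x hx => hx.1.le)
  have hne : (nhdsWithin (0 : ℝ) (Ioc 0 s)).NeBot := by
    rw [nhdsWithin_Ioc_eq_nhdsGT hs]
    infer_instance
  have h0 : c * φ s ≤ 0 := ge_of_tendsto hcont (by
    filter_upwards [self_mem_nhdsWithin] with t ht using key t ht)
  linarith

theorem Covers.sub_half (h : Covers s ν fun t => φ t * √t) : Covers s (ν - 1 / 2) φ := by
  obtain ⟨c, hc, h⟩ := h
  refine ⟨c, hc, fun t ht σ hσ => ?_⟩
  have h1 := h t ht σ hσ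
  have e : ∀ u : ℝ, 0 < u → u ^ ν / (φ u * √u) = u ^ (ν - 1 / 2) / φ u := by
    intro u hu
    have hu' : 0 < √u := Real.sqrt_pos.2 hu
    have : u ^ ν = √u * u ^ (ν - 1 / 2) := by
      rw [Real.sqrt_eq_rpow, ← Real.rpow_add hu]
      ring_nf
    rw [this, mul_comm (φ u), mul_div_mul_left _ _ hu'.ne']
  simp only [e t ht.1, e σ (ht.1.trans_le hσ.1)] at h1
  exact h1

end Covering

/-! ### Countability of bases of the output space. -/

section Countable

/-- Distinct basis vectors are √2 apart, so the balls of radius 1/2 about them are disjoint.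
Countability is needed to integrate termwise over a basis of `Y`. -/
theorem HilbertBasis.countable {κ Y : Type*} [NormedAddCommGroup Y] [InnerProductSpace ℝ Y]
    [SecondCountableTopology Y] (c : HilbertBasis κ ℝ Y) : Countable κ := by
  have h : (univ : Set κ).PairwiseDisjoint fun i => Metric.ball (c i) (1 / 2) := by
    intro i _ j _ hij
    refine Metric.ball_disjoint_ball ?_
    have h1 : ‖c i - c j‖ ^ 2 = 2 := by
      rw [norm_sub_sq_real, c.orthonormal.1 i, c.orthonormal.1 j, c.orthonormal.2 hij]
      norm_num
    rw [dist_eq_norm]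
    nlinarith [norm_nonneg (c i - c j)]
  exact countable_univ_iff.1 (h.countable_of_isOpen (fun i _ => Metric.isOpen_ball)
    fun i _ => ⟨c i, Metric.mem_ball_self (by norm_num)⟩)

end Countable

theorem biasConst_nonneg {ν c K M : ℝ} (hν : 0 < ν) (hc : 0 < c) (hK : 0 ≤ K) (hM : 0 ≤ M) :
    0 ≤ biasConst ν c K M := by
  obtain ⟨-, q1⟩ := two_rpow_neg_mem hν
  have h1 : 0 < (1 - (2 : ℝ) ^ (-ν))⁻¹ := inv_pos.2 (by linarith)
  have h2 : 0 < (2 : ℝ) ^ ν - 1 := by linarith [Real.one_lt_rpow one_lt_two hν]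
  unfold biasConst
  positivity

theorem biasConst_mul {ν c K M u : ℝ} : biasConst ν c (K * u) M = u * biasConst ν c K M := by
  unfold biasConst
  ring

/-! ### Error decomposition into bias and noise. -/

namespace IsWeightedModel

variable {X Y H G : Type*} [MeasurableSpace X]
  [NormedAddCommGroup Y] [InnerProductSpace ℝ Y] [CompleteSpace Y]
  [NormedAddCommGroup H] [InnerProductSpace ℝ H] [CompleteSpace H] [RKHS ℝ H X ℝ]
  [NormedAddCommGroup G] [InnerProductSpace ℝ G] [CompleteSpace G] [RKHS ℝ G X Y]
  {pX qX : Measure X} [IsProbabilityMeasure pX] [IsProbabilityMeasure qX]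
  {β : X → ℝ} {s : ℝ} {e : HilbertBasis ℕ ℝ H} {μ : ℕ → ℝ}

section Source

variable {φ : ℝ → ℝ}

theorem index_bounded (hm : IsWeightedModel pX qX β s e μ) (hφ : IsIndexFunction φ) :
    ∃ C, ∀ i, |φ (μ i)| ≤ C :=
  ⟨φ s, fun i => by
    rw [abs_of_pos (hφ.pos (hm.eigenvalue_pos i))]
    exact hφ.mono (hm.eigenvalue_pos i).le (hm.eigenvalue_le i)⟩

/-- Taking adjoints in ⟪y, C_o φ(C) k(x, ·)⟫ exhibits the component of f along y as φ(C) C_o* y, the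
form used in the bias bound. -/
theorem exists_source (hm : IsWeightedModel pX qX β s e μ) (hφ : IsIndexFunction φ)
    (hG : IsScalarKernelExtension H G) {f : G} (hsource : SourceCondition H qX φ f) :
    StronglyMeasurable (fun x => f x) ∧ ∃ Co : H →L[ℝ] Y, IsHilbertSchmidt Co ∧
      ∀ y, rkhsComp hG y f =
        e.diag (fun i => φ (μ i)) (ContinuousLinearMap.adjoint Co y) := by
  obtain ⟨Cs, Co, -, hCo, hf, hCs⟩ := hsource
  have hb := hm.index_bounded hφ
  refine ⟨?_, Co, hCo, fun y => RKHS.ext fun x => ?_⟩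
  · simp only [hf]
    exact Cs.continuous.comp_stronglyMeasurable
      (stronglyMeasurable_featureMap hm.measurable_kernel e)
  · rw [rkhsComp_apply, hf, hCs, hm.covarianceOp_eq_diag,
      spectralApply_diag e hm.eigenvalue_bounded hb, ← inner_featureMap,
      ← e.inner_diag_comm hb, ContinuousLinearMap.adjoint_inner_right, real_inner_comm]

end Source

/-- Comparison of the `L²(q_X)`-norm with the components in an orthonormal basis of `Y`. -/
theorem eLpNorm_le_of_sum_le [SecondCountableTopology Y]
    (hm : IsWeightedModel pX qX β s e μ) (hG : IsScalarKernelExtension H G) {κ : Type*}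
    (c : HilbertBasis κ ℝ Y) (f : G) {T : ℝ} (hT : 0 ≤ T)
    (h : ∀ F : Finset κ, ∑ j ∈ F, inner ℝ (rkhsComp hG (c j) f)
      (e.diag μ (rkhsComp hG (c j) f)) ≤ T ^ 2) :
    eLpNorm (fun x => f x) 2 qX ≤ ENNReal.ofReal T := by
  have := c.countable
  obtain ⟨k, hk⟩ := hm.bounded_kernel
  have hmeas : ∀ j, Measurable fun x => rkhsComp hG (c j) f x := fun j =>
    measurable_apply_of_mem_rkhs hm.measurable_kernel _
  have h1 : ∀ x, ‖f x‖ₑ ^ (2 : ℝ) = ∑' j, ENNReal.ofReal (rkhsComp hG (c j) f x ^ 2) := by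
    intro x
    have h2 : HasSum (fun j => rkhsComp hG (c j) f x ^ 2) (‖f x‖ ^ 2) :=
      (c.hasSum_inner_sq (f x)).congr_fun fun j => by rw [rkhsComp_apply]
    rw [← ENNReal.ofReal_tsum_of_nonneg (fun j => sq_nonneg _) h2.summable, h2.tsum_eq,
      ENNReal.ofReal_pow (norm_nonneg _), ofReal_norm, ENNReal.rpow_two]
  have h3 : ∀ j, ∫⁻ x, ENNReal.ofReal (rkhsComp hG (c j) f x ^ 2) ∂qX =
      ENNReal.ofReal (inner ℝ (rkhsComp hG (c j) f) (e.diag μ (rkhsComp hG (c j) f))) := by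
    intro j
    rw [← hm.covarianceOp_eq_diag, _root_.inner_covarianceOp hm.measurable_kernel hk e]
    simp only [← pow_two]
    refine (ofReal_integral_eq_lintegral_ofReal ?_
      (Filter.Eventually.of_forall fun x => sq_nonneg _)).symm
    refine Integrable.of_bound (C := (|k| * ‖rkhsComp hG (c j) f‖) ^ 2)
      ((hmeas j).pow_const 2).aestronglyMeasurable (Filter.Eventually.of_forall fun x => ?_)
    rw [norm_pow, Real.norm_eq_abs]
    have := abs_apply_le_norm hk (rkhsComp hG (c j) f) x
    gcongr
  have hnn : ∀ j, 0 ≤ inner ℝ (rkhsComp hG (c j) f) (e.diag μ (rkhsComp hG (c j) f)) := fun j =>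
    (e.hasSum_inner_diag hm.eigenvalue_bounded _ _).nonneg fun i =>
      mul_nonneg (hm.eigenvalue_pos i).le (mul_self_nonneg _)
  rw [eLpNorm_eq_lintegral_rpow_enorm_toReal (by norm_num) (by norm_num)]
  simp only [ENNReal.toReal_ofNat, h1]
  rw [lintegral_tsum fun j => ((hmeas j).pow_const 2).ennreal_ofReal.aemeasurable]
  simp only [h3]
  have h4 : ∑' j, ENNReal.ofReal (inner ℝ (rkhsComp hG (c j) f)
      (e.diag μ (rkhsComp hG (c j) f))) ≤ ENNReal.ofReal T ^ (2 : ℝ) := by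
    rw [ENNReal.tsum_eq_iSup_sum]
    refine iSup_le fun F => ?_
    rw [← ENNReal.ofReal_sum_of_nonneg fun j _ => hnn j, ENNReal.rpow_two,
      ← ENNReal.ofReal_pow hT]
    exact ENNReal.ofReal_le_ofReal (h F)
  calc _ ≤ (ENNReal.ofReal T ^ (2 : ℝ)) ^ (1 / 2 : ℝ) := ENNReal.rpow_le_rpow h4 (by norm_num)
    _ = _ := by rw [← ENNReal.rpow_mul]; norm_num

section Residual

variable {κ ι : Type*} {n : ℕ} {b : HilbertBasis ι ℝ H} {t : ι → ℝ}

/-- Bias and variance parts of the components of the error. -/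
theorem rkhsComp_sub_estimator (hG : IsScalarKernelExtension H G) (c : HilbertBasis κ ℝ Y)
    (z : Fin n → X × Y)
    (ht : ∀ i, empiricalCov H β (fun i => (z i).1) (b i) = t i • b i)
    (ht0 : ∀ i, t i = 0 → ∀ j, β (z j).1 * b i (z j).1 = 0) (htb : ∃ C, ∀ i, |t i| ≤ C)
    {g : ℝ → ℝ → ℝ} {lam : ℝ} (hg : ∃ C, ∀ i, |g lam (t i)| ≤ C) (j : κ) (f : G) :
    rkhsComp hG (c j) (f - estimator G g β lam z) =
      b.diag (fun i => 1 - t i * cutoff (g lam) (t i)) (rkhsComp hG (c j) f) -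
      b.diag (fun i => cutoff (g lam) (t i)) ((n : ℝ)⁻¹ • ∑ i, (β (z i).1 *
        inner ℝ (c j) ((z i).2 - f (z i).1)) • featureMap H (z i).1) := by
  have hg' := bounded_cutoff hg
  have hr := bounded_one_sub_mul_cutoff hg htb
  have hC := (b.eq_diag (b.isSymmetric_of_eigen ht) ht).2
  rw [map_sub, rkhsComp_estimator hG β c z ht ht0 hg, rkhsComp_empiricalRHS_sub hG β z (c j) f, hC]
  change _ - b.diag (fun i => cutoff (g lam) (t i)) _ = _
  rw [map_add, ← sub_sub]
  congr 1
  refine b.ext_inner fun i => ?_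
  rw [inner_sub_right, b.inner_diag hg', b.inner_diag htb, b.inner_diag hr]
  ring

/-- The weighted sum of the squared components of the error. -/
theorem sum_norm_diag_error_le (hG : IsScalarKernelExtension H G) (c : HilbertBasis κ ℝ Y)
    (z : Fin n → X × Y) (ht : ∀ i, empiricalCov H β (fun i => (z i).1) (b i) = t i • b i)
    (ht0 : ∀ i, t i = 0 → ∀ j, β (z j).1 * b i (z j).1 = 0) (htb : ∃ C, ∀ i, |t i| ≤ C)
    (htn : ∀ i, 0 ≤ t i) {g : ℝ → ℝ → ℝ} {lam : ℝ} (hl : 0 < lam)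
    (hg : ∃ C, ∀ i, |g lam (t i)| ≤ C) {f : G} {Co : H →L[ℝ] Y} (hCo : IsHilbertSchmidt Co)
    {φμ : ℕ → ℝ} (hf : ∀ y, rkhsComp hG y f = e.diag φμ (ContinuousLinearMap.adjoint Co y))
    {p : ι → ℝ} (hp : ∃ C, ∀ i, |p i| ≤ C) {A Q : ℝ} (hQ : 0 ≤ Q)
    (hA : ∀ v, ‖b.diag (fun i => p i * (1 - t i * cutoff (g lam) (t i))) (e.diag φμ v)‖ ≤ A * ‖v‖)
    (hpQ : ∀ i, p i ^ 2 * cutoff (g lam) (t i) ^ 2 ≤ Q * (t i + lam)⁻¹) (F : Finset κ) :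
    ∑ j ∈ F, ‖b.diag p (rkhsComp hG (c j) (f - estimator G g β lam z))‖ ^ 2 ≤
      2 * (A ^ 2 * ∑' j, ‖ContinuousLinearMap.adjoint Co (c j)‖ ^ 2) +
      2 * (Q * noiseForm H β (fun x => f x) lam z) := by
  have hg' := bounded_cutoff hg
  have hr := bounded_one_sub_mul_cutoff hg htb
  have hpg : ∃ C, ∀ i, |p i * cutoff (g lam) (t i)| ≤ C := by
    obtain ⟨C, hC⟩ := hg'
    obtain ⟨T, hT⟩ := hp
    refine ⟨T * C, fun i => ?_⟩
    rw [abs_mul]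
    have h1 := hT i
    have h2 := hC i
    have h3 := (abs_nonneg _).trans h1
    gcongr
  have hC := (b.eq_diag (b.isSymmetric_of_eigen ht) ht).2
  obtain ⟨-, hR⟩ := isUnit_and_inverse_empiricalCov_add hC htb htn hl
  set ξ : κ → H := fun j => (n : ℝ)⁻¹ • ∑ i, (β (z i).1 *
    inner ℝ (c j) ((z i).2 - f (z i).1)) • featureMap H (z i).1 with hξ
  have hib : ∃ C, ∀ i, |(t i + lam)⁻¹| ≤ C := ⟨_, bounded_inv_add htn hl⟩
  -- The weight `p` is 1 for the norm of `G` and √(t + ωλ) for L₂(q_X). By `hpQ` the weighted filter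
  -- is dominated by Q(Ĉ + λ)⁻¹, so that the variance parts sum to at most Q times the noise form.
  have hterm : ∀ j, ‖b.diag p (rkhsComp hG (c j) (f - estimator G g β lam z))‖ ^ 2 ≤
      2 * (A ^ 2 * ‖ContinuousLinearMap.adjoint Co (c j)‖ ^ 2) + 2 * (Q * inner ℝ (ξ j)
        (empiricalResolvent H β lam (fun i => (z i).1) (ξ j))) := by
    intro j
    rw [rkhsComp_sub_estimator hG c z ht ht0 htb hg j f, map_sub, b.diag_comp hp hr, hf,
      b.diag_comp hp hg']
    set u := b.diag (fun i => p i * (1 - t i * cutoff (g lam) (t i)))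
      (e.diag φμ (ContinuousLinearMap.adjoint Co (c j))) with hu
    set v := b.diag (fun i => p i * cutoff (g lam) (t i)) (ξ j) with hv
    have h1 : ‖u - v‖ ^ 2 ≤ 2 * ‖u‖ ^ 2 + 2 * ‖v‖ ^ 2 := by
      have h2 := norm_sub_le u v
      have h3 : ‖u - v‖ ^ 2 ≤ (‖u‖ + ‖v‖) ^ 2 := by gcongr
      nlinarith [sq_nonneg (‖u‖ - ‖v‖)]
    have h4 : ‖u‖ ^ 2 ≤ A ^ 2 * ‖ContinuousLinearMap.adjoint Co (c j)‖ ^ 2 := by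
      rw [← mul_pow]
      have := hA (ContinuousLinearMap.adjoint Co (c j))
      gcongr
    have h5 : ‖v‖ ^ 2 ≤ Q * inner ℝ (ξ j)
        (empiricalResolvent H β lam (fun i => (z i).1) (ξ j)) := by
      rw [hR]
      refine hasSum_le (fun i => ?_) (b.hasSum_norm_diag_sq hpg (ξ j))
        ((b.hasSum_inner_diag hib (ξ j) (ξ j)).mul_left Q)
      have h6 := mul_le_mul_of_nonneg_right (hpQ i) (sq_nonneg (inner ℝ (b i) (ξ j)))
      nlinarith
    linarith
  refine (Finset.sum_le_sum fun j _ => hterm j).trans ?_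
  rw [Finset.sum_add_distrib, ← Finset.mul_sum, ← Finset.mul_sum, ← Finset.mul_sum,
    ← Finset.mul_sum]
  have hV := hasSum_inner_resolvent_noise (H := H) (β := β) (lam := lam) c (fun x => f x) z
  have h7 : ∑ j ∈ F, inner ℝ (ξ j) (empiricalResolvent H β lam (fun i => (z i).1) (ξ j)) ≤
      noiseForm H β (fun x => f x) lam z := by
    refine sum_le_hasSum F (fun j _ => ?_) hV
    rw [hR]
    exact (b.hasSum_inner_diag hib _ _).nonneg fun i => mul_nonneg
      (inv_nonneg.2 (by linarith [htn i])) (mul_self_nonneg _)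
  have h8 := (hCo.summable_adjoint c).sum_le_tsum F fun j _ => sq_nonneg _
  gcongr

end Residual

section GoodSample

variable {κ ι : Type*} {n : ℕ} {b : HilbertBasis ι ℝ H} {t : ι → ℝ} {f : X → Y}
  {lam ω η V : ℝ} {z : Fin n → X × Y}

/-- On a good sample the resolvent perturbation is at most √(2ω/λ) η at every level s ≥ λ. The
function `r` is left general to serve both the plain and the weighted residual. -/
theorem norm_bias_le (hm : IsWeightedModel pX qX β s e μ)
    (hz : IsGoodSample β e μ f lam ω η V z)
    (hC : empiricalCov H β (fun i => (z i).1) = b.diag t) (htb : ∃ C, ∀ i, |t i| ≤ C)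
    (htn : ∀ i, 0 ≤ t i) (hl : 0 < lam) (hls : lam ≤ s) (hω : 1 ≤ ω) (hη0 : 0 ≤ η)
    (hηs : η ≤ √(ω * lam) / 2) {φ : ℝ → ℝ} (hφ : IsIndexFunction φ) {ν c : ℝ} (hν : 0 < ν)
    (hc : 0 < c) (hcov : ∀ t ∈ Ioc 0 s, ∀ σ ∈ Icc t s, c * (t ^ ν / φ t) ≤ σ ^ ν / φ σ)
    {K : ℝ} (hK : 0 ≤ K) {r : ι → ℝ} (hr : ∀ i, |r i| ≤ K)
    (hrt : ∀ i, 0 < t i → |r i| * t i ^ ν ≤ K * lam ^ ν) (v : H) :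
    ‖b.diag r (e.diag (fun i => φ (μ i)) v)‖ ≤
      biasConst ν c K (φ s) * (φ lam + √(2 * ω / lam) * η) * ‖v‖ := by
  have hcov' := hz.cov
  rw [hC] at hcov'
  have hμ0 := fun i => (hm.eigenvalue_pos i).le
  refine norm_diag_residual_le e b hm.eigenvalue_pos hm.eigenvalue_bounded htn htb hν hl hc
    (by positivity) (fun r' hr' h => ?_) hr hrt hK (fun i => (hφ.pos (hm.eigenvalue_pos i)).le)
    (hφ.pos hl).le (fun i => hφ.mono (hμ0 i) (hm.eigenvalue_le i)) (hφ.pos hm.pos).le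
    (fun i hi => hφ.mono (hμ0 i) hi) (fun i hi => ?_) v
  · exact norm_diag_resolvent_sub_le e b hμ0 hm.eigenvalue_bounded htn htb hl hω hη0 hcov' hηs hr' h
  · have h1 := hcov lam ⟨hl, hls⟩ (μ i) ⟨hi, hm.eigenvalue_le i⟩
    have hφl := hφ.pos hl
    have hφi := hφ.pos (hm.eigenvalue_pos i)
    have hlν : 0 < lam ^ ν := by positivity
    rw [Real.div_rpow (hμ0 i) hl.le]
    rw [mul_div_assoc', div_le_div_iff₀ hφl hφi] at h1
    rw [mul_div_assoc', le_div_iff₀ hlν, mul_assoc, inv_mul_eq_div, le_div_iff₀ hc]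
    linarith

end GoodSample

end IsWeightedModel

/-! ### Error bounds on a good sample. -/

namespace IsWeightedModel

theorem enlargedDeviation_eq {ω lam d x : ℝ} (hω : 0 ≤ ω) (hl : 0 < lam) :
    √(2 * ω / lam) * (d * √lam * x) = √2 * √ω * (d * x) := by
  have hsl : 0 < √lam := Real.sqrt_pos.2 hl
  rw [Real.sqrt_div (by positivity), Real.sqrt_mul zero_le_two]
  field_simp

theorem deviation_le_half_sqrt {s CN L φl lam : ℝ} (hL : 0 ≤ L) (hl : 0 < lam) :
    devConst s CN * √lam * (√L * φl) ≤ √(enlargement s CN L φl * lam) / 2 := by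
  have h := (mul_sqrt_le_sqrt_enlargement (s := s) (CN := CN) (φl := φl) hL).1
  have h1 : 1 ≤ enlargement s CN L φl := one_le_enlargement hL
  have hsl : 0 < √lam := Real.sqrt_pos.2 hl
  rw [Real.sqrt_mul (by linarith)]
  nlinarith

theorem sqrt_le_two_mul {L : ℝ} (hL : 1 / 2 ≤ L) : √L ≤ 2 * L := by
  refine Real.sqrt_le_iff.2 ⟨by linarith, ?_⟩
  nlinarith

/-- The enlargement costs √ω ≲ √L, and the deviation carries another √L; together they stay linear
in L. -/
theorem le_enlarged_bias_const {s CN L φl φ₁ : ℝ} (hs : 0 < s) (hL : 1 / 2 ≤ L) (hφ0 : 0 ≤ φl)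
    (hφ : φl ≤ φ₁) :
    φl + √2 * √(enlargement s CN L φl) * (devConst s CN * (√L * φl)) ≤
      (2 + √2 * devConst s CN * √(enlargementConst s CN φ₁)) * (φl * L) := by
  have hL0 : 0 ≤ L := by linarith
  have hd := (devConst_pos (CN := CN) hs).le
  have hE0 : 0 ≤ enlargementConst s CN φ₁ := by unfold enlargementConst; positivity
  have h1 : √(enlargement s CN L φl) ≤ √(enlargementConst s CN φ₁) * √L := by
    rw [← Real.sqrt_mul hE0]
    exact Real.sqrt_le_sqrt (enlargement_le hL hφ0 hφ)
  have h2 : √L * √L = L := Real.mul_self_sqrt hL0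
  calc _ ≤ 2 * L * φl + √2 * (√(enlargementConst s CN φ₁) * √L) * (devConst s CN * (√L * φl)) := by
        refine add_le_add (by nlinarith) ?_
        gcongr
    _ = _ := by linear_combination (√2 * √(enlargementConst s CN φ₁) * devConst s CN * φl) * h2

/-- Multiplying the perturbative bound by a further √ω could produce L^(3/2). If x = √L φ(λ) ≤ 1,
then ω is bounded and that bound suffices; if x ≥ 1, then √ω ≲ x ≤ 2φ(λ)L and the trivial bound k₂
suffices. -/
theorem sqrt_enlargement_mul_min_le {s CN L φl m k₁ k₂ : ℝ} (hs : 0 < s) (hL : 1 / 2 ≤ L)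
    (hφ0 : 0 ≤ φl) (hk₁ : 0 ≤ k₁) (hk₂ : 0 ≤ k₂)
    (h1 : m ≤ k₁ * (φl + √2 * √(enlargement s CN L φl) * (devConst s CN * (√L * φl))))
    (h2 : m ≤ k₂) :
    √(enlargement s CN L φl) * m ≤
      2 * √(2 + 4 * devConst s CN ^ 2) *
        (k₁ * (1 + √2 * devConst s CN * √(2 + 4 * devConst s CN ^ 2)) + k₂) * (φl * L) := by
  have hL0 : 0 ≤ L := by linarith
  have hd := (devConst_pos (CN := CN) hs).le
  set d := devConst s CN
  set w := √(2 + 4 * d ^ 2) with hw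
  have hw0 : 0 ≤ w := Real.sqrt_nonneg _
  set x := √L * φl with hx
  have hx0 : 0 ≤ x := by positivity
  have hx2 : x ^ 2 = L * φl ^ 2 := by rw [hx, mul_pow, Real.sq_sqrt hL0]
  have hxL : x ≤ 2 * (φl * L) := by
    have := mul_le_mul_of_nonneg_right (sqrt_le_two_mul hL) hφ0
    linarith
  have hω : enlargement s CN L φl = 1 + (1 + 4 * d ^ 2) * x ^ 2 := by rw [hx2]; rfl
  have hy : 0 ≤ φl * L := by positivity
  rcases le_total x 1 with hx1 | hx1
  · have h3 : √(enlargement s CN L φl) ≤ w := by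
      refine Real.sqrt_le_sqrt ?_
      rw [hω]
      nlinarith [sq_nonneg d, pow_le_one₀ (n := 2) hx0 hx1]
    have hφL : φl ≤ 2 * (φl * L) := by nlinarith
    calc √(enlargement s CN L φl) * m
        ≤ √(enlargement s CN L φl) * (k₁ * (φl + √2 * √(enlargement s CN L φl) * (d * x))) := by
          gcongr
      _ ≤ w * (k₁ * (2 * (φl * L) + √2 * w * (d * (2 * (φl * L))))) := by gcongr
      _ = 2 * w * (k₁ * (1 + √2 * d * w)) * (φl * L) := by ring
      _ ≤ _ := by gcongr; linarith
  · have h3 : √(enlargement s CN L φl) ≤ w * x := by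
      refine Real.sqrt_le_iff.2 ⟨by positivity, ?_⟩
      rw [mul_pow, hw, Real.sq_sqrt (by positivity), hω]
      nlinarith [sq_nonneg d, one_le_pow₀ (n := 2) hx1]
    calc √(enlargement s CN L φl) * m ≤ √(enlargement s CN L φl) * k₂ := by gcongr
      _ ≤ w * (2 * (φl * L)) * k₂ := by
          gcongr
          exact h3.trans (by gcongr)
      _ = 2 * w * k₂ * (φl * L) := by ring
      _ ≤ _ := by
          have : 0 ≤ k₁ * (1 + √2 * d * w) := by positivity
          gcongr
          linarith

/-- The left side is 5(δ/2)³ = 5δ³/8. -/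
theorem five_mul_exp_le {δ : ℝ} (hδ : δ ∈ Ioo 0 1) :
    5 * Real.exp (-(3 * Real.log (2 / δ))) ≤ δ := by
  obtain ⟨h0, h1⟩ := hδ
  have h2 : Real.exp (-(3 * Real.log (2 / δ))) = (δ / 2) ^ 3 := by
    rw [← Real.exp_log (show 0 < δ / 2 by positivity), ← Real.exp_nat_mul]
    congr 1
    rw [Real.log_div two_ne_zero h0.ne', Real.log_div h0.ne' two_ne_zero]
    push_cast
    ring
  rw [h2]
  have h3 : δ ^ 2 ≤ 1 := pow_le_one₀ h0.le h1.le
  nlinarith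

theorem half_le_log {δ : ℝ} (hδ : δ ∈ Ioo 0 1) : 1 / 2 ≤ Real.log (2 / δ) := by
  have h1 : Real.log 2 ≤ Real.log (2 / δ) := by
    refine Real.log_le_log two_pos ?_
    rw [le_div_iff₀ hδ.1]
    linarith [hδ.2]
  linarith [Real.log_two_gt_d9]

variable {X Y H G : Type*} [MeasurableSpace X]
  [NormedAddCommGroup Y] [InnerProductSpace ℝ Y] [CompleteSpace Y]
  [NormedAddCommGroup H] [InnerProductSpace ℝ H] [CompleteSpace H] [RKHS ℝ H X ℝ]
  [NormedAddCommGroup G] [InnerProductSpace ℝ G] [CompleteSpace G] [RKHS ℝ G X Y]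
  {pX qX : Measure X} [IsProbabilityMeasure pX] [IsProbabilityMeasure qX]
  {β : X → ℝ} {s : ℝ} {e : HilbertBasis ℕ ℝ H} {μ : ℕ → ℝ}

/-- Uniform bounds of a regularization family together with its qualification inequality. -/
structure FilterBounds (s : ℝ) (g : ℝ → ℝ → ℝ) (D Bg ν γν : ℝ) : Prop where
  D_nonneg : 0 ≤ D
  mul_le : ∀ lam ∈ Ioc 0 s, ∀ σ ∈ Ioc 0 s, |σ * g lam σ| ≤ D
  Bg_nonneg : 0 ≤ Bg
  le : ∀ lam ∈ Ioc 0 s, ∀ σ ∈ Ioc 0 s, |g lam σ| ≤ Bg / lam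
  γ_nonneg : 0 ≤ γν
  residual_le : ∀ lam ∈ Ioc 0 s, ∀ σ ∈ Ioc 0 s, |1 - σ * g lam σ| * σ ^ ν ≤ γν * lam ^ ν

theorem FilterBounds.residual_cutoff_le {g : ℝ → ℝ → ℝ} {D Bg ν γν : ℝ}
    (h : FilterBounds s g D Bg ν γν) {lam t : ℝ} (hl : lam ∈ Ioc 0 s) (ht : t ≤ s) (ht0 : 0 < t) :
    |1 - t * cutoff (g lam) t| * t ^ ν ≤ γν * lam ^ ν := by
  rw [cutoff, if_neg ht0.ne']
  exact h.residual_le lam hl t ⟨ht0, ht⟩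

section Bounds

variable {n : ℕ} {g : ℝ → ℝ → ℝ} {φ : ℝ → ℝ} {lam D Bg ν γν c CN L CV bβ k φ₁ : ℝ} {f : G}
  {Co : H →L[ℝ] Y} {ι : Type*} {z : Fin n → X × Y}

theorem bounded_filter (hg : FilterBounds s g D Bg ν γν) (hl : lam ∈ Ioc 0 s) {κ : Type*}
    {t : κ → ℝ} (ht : ∀ i, t i ∈ Icc 0 s) : ∃ C, ∀ i, |g lam (t i)| ≤ C := by
  refine ⟨max |g lam 0| (Bg / lam), fun i => ?_⟩
  rcases (ht i).1.eq_or_lt with h | h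
  · rw [← h]; exact le_max_left _ _
  · exact (hg.le lam hl _ ⟨h, (ht i).2⟩).trans (le_max_right _ _)

/-- The weight is 1. The bias is of order φ(λ)L, and the noise contributes (D + Bg)²/λ times a
multiple of Lλφ(λ)²; since L ≤ 2L², both fit into the square of φ(λ)L. -/
theorem norm_sub_estimator_le (hm : IsWeightedModel pX qX β s e μ)
    (hG : IsScalarKernelExtension H G) (hk : ∀ x, scalarKernel H x x ≤ k ^ 2)
    (hβ : ∀ x, β x ≤ bβ) (hbk : bβ * k ^ 2 ≤ s) (hn : 0 < n) (hφ : IsIndexFunction φ)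
    (hg : FilterBounds s g D Bg ν γν) (hν : 0 < ν) (hc : 0 < c)
    (hcov : ∀ t ∈ Ioc 0 s, ∀ σ ∈ Icc t s, c * (t ^ ν / φ t) ≤ σ ^ ν / φ σ)
    (hCo : IsHilbertSchmidt Co)
    (hf : ∀ y, rkhsComp hG y f =
      e.diag (fun i => φ (μ i)) (ContinuousLinearMap.adjoint Co y))
    (cb : HilbertBasis ι ℝ Y) (hl : lam ∈ Ioc 0 s) (hl1 : lam ≤ 1) (hL : 1 / 2 ≤ L) (hCV : 0 ≤ CV)
    (hz : IsGoodSample β e μ (fun x => f x) lam (enlargement s CN L (φ lam))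
      (devConst s CN * √lam * (√L * φ lam)) (CV * L * (lam * φ lam ^ 2)) z) :
    ‖f - estimator G g β lam z‖ ≤
      √(2 * ((biasConst ν c (1 + D + γν) (φ s) *
        (2 + √2 * devConst s CN * √(enlargementConst s CN (φ 1)))) ^ 2 *
        ∑' j, ‖ContinuousLinearMap.adjoint Co (cb j)‖ ^ 2) + 4 * ((D + Bg) ^ 2 * CV)) *
      (φ lam * L) := by
  have hs := hm.pos
  have hl0 := hl.1
  have hL0 : 0 ≤ L := by linarith
  have hφl := hφ.pos hl0
  have hφs := hφ.pos hs
  have hD := hg.D_nonneg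
  have hB := hg.Bg_nonneg
  have hγ := hg.γ_nonneg
  obtain ⟨w, b, t, ht, htI, ht0⟩ :=
    exists_eigenbasis_empiricalCov hm.weight_nonneg hβ hk hn fun i => (z i).1
  replace htI : ∀ i, t i ∈ Icc 0 s := fun i => ⟨(htI i).1, (htI i).2.trans hbk⟩
  obtain ⟨htb, hC⟩ := b.eq_diag (b.isSymmetric_of_eigen ht) ht
  have hd0 := (devConst_pos (CN := CN) hs).le
  have hω1 : 1 ≤ enlargement s CN L (φ lam) := one_le_enlargement hL0
  set S := ∑' j, ‖ContinuousLinearMap.adjoint Co (cb j)‖ ^ 2 with hS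
  have hS0 : 0 ≤ S := tsum_nonneg fun j => sq_nonneg _
  set K₁ := biasConst ν c (1 + D + γν) (φ s)
  have hK₁ : 0 ≤ K₁ := biasConst_nonneg hν hc (by positivity) hφs.le
  set C₂ := 2 + √2 * devConst s CN * √(enlargementConst s CN (φ 1))
  have hC₂ : 0 ≤ C₂ := by positivity
  have hbias : ∀ v, ‖b.diag (fun i => 1 * (1 - t i * cutoff (g lam) (t i)))
      (e.diag (fun i => φ (μ i)) v)‖ ≤ K₁ * C₂ * (φ lam * L) * ‖v‖ := by
    intro v
    simp only [one_mul]
    have h1 := hm.norm_bias_le hz hC htb (fun i => (htI i).1) hl0 hl.2 hω1 (by positivity)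
      (deviation_le_half_sqrt hL0 hl0) hφ hν hc hcov (K := 1 + D + γν) (by positivity)
      (r := fun i => 1 - t i * cutoff (g lam) (t i))
      (fun i => (abs_one_sub_mul_cutoff_le hD hg.mul_le hl (htI i)).trans (by linarith))
      (fun i hi => (hg.residual_cutoff_le hl (htI i).2 hi).trans (by
        have : 0 ≤ lam ^ ν := by positivity
        gcongr
        linarith)) v
    rw [enlargedDeviation_eq (by linarith) hl0] at h1
    refine h1.trans ?_
    have h2 := le_enlarged_bias_const (CN := CN) hs hL hφl.le (hφ.mono hl0.le hl1)
    calc _ ≤ K₁ * (C₂ * (φ lam * L)) * ‖v‖ := by gcongr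
      _ = _ := by ring
  have hcut : ∀ i, (1 : ℝ) ^ 2 * cutoff (g lam) (t i) ^ 2 ≤
      (D + Bg) ^ 2 / lam * (t i + lam)⁻¹ := by
    intro i
    have h1 := cutoff_mul_sq_le hD hg.mul_le hB hg.le hl (htI i)
    have h2 : lam * cutoff (g lam) (t i) ^ 2 ≤ (D + Bg) ^ 2 * (t i + lam)⁻¹ := by
      refine le_trans ?_ h1
      have := (htI i).1
      gcongr
      linarith
    rw [one_pow, one_mul, div_mul_eq_mul_div, le_div_iff₀ hl0]
    linarith
  have hsum := sum_norm_diag_error_le hG cb z ht ht0 htb (fun i => (htI i).1) hl0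
    (bounded_filter hg hl htI) hCo hf (p := fun _ => 1) ⟨1, fun _ => by simp⟩
    (by positivity) hbias hcut
  have hone : ∀ x, b.diag (fun _ => 1) x = x := fun x => b.ext_inner fun i => by
    rw [b.inner_diag ⟨1, fun _ => by simp⟩, one_mul]
  simp only [hone] at hsum
  have hle : ‖f - estimator G g β lam z‖ ^ 2 ≤
      2 * ((K₁ * C₂ * (φ lam * L)) ^ 2 * S) + 2 * ((D + Bg) ^ 2 / lam *
        (CV * L * (lam * φ lam ^ 2))) := by
    refine hasSum_le_of_sum_le (hasSum_norm_rkhsComp_sq hG cb _) fun F => (hsum F).trans ?_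
    have := hz.noise
    gcongr
  have hfin : ‖f - estimator G g β lam z‖ ^ 2 ≤
      (2 * ((K₁ * C₂) ^ 2 * S) + 4 * ((D + Bg) ^ 2 * CV)) * (φ lam * L) ^ 2 := by
    refine hle.trans ?_
    have h1 : (D + Bg) ^ 2 / lam * (CV * L * (lam * φ lam ^ 2)) =
        (D + Bg) ^ 2 * CV * φ lam ^ 2 * L := by field_simp
    have h2 : L ≤ 2 * L ^ 2 := by nlinarith
    have h3 := mul_le_mul_of_nonneg_left h2
      (show 0 ≤ (D + Bg) ^ 2 * CV * φ lam ^ 2 by positivity)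
    rw [h1]
    nlinarith
  refine abs_le_of_sq_le_sq' ?_ (by positivity) |>.2
  rwa [mul_pow, Real.sq_sqrt (by positivity)]

/-- The squared norm is ∑ⱼ ⟪fⱼ, C fⱼ⟫, and C ≤ C + ωλ ≤ 2(Ĉ + ωλ) on a good sample, hence the weight
√(t + ωλ). The weighted residual has exponent ν - 1/2, which is why covering is required of that
exponent. -/
theorem eLpNorm_sub_estimator_le [SecondCountableTopology Y] (hm : IsWeightedModel pX qX β s e μ)
    (hG : IsScalarKernelExtension H G) (hk : ∀ x, scalarKernel H x x ≤ k ^ 2)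
    (hβ : ∀ x, β x ≤ bβ) (hbk : bβ * k ^ 2 ≤ s) (hn : 0 < n) (hφ : IsIndexFunction φ)
    (hg : FilterBounds s g D Bg ν γν) (hν : 1 / 2 < ν) (hc : 0 < c)
    (hcov : ∀ t ∈ Ioc 0 s, ∀ σ ∈ Icc t s,
      c * (t ^ (ν - 1 / 2) / φ t) ≤ σ ^ (ν - 1 / 2) / φ σ)
    (hCo : IsHilbertSchmidt Co)
    (hf : ∀ y, rkhsComp hG y f =
      e.diag (fun i => φ (μ i)) (ContinuousLinearMap.adjoint Co y))
    (cb : HilbertBasis ι ℝ Y) (hl : lam ∈ Ioc 0 s) (hl1 : lam ≤ 1) (hL : 1 / 2 ≤ L) (hCV : 0 ≤ CV)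
    (hz : IsGoodSample β e μ (fun x => f x) lam (enlargement s CN L (φ lam))
      (devConst s CN * √lam * (√L * φ lam)) (CV * L * (lam * φ lam ^ 2)) z) :
    eLpNorm (fun x => (f - estimator G g β lam z) x) 2 qX ≤ ENNReal.ofReal
      (√(2 * (2 * ((2 * √(2 + 4 * devConst s CN ^ 2) *
        (biasConst (ν - 1 / 2) c (√2 * (1 + D + γν)) (φ s) *
          (1 + √2 * devConst s CN * √(2 + 4 * devConst s CN ^ 2)) +
          √2 * (1 + D + γν) * φ s)) ^ 2 *
        ∑' j, ‖ContinuousLinearMap.adjoint Co (cb j)‖ ^ 2) +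
        2 * (enlargementConst s CN (φ 1) * (D + Bg) ^ 2 * CV))) *
      (√lam * (φ lam * L))) := by
  have hs := hm.pos
  have hl0 := hl.1
  have hL0 : 0 ≤ L := by linarith
  have hφl := hφ.pos hl0
  have hφs := hφ.pos hs
  have hD := hg.D_nonneg
  have hB := hg.Bg_nonneg
  have hγ := hg.γ_nonneg
  have hμ0 := fun i => (hm.eigenvalue_pos i).le
  obtain ⟨w, b, t, ht, htI, ht0⟩ :=
    exists_eigenbasis_empiricalCov hm.weight_nonneg hβ hk hn fun i => (z i).1
  replace htI : ∀ i, t i ∈ Icc 0 s := fun i => ⟨(htI i).1, (htI i).2.trans hbk⟩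
  have htn := fun i => (htI i).1
  obtain ⟨htb, hC⟩ := b.eq_diag (b.isSymmetric_of_eigen ht) ht
  have hd0 := (devConst_pos (CN := CN) hs).le
  set ω := enlargement s CN L (φ lam) with hω
  have hω1 : 1 ≤ ω := one_le_enlargement hL0
  have hωl : 0 < ω * lam := by positivity
  have hsl2 : √lam ^ 2 = lam := Real.sq_sqrt hl0.le
  set S := ∑' j, ‖ContinuousLinearMap.adjoint Co (cb j)‖ ^ 2 with hS
  have hS0 : 0 ≤ S := tsum_nonneg fun j => sq_nonneg _
  set K := √2 * (1 + D + γν) with hK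
  have hK0 : 0 ≤ K := by positivity
  set K₁ := biasConst (ν - 1 / 2) c K (φ s) with hK₁def
  have hK₁ : 0 ≤ K₁ := biasConst_nonneg (by linarith) hc hK0 hφs.le
  set C₃ := 2 * √(2 + 4 * devConst s CN ^ 2) *
    (K₁ * (1 + √2 * devConst s CN * √(2 + 4 * devConst s CN ^ 2)) + K * φ s) with hC₃
  set p : w → ℝ := fun i => √(t i + ω * lam) with hp
  set r : w → ℝ := fun i => p i * (1 - t i * cutoff (g lam) (t i)) with hr
  have hres : ∀ i, |r i| ≤ K * (√ω * √lam) ∧ (0 < t i → |r i| * t i ^ (ν - 1 / 2) ≤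
      K * (√ω * √lam) * lam ^ (ν - 1 / 2)) := fun i =>
    sqrt_add_mul_residual_le hl0 (htn i) hω1 hν hγ (by positivity : 0 ≤ 1 + D)
      (abs_one_sub_mul_cutoff_le hD hg.mul_le hl (htI i))
      (fun hi => hg.residual_cutoff_le hl (htI i).2 hi)
  have hηs := deviation_le_half_sqrt (s := s) (CN := CN) (φl := φ lam) hL0 hl0
  have hbias : ∀ v, ‖b.diag r (e.diag (fun i => φ (μ i)) v)‖ ≤
      C₃ * (√lam * (φ lam * L)) * ‖v‖ := by
    intro v
    have h1 := hm.norm_bias_le hz hC htb htn hl0 hl.2 hω1 (by positivity) hηs hφ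
      (by linarith : 0 < ν - 1 / 2) hc hcov (K := K * (√ω * √lam)) (by positivity)
      (fun i => (hres i).1) (fun i => (hres i).2) v
    rw [enlargedDeviation_eq (by linarith) hl0, biasConst_mul] at h1
    have h2 : ‖b.diag r (e.diag (fun i => φ (μ i)) v)‖ ≤ √ω * √lam * (K * φ s) * ‖v‖ := by
      refine (b.norm_diag_le (by positivity) (fun i => (hres i).1) _).trans ?_
      have h3 := e.norm_diag_le hφs.le (f := fun i => φ (μ i)) (fun i => by
        rw [abs_of_pos (hφ.pos (hm.eigenvalue_pos i))]
        exact hφ.mono (hμ0 i) (hm.eigenvalue_le i)) v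
      calc _ ≤ K * (√ω * √lam) * (φ s * ‖v‖) := by gcongr
        _ = _ := by ring
    -- The perturbative bound competes with the trivial one, which uses only sup |r| and φ(μᵢ) ≤
    -- φ(s).
    set m := min (K₁ * (φ lam + √2 * √ω * (devConst s CN * (√L * φ lam)))) (K * φ s) with hmdef
    have h4 : ‖b.diag r (e.diag (fun i => φ (μ i)) v)‖ ≤ √ω * m * (√lam * ‖v‖) := by
      rcases min_choice (K₁ * (φ lam + √2 * √ω * (devConst s CN * (√L * φ lam)))) (K * φ s)
        with h | h
      · rw [hmdef, h]
        exact h1.trans (le_of_eq (by ring))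
      · rw [hmdef, h]
        exact h2.trans (le_of_eq (by ring))
    have h5 := sqrt_enlargement_mul_min_le (m := m) hs hL hφl.le hK₁
      (by positivity : 0 ≤ K * φ s) (min_le_left _ _) (min_le_right _ _)
    calc _ ≤ _ := h4
      _ ≤ C₃ * (φ lam * L) * (√lam * ‖v‖) := mul_le_mul_of_nonneg_right h5 (by positivity)
      _ = _ := by ring
  have hcut : ∀ i, p i ^ 2 * cutoff (g lam) (t i) ^ 2 ≤
      ω * (D + Bg) ^ 2 * (t i + lam)⁻¹ := by
    intro i
    have h1 := cutoff_mul_sq_le hD hg.mul_le hB hg.le hl (htI i)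
    have h0 := htn i
    rw [hp, Real.sq_sqrt (by positivity)]
    have h2 : t i + ω * lam ≤ ω * (t i + lam) := by nlinarith
    calc _ ≤ ω * (t i + lam) * cutoff (g lam) (t i) ^ 2 := by gcongr
      _ = ω * ((t i + lam) * cutoff (g lam) (t i) ^ 2) := by ring
      _ ≤ ω * ((D + Bg) ^ 2 * (t i + lam)⁻¹) := by gcongr
      _ = _ := by ring
  have hsum := sum_norm_diag_error_le hG cb z ht ht0 htb htn hl0
    (bounded_filter hg hl htI) hCo hf (p := p) (bounded_sqrt_add htb _)
    (by positivity) hbias hcut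
  have hcov' := hz.cov
  rw [hC] at hcov'
  have hcmp := norm_sq_diag_sqrt_add_le e b hμ0 hm.eigenvalue_bounded htn htb hωl hcov' hηs
  have hE0 : 0 ≤ enlargementConst s CN (φ 1) := by unfold enlargementConst; positivity
  refine hm.eLpNorm_le_of_sum_le hG cb _ (by positivity) fun F => ?_
  have hωL : ω ≤ enlargementConst s CN (φ 1) * L :=
    enlargement_le hL hφl.le (hφ.mono hl0.le hl1)
  calc _ ≤ ∑ j ∈ F, 2 * ‖b.diag p (rkhsComp hG (cb j) (f - estimator G g β lam z))‖ ^ 2 := by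
        refine Finset.sum_le_sum fun j _ => le_trans ?_ (hcmp _)
        rw [norm_sq_diag_sqrt_add e hμ0 hm.eigenvalue_bounded hωl]
        have : 0 ≤ ω * lam * ‖rkhsComp hG (cb j) (f - estimator G g β lam z)‖ ^ 2 := by positivity
        linarith
    _ ≤ 2 * (2 * ((C₃ * (√lam * (φ lam * L))) ^ 2 * S) +
        2 * (ω * (D + Bg) ^ 2 * (CV * L * (lam * φ lam ^ 2)))) := by
        rw [← Finset.mul_sum]
        refine mul_le_mul_of_nonneg_left ((hsum F).trans ?_) zero_le_two
        have := hz.noise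
        gcongr
    _ ≤ 2 * (2 * ((C₃ * (√lam * (φ lam * L))) ^ 2 * S) +
        2 * (enlargementConst s CN (φ 1) * L * (D + Bg) ^ 2 * (CV * L * (lam * φ lam ^ 2)))) := by
        gcongr
    _ = _ := by
        rw [mul_pow √(_), Real.sq_sqrt (by positivity)]
        simp only [mul_pow, hsl2]
        ring

end Bounds

end IsWeightedModel

/-! ### Assembly of the theorem. -/

/-- The total mass gives 1 = q_X(X) ≤ b. -/
theorem weight_bound_pos {X : Type*} [MeasurableSpace X] {pX qX : Measure X}
    [IsProbabilityMeasure pX] [IsProbabilityMeasure qX] {β : X → ℝ}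
    (hq : qX = pX.withDensity fun x => ENNReal.ofReal (β x)) {b : ℝ} (hβb : ∀ x, β x ≤ b) :
    0 < b := by
  have h1 : qX univ ≤ ENNReal.ofReal b := by
    rw [hq, withDensity_apply _ MeasurableSet.univ, setLIntegral_univ]
    calc _ ≤ ∫⁻ _, ENNReal.ofReal b ∂pX :=
          lintegral_mono fun x => ENNReal.ofReal_le_ofReal (hβb x)
      _ = _ := by simp
  rw [measure_univ] at h1
  by_contra hcon
  rw [ENNReal.ofReal_of_nonpos (not_lt.1 hcon)] at h1
  exact absurd h1 (by simp)

end

theorem mainTheorem3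
    -- input space, output space, scalar RKHS `H`, vector-valued RKHS `G` with kernel `k · Id_Y`
    {X Y H G : Type*} [MeasurableSpace X]
    [NormedAddCommGroup Y] [InnerProductSpace ℝ Y] [CompleteSpace Y]
    [SecondCountableTopology Y] [MeasurableSpace Y] [BorelSpace Y]
    [NormedAddCommGroup H] [InnerProductSpace ℝ H] [CompleteSpace H] [RKHS ℝ H X ℝ]
    [NormedAddCommGroup G] [InnerProductSpace ℝ G] [CompleteSpace G] [RKHS ℝ G X Y]
    (hG : ∀ x t, RKHS.kernel G x t = scalarKernel H x t • ContinuousLinearMap.id ℝ Y)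
    (hmeas : ∀ t, Measurable fun x => scalarKernel H x t)
    -- bounded kernel
    (κ : ℝ) (hκ : ∀ x, scalarKernel H x x ≤ κ ^ 2)
    -- covariate shift: source `p = p_X ⊗ 𝒦`, target marginal `dq_X = β dp_X` with bounded `β`
    (pX qX : Measure X) [IsProbabilityMeasure pX] [IsProbabilityMeasure qX]
    (𝒦 : ProbabilityTheory.Kernel X Y) [ProbabilityTheory.IsMarkovKernel 𝒦]
    (β : X → ℝ) (hβm : Measurable β) (hβ0 : ∀ x, 0 ≤ β x)
    (hq : qX = pX.withDensity fun x => ENNReal.ofReal (β x))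
    (b : ℝ) (hβb : ∀ x, β x ≤ b)
    -- bounded outputs
    (M' : ℝ) (hM' : ∀ᵐ w ∂(pX ⊗ₘ 𝒦), ‖w.2‖ ≤ M')
    -- the regression function lies in `G` and satisfies the general source condition
    (φ : ℝ → ℝ) (hφ : IsIndexFunction φ)
    (fstar : G) (hfstar : ∀ᵐ x ∂qX, fstar x = regressionFunction 𝒦 x)
    (hsource : SourceCondition H qX φ fstar)
    -- polynomial eigenvalue decay
    (a : ℝ) (ha : 1 < a) (e : HilbertBasis ℕ ℝ H) (μ : ℕ → ℝ)
    (hμ0 : ∀ i, 0 < μ i) (he : ∀ i, covarianceOp H qX (e i) = μ i • e i)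
    (hμ : ∃ l > 0, ∃ u > 0, ∀ i : ℕ,
      l * ((i : ℝ) + 1) ^ (-a) ≤ μ i ∧ μ i ≤ u * ((i : ℝ) + 1) ^ (-a))
    -- regularization family on `[0, s]`, which contains the spectra of the empirical operators
    (s : ℝ) (hs : b * κ ^ 2 ≤ s) (g : ℝ → ℝ → ℝ) (hg : IsRegularizationFamily s g) :
    -- "with probability at least `1 - δ`" is stated as: the exceptional set of samples has (outer)
    -- measure at most `δ`
    (∀ ν, QualificationHolds s g ν → Covers s ν φ →
      ∃ c₁ > 0, ∀ (n : ℕ) (δ lam : ℝ), 0 < n → δ ∈ Ioo 0 1 →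
        lam ∈ Ioc 0 1 → lam ≤ s → lam = psiInv φ a ((n : ℝ) ^ (-(1 / 2) : ℝ)) →
        Measure.pi (fun _ : Fin n => pX ⊗ₘ 𝒦)
          {z | ¬ ‖fstar - estimator G g β lam z‖ ≤
            c₁ * φ (psiInv φ a ((n : ℝ) ^ (-(1 / 2) : ℝ))) * Real.log (2 / δ)} ≤
          ENNReal.ofReal δ) ∧
    (∀ ν, QualificationHolds s g ν → Covers s ν (fun t => φ t * √t) →
      ∃ c₂ > 0, ∀ (n : ℕ) (δ lam : ℝ), 0 < n → δ ∈ Ioo 0 1 →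
        lam ∈ Ioc 0 1 → lam ≤ s → lam = psiInv φ a ((n : ℝ) ^ (-(1 / 2) : ℝ)) →
        Measure.pi (fun _ : Fin n => pX ⊗ₘ 𝒦)
          {z | ¬ eLpNorm (fun x => regressionFunction 𝒦 x - estimator G g β lam z x) 2 qX ≤
            ENNReal.ofReal (c₂ * √(psiInv φ a ((n : ℝ) ^ (-(1 / 2) : ℝ))) *
              φ (psiInv φ a ((n : ℝ) ^ (-(1 / 2) : ℝ))) * Real.log (2 / δ))} ≤
          ENNReal.ofReal δ) := by
  have hb : 0 < b := weight_bound_pos hq hβb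
  obtain ⟨l, -, u, hu, hlu⟩ := hμ
  have hG' : IsScalarKernelExtension H G := hG
  have hm : IsWeightedModel pX qX β s e μ :=
    { measurable_kernel := hmeas
      bounded_kernel := ⟨κ, hκ⟩
      measurable_weight := hβm
      weight_nonneg := hβ0
      density := hq
      weight_mul_le := fun x => by
        refine le_trans ?_ hs
        rw [norm_featureMap_sq]
        calc β x * scalarKernel H x x ≤ β x * κ ^ 2 := mul_le_mul_of_nonneg_left (hκ x) (hβ0 x)
          _ ≤ b * κ ^ 2 := mul_le_mul_of_nonneg_right (hβb x) (sq_nonneg κ)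
      eigenvalue_pos := hμ0
      eigen := he }
  have hs0 := hm.pos
  obtain ⟨hfm, Co, hCo, hf⟩ := hm.exists_source hφ hG' hsource
  obtain ⟨w, cb, -⟩ := exists_hilbertBasis ℝ Y
  obtain ⟨⟨D, hD0, hD⟩, ⟨Bg, hBg0, hBg⟩⟩ := hg
  set CN := effDimConst u a
  have hCN : 0 < CN := effDimConst_pos hu ha
  have hN : ∀ lam ∈ Ioc (0 : ℝ) 1, ∀ r, lam ≤ r → ∀ n,
      ∑ i ∈ Finset.range n, μ i / (μ i + r) ≤ CN * lam ^ (-(1 / a)) := fun lam hl r hr n =>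
    sum_div_add_le ha hu hμ0 (fun i => (hlu i).2) hl hr n
  -- The given bound `M'` may be 0, whereas the noise estimate divides by the square of its bound.
  set M := max M' 1
  have hM0 : 0 < M := lt_max_of_lt_right one_pos
  have hM : ∀ᵐ w ∂(pX ⊗ₘ 𝒦), ‖w.2‖ ≤ M := by
    filter_upwards [hM'] with w hw using hw.trans (le_max_left _ _)
  set CV := IsWeightedModel.noiseConst s CN b M (φ 1) with hCVdef
  have hE0 : 0 ≤ IsWeightedModel.enlargementConst s CN (φ 1) := by
    unfold IsWeightedModel.enlargementConst
    positivity
  have hCV : 0 ≤ CV := by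
    rw [hCVdef]
    unfold IsWeightedModel.noiseConst
    positivity
  have hbad : ∀ (n : ℕ) (δ lam : ℝ), 0 < n → δ ∈ Ioo 0 1 → lam ∈ Ioc 0 1 →
      lam = psiInv φ a ((n : ℝ) ^ (-(1 / 2) : ℝ)) →
      Measure.pi (fun _ : Fin n => pX ⊗ₘ 𝒦)
        {z | ¬ IsWeightedModel.IsGoodSample β e μ (fun x => fstar x) lam
          (IsWeightedModel.enlargement s CN (Real.log (2 / δ)) (φ lam))
          (IsWeightedModel.devConst s CN * √lam * (√(Real.log (2 / δ)) * φ lam))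
          (CV * Real.log (2 / δ) * (lam * φ lam ^ 2)) z} ≤ ENNReal.ofReal δ := by
    intro n δ lam hn hδ hl hlam
    refine (hm.measure_not_isGoodSample_le hG' 𝒦 hβb hb hfm.measurable hfstar hM0 hM ha hCN hN hn hl
      (hφ.pos hl.1) (hφ.mono hl.1.le hl.2) (IsWeightedModel.half_le_log hδ)
      (inv_eq_of_eq_psiInv hφ ha hl.1 hlam)).trans ?_
    exact ENNReal.ofReal_le_ofReal (IsWeightedModel.five_mul_exp_le hδ)
  refine ⟨fun ν hν hcov => ?_, fun ν hν hcov => ?_⟩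
  · obtain ⟨hν0, γν, hγ0, hγ⟩ := hν
    obtain ⟨c, hc, hcov⟩ := hcov
    have hfb : IsWeightedModel.FilterBounds s g D Bg ν γν :=
      ⟨hD0.le, hD, hBg0.le, hBg, hγ0.le, hγ⟩
    -- The final `+ 1` makes the constant strictly positive.
    refine ⟨√(2 * ((biasConst ν c (1 + D + γν) (φ s) *
      (2 + √2 * IsWeightedModel.devConst s CN *
        √(IsWeightedModel.enlargementConst s CN (φ 1)))) ^ 2 *
      ∑' j, ‖ContinuousLinearMap.adjoint Co (cb j)‖ ^ 2) + 4 * ((D + Bg) ^ 2 * CV)) + 1,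
      add_pos_of_nonneg_of_pos (Real.sqrt_nonneg _) one_pos,
      fun n δ lam hn hδ hl hls hlam => ?_⟩
    refine le_trans (measure_mono fun z hz => ?_) (hbad n δ lam hn hδ hl hlam)
    rw [mem_ofPred_eq] at hz ⊢
    refine fun hgood => hz ?_
    have hL := IsWeightedModel.half_le_log hδ
    rw [← hlam, add_mul, add_mul]
    refine (hm.norm_sub_estimator_le hG' hκ hβb hs hn hφ hfb hν0 hc hcov hCo hf cb ⟨hl.1, hls⟩ hl.2
      hL hCV hgood).trans ?_
    rw [← mul_assoc]
    have := hφ.pos hl.1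
    exact le_add_of_nonneg_right (by positivity)
  -- Covering φ(t)√t forces ν > 1/2, and ν - 1/2 then covers φ; the bias argument runs with this
  -- smaller positive exponent.
  · have hν2 := hcov.half_lt hφ hs0
    obtain ⟨c, hc, hcov⟩ := hcov.sub_half
    obtain ⟨hν0, γν, hγ0, hγ⟩ := hν
    have hfb : IsWeightedModel.FilterBounds s g D Bg ν γν :=
      ⟨hD0.le, hD, hBg0.le, hBg, hγ0.le, hγ⟩
    refine ⟨√(2 * (2 * ((2 * √(2 + 4 * IsWeightedModel.devConst s CN ^ 2) *
      (biasConst (ν - 1 / 2) c (√2 * (1 + D + γν)) (φ s) *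
        (1 + √2 * IsWeightedModel.devConst s CN * √(2 + 4 * IsWeightedModel.devConst s CN ^ 2)) +
        √2 * (1 + D + γν) * φ s)) ^ 2 *
      ∑' j, ‖ContinuousLinearMap.adjoint Co (cb j)‖ ^ 2) +
      2 * (IsWeightedModel.enlargementConst s CN (φ 1) * (D + Bg) ^ 2 * CV))) + 1,
      add_pos_of_nonneg_of_pos (Real.sqrt_nonneg _) one_pos,
      fun n δ lam hn hδ hl hls hlam => ?_⟩
    refine le_trans (measure_mono fun z hz => ?_) (hbad n δ lam hn hδ hl hlam)
    rw [mem_ofPred_eq] at hz ⊢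
    refine fun hgood => hz ?_
    have hL := IsWeightedModel.half_le_log hδ
    have hcongr : (fun x => regressionFunction 𝒦 x - estimator G g β lam z x) =ᵐ[qX]
        fun x => (fstar - estimator G g β lam z) x := by
      filter_upwards [hfstar] with x hx
      rw [← hx]
      simp
    rw [← hlam, eLpNorm_congr_ae hcongr, mul_assoc, mul_assoc, add_mul]
    refine (hm.eLpNorm_sub_estimator_le hG' hκ hβb hs hn hφ hfb hν2 hc hcov hCo hf cb ⟨hl.1, hls⟩
      hl.2 hL hCV hgood).trans (ENNReal.ofReal_le_ofReal ?_)
    have := hφ.pos hl.1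
    exact le_add_of_nonneg_right (by positivity)
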